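/- Theorem 1.5 (lower bound on the threshold for Simonovits's theorem in $G_{n,p}$). All graphs are finite and simple. For a graph $F$, write $v_F$, $e_F$ and $\chi(F)$ for its numbers of vertices and edges and its chromatic number. A graph $H$ is *edge-critical* if $\chi(H\setminus e)=\chi(H)-1$ for some edge $e$ of $H$. For a graph $H$ with at least two edges, let $$m_2(H)=\max\Big\{\frac{e_F-1}{v_F-2} : F\subseteq H,\ e_F\ge 2\Big\};$$ $H$ is *strictly $2$-balanced* if this maximum is attained at $F=H$ and at no other subgraph $F \subseteq H$. A graph $G$ is *$H$-Simonovits* if every $H$-free subgraph of $G$ with the largest possible number of edges is $(\chi(H)-1)$-partite. Let $K_r(m)^+$ be the complete $r$-partite graph with $r$ parts of size $m$ together with one additional edge inside one of the parts, and let $\mathrm{Cop}(H,G)$ be the number of (unlabelled) copies of $H$ in $G$. Let $H$ be a nonbipartite, edge-critical, strictly $2$-balanced graph. The limit $$\pi_H=\lim_{m\to\infty}\frac{\mathrm{Cop}\big(H,K_{\chi(H)-1}(m)^+\big)}{m^{v_H-2}}$$ exists and is positive, and there is a unique positive real $\theta_H$ satisfying $$(\chi(H)-1)^{2-v_H}\cdot\pi_H\cdot\theta_H^{\,e_H-1}=2-\frac1{m_2(H)}.$$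 Let $\varepsilon>0$ be a constant and let $p=p(n)\in[0,1]$ satisfy $pn\to\infty$ as $n\to\infty$ and, for all sufficiently large $n$, $$p\le(\theta_H-\varepsilon)\cdot n^{-1/m_2(H)}\cdot(\log n)^{1/(e_H-1)}.$$ Then, with probability tending to $1$ as $n\to\infty$, the binomial random graph $G_{n,p}$ is not $H$-Simonovits, that is, some largest $H$-free subgraph of $G_{n,p}$ is not $(\chi(H)-1)$-partite. -/

import Mathlib

open Filter Topology Asymptotics

noncomputable section

namespace SimpleGraph

/-- `χ(H) - 1` as a natural number (used for finite graphs `H` with at least one vertex). -/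
def chromaticPred {V : Type*} (H : SimpleGraph V) : ℕ :=
  H.chromaticNumber.toNat - 1

/-- `H` is edge-critical: deleting some edge lowers the chromatic number by exactly one. -/
def IsEdgeCritical {V : Type*} (H : SimpleGraph V) : Prop :=
  ∃ e ∈ H.edgeSet, (H.deleteEdges {e}).chromaticNumber + 1 = H.chromaticNumber

/-- The ratio `(e_F - 1) / (v_F - 2)` of a subgraph `F` (used only when `e_F ≥ 2`, so `v_F ≥ 3`). -/
def edgeVertexRatio {V : Type*} {H : SimpleGraph V} (F : H.Subgraph) : ℝ :=
  ((F.edgeSet.ncard : ℝ) - 1) / ((F.verts.ncard : ℝ) - 2)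

/-- The `2`-density `m₂(H)`: the maximum of `(e_F - 1) / (v_F - 2)` over all subgraphs `F ⊆ H`
with `e_F ≥ 2` (a maximum over a finite set when `H` is finite). -/
def twoDensity {V : Type*} (H : SimpleGraph V) : ℝ :=
  sSup (edgeVertexRatio '' {F : H.Subgraph | 2 ≤ F.edgeSet.ncard})

/-- `H` is strictly `2`-balanced: the maximum that defines `m₂(H)` is attained at `F = H`, and
only there. -/
def IsStrictlyTwoBalanced {V : Type*} (H : SimpleGraph V) : Prop :=
  2 ≤ H.edgeSet.ncard ∧
    ∀ F : H.Subgraph, 2 ≤ F.edgeSet.ncard → F ≠ ⊤ →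
      edgeVertexRatio F < edgeVertexRatio (⊤ : H.Subgraph)

/-- `K_r(m)⁺`: the complete `r`-partite graph with parts `{i} × Fin m`, together with one
additional edge, joining the vertices `(0, 0)` and `(0, 1)` of the first part (this extra edge is
there as soon as `1 ≤ r` and `2 ≤ m`). -/
def equipartitePlus (r m : ℕ) : SimpleGraph (Fin r × Fin m) :=
  completeEquipartiteGraph r m ⊔
    fromRel fun u v ↦ (u.1 : ℕ) = 0 ∧ (u.2 : ℕ) = 0 ∧ (v.1 : ℕ) = 0 ∧ (v.2 : ℕ) = 1

/-- The normalised number of (unlabelled) copies of `H` in `K_{χ(H)-1}(m)⁺`, namely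
`Cop(H, K_{χ(H)-1}(m)⁺) / m ^ (v_H - 2)`. -/
def copyRatio {V : Type*} (H : SimpleGraph V) (m : ℕ) : ℝ :=
  ((equipartitePlus H.chromaticPred m).copyCount H : ℝ) / (m : ℝ) ^ ((Nat.card V : ℤ) - 2)

/-- The constant `π_H`, the limit of `copyRatio H m` as `m → ∞`. -/
def piConst {V : Type*} (H : SimpleGraph V) : ℝ :=
  limUnder atTop (copyRatio H)

/-- The constant `θ_H`: the positive real `θ` with
`(χ(H) - 1) ^ (2 - v_H) * π_H * θ ^ (e_H - 1) = 2 - 1 / m₂(H)`. -/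
def thetaConst {V : Type*} (H : SimpleGraph V) : ℝ :=
  ((2 - 1 / H.twoDensity) / ((H.chromaticPred : ℝ) ^ (2 - (Nat.card V : ℤ)) * H.piConst)) ^
    (1 / ((H.edgeSet.ncard : ℝ) - 1))

/-- `F` is a largest `H`-free subgraph of `G`: it has the maximum number of edges among the
`H`-free subgraphs of `G`. -/
def IsLargestFreeSubgraph {V W : Type*} (F G : SimpleGraph W) (H : SimpleGraph V) : Prop :=
  F ≤ G ∧ H.Free F ∧
    ∀ F' : SimpleGraph W, F' ≤ G → H.Free F' → F'.edgeSet.ncard ≤ F.edgeSet.ncard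

/-- `G` is `H`-Simonovits: each largest `H`-free subgraph of `G` is `(χ(H) - 1)`-partite. -/
def IsSimonovits {V W : Type*} (G : SimpleGraph W) (H : SimpleGraph V) : Prop :=
  ∀ F : SimpleGraph W, F.IsLargestFreeSubgraph G H → F.Colorable H.chromaticPred

end SimpleGraph

end

/-!
# The random graph is not `H`-Simonovits below the threshold

Write `r = χ(H) - 1`, and let `S` be the edge set of `H`.

If a graph is `H`-Simonovits, then its largest `H`-free subgraphs have the size of a maximum
`r`-cut. Hence every edge inside a part of a maximum cut *closes* a copy of `H`: the edge and the
edges of the cut contain a copy through that edge. Such a graph is called *saturated*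
(`IsSaturated`, `isSaturated_of_isSimonovits`). It is enough to show that the random graph is
unlikely to be saturated. To make the maximum cut a function of the graph, ties are broken by a
fixed enumeration (`maxCut`).

If copies of `H` are much rarer than edges, there are simply too few copies to serve all the edges
inside the parts (`pr_isSaturated_le_of_sparse`). Otherwise the argument is a *switching*. From a
saturated graph `E` and a typical edge `e` inside a part, delete one edge from each copy that `e`
closes. In the resulting graph `E \ R` the edge `e` closes nothing, and there are only
polylogarithmically many such edges, because few copies were destroyed (in the formal statements,
at most a small power of `n`). Conversely, `R` can be recovered from `E \ R` and `e` as a set of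
missing edges of copies that contain `e` and lack one further edge. If an average edge lies in
`(e_H - 1) Λ / p` such incomplete copies, the reverse operation costs a factor `exp Λ`
(`ex_card_le_of_switching`, `ex_card_good_le`). Here `Λ` is essentially the expected number of
copies closed by an edge, which below the threshold is at most `(2 - 1 / m₂(H) - δ) log n`. There
are about `p n² = n ^ (2 - 1 / m₂(H) + o(1))` edges inside the parts, so the total number of
switchings out of a saturated graph exceeds what can be received, unless saturation is unlikely
(`pr_isSaturated_le`). This is where the equation for `θ_H` comes from.

Two ingredients make this work.

* The switching must not change the maximum cut. Adding edges across the maximum cut never does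
  (`maxCut_union`); as deleting and adding random edges are inverse operations, this shows that
  the maximum cut usually survives the deletion of random cut edges at a given vertex
  (`ex_le_ex_robustness`, `ex_card_fragile_le`). At a vertex where it survives, no nearly maximum
  cut can lose many edges (`mul_card_lost_le`), and uniform edge distribution then shows that
  all nearly maximum cuts agree outside a small set of vertices (`exists_contested`).
* The incomplete copies have to be counted for the maximum cut, which depends on the random graph.
  An upper-tail bound that is uniform over all `r ^ n` cuts is obtained from Chebyshev's inequality
  for the number of all incomplete copies and Janson's inequality for the lower tails of the
  complementary counts (`pr_exists_mean_add_le_cnt`).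

Everything takes place in the space of `p`-random subsets of `Sym2 V`, with elementary finite sums
in place of measures; loops are present but harmless, and are summed out when passing to the
binomial random graph (`binomialRandom_apply_eq`). The constant `π_H` is computed in
`exists_tendsto_copyCount`, and `card_copies_closing_le` shows that it bounds the number of
potential copies that a pair closes in any nearly balanced cut.
-/

set_option linter.unusedSectionVars false

namespace RandomSubset

open Finset

/-! ### Random subsets of a finite set -/

section RandomSets

variable {α : Type*} [Fintype α] [DecidableEq α]

/-- The probability that the `p`-random subset of `α` equals `E`. -/
noncomputable def wt (p : ℝ) (E : Finset α) : ℝ := p ^ #E * (1 - p) ^ #Eᶜ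

/-- The expectation of `f E`, where `E` is the `p`-random subset of `α`. -/
noncomputable def ex (p : ℝ) (f : Finset α → ℝ) : ℝ := ∑ E, wt p E * f E

/-- The probability that the `p`-random subset of `α` belongs to the family `S`. -/
noncomputable def pr (p : ℝ) (S : Set (Finset α)) : ℝ := ex p (S.indicator 1)

variable {p : ℝ}

lemma wt_nonneg (h0 : 0 ≤ p) (h1 : p ≤ 1) (E : Finset α) : 0 ≤ wt p E :=
  mul_nonneg (pow_nonneg h0 _) (pow_nonneg (by linarith) _)

/-- The generating function of the random set: its elements are independent. -/
lemma ex_prod (p : ℝ) (x : α → ℝ) :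
    ex p (fun E ↦ ∏ a ∈ E, x a) = ∏ a, (1 - p + p * x a) := by
  simp_rw [add_comm (1 - p), Finset.prod_add, ex, wt, prod_mul_distrib, prod_const]
  refine sum_congr rfl fun E _ ↦ by rw [compl_eq_univ_sdiff]; ring

lemma ex_one (p : ℝ) : ex p (fun _ : Finset α ↦ 1) = 1 := by
  simpa using ex_prod p (fun _ : α ↦ 1)

lemma sum_wt (p : ℝ) : ∑ E : Finset α, wt p E = 1 := by simpa [ex] using ex_one (α := α) p

lemma ex_const (p c : ℝ) : ex p (fun _ : Finset α ↦ c) = c := by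
  rw [ex, ← sum_mul, sum_wt, one_mul]

lemma ex_mono (h0 : 0 ≤ p) (h1 : p ≤ 1) {f g : Finset α → ℝ} (h : ∀ E, f E ≤ g E) :
    ex p f ≤ ex p g :=
  sum_le_sum fun E _ ↦ mul_le_mul_of_nonneg_left (h E) (wt_nonneg h0 h1 E)

lemma ex_nonneg (h0 : 0 ≤ p) (h1 : p ≤ 1) {f : Finset α → ℝ} (h : ∀ E, 0 ≤ f E) : 0 ≤ ex p f :=
  sum_nonneg fun E _ ↦ mul_nonneg (wt_nonneg h0 h1 E) (h E)

lemma ex_add (p : ℝ) (f g : Finset α → ℝ) : ex p (fun E ↦ f E + g E) = ex p f + ex p g := by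
  simp [ex, mul_add, sum_add_distrib]

lemma ex_sub (p : ℝ) (f g : Finset α → ℝ) : ex p (fun E ↦ f E - g E) = ex p f - ex p g := by
  simp [ex, mul_sub, sum_sub_distrib]

lemma ex_mul_left (p c : ℝ) (f : Finset α → ℝ) : ex p (fun E ↦ c * f E) = c * ex p f := by
  simp only [ex, mul_sum]
  exact sum_congr rfl fun E _ ↦ by ring

lemma ex_sum {ι : Type*} (p : ℝ) (s : Finset ι) (f : ι → Finset α → ℝ) :
    ex p (fun E ↦ ∑ i ∈ s, f i E) = ∑ i ∈ s, ex p (f i) := by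
  simp only [ex, mul_sum]
  exact sum_comm

lemma pr_nonneg (h0 : 0 ≤ p) (h1 : p ≤ 1) (S : Set (Finset α)) : 0 ≤ pr p S :=
  ex_nonneg h0 h1 fun E ↦ Set.indicator_nonneg (fun _ _ ↦ zero_le_one) E

lemma pr_mono (h0 : 0 ≤ p) (h1 : p ≤ 1) {S T : Set (Finset α)} (h : S ⊆ T) : pr p S ≤ pr p T :=
  ex_mono h0 h1 fun E ↦ Set.indicator_le_indicator_of_subset h (fun _ ↦ zero_le_one) E

lemma pr_univ (p : ℝ) : pr p (Set.univ : Set (Finset α)) = 1 := by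
  simp only [pr, Set.indicator_univ]; exact ex_one p

lemma pr_le_one (h0 : 0 ≤ p) (h1 : p ≤ 1) (S : Set (Finset α)) : pr p S ≤ 1 :=
  (pr_mono h0 h1 (Set.subset_univ S)).trans_eq (pr_univ p)

lemma pr_union_le (h0 : 0 ≤ p) (h1 : p ≤ 1) (S T : Set (Finset α)) :
    pr p (S ∪ T) ≤ pr p S + pr p T := by
  rw [pr, pr, pr, ← ex_add]
  refine ex_mono h0 h1 fun E ↦ ?_
  by_cases hS : E ∈ S <;> by_cases hT : E ∈ T <;> simp [hS, hT]

lemma pr_compl (p : ℝ) (S : Set (Finset α)) : pr p Sᶜ = 1 - pr p S := by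
  rw [pr, pr, ← ex_one (α := α) p, ← ex_sub]
  congr 1; ext E
  by_cases hS : E ∈ S <;> simp [hS]

/-- **Markov's inequality**. -/
lemma pr_le_div (h0 : 0 ≤ p) (h1 : p ≤ 1) {f : Finset α → ℝ} (hf : ∀ E, 0 ≤ f E) {c : ℝ}
    (hc : 0 < c) : pr p {E | c ≤ f E} ≤ ex p f / c := by
  rw [le_div_iff₀ hc, mul_comm, pr, ← ex_mul_left]
  refine ex_mono h0 h1 fun E ↦ ?_
  by_cases hE : c ≤ f E <;> simp [Set.indicator, hE, hf E]

lemma pr_iUnion_le {ι : Type*} (h0 : 0 ≤ p) (h1 : p ≤ 1) (s : Finset ι)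
    (S : ι → Set (Finset α)) : pr p {E | ∃ i ∈ s, E ∈ S i} ≤ ∑ i ∈ s, pr p (S i) := by
  simp only [pr]
  rw [← ex_sum]
  refine ex_mono h0 h1 fun E ↦ ?_
  by_cases hE : ∃ i ∈ s, E ∈ S i
  · obtain ⟨i, hi, hiE⟩ := hE
    rw [Set.indicator_of_mem (show E ∈ {E | ∃ i ∈ s, E ∈ S i} from ⟨i, hi, hiE⟩)]
    refine le_trans ?_ (single_le_sum (f := fun i ↦ (S i).indicator (1 : Finset α → ℝ) E)
      (fun j _ ↦ Set.indicator_nonneg (fun _ _ ↦ zero_le_one) E) hi)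
    simp [hiE]
  · rw [Set.indicator_of_notMem (by exact hE)]
    exact sum_nonneg fun j _ ↦ Set.indicator_nonneg (fun _ _ ↦ zero_le_one) E

lemma pr_exists_le {ι : Type*} [Fintype ι] (h0 : 0 ≤ p) (h1 : p ≤ 1)
    (S : ι → Set (Finset α)) {c : ℝ} (hS : ∀ i, pr p (S i) ≤ c) :
    pr p {E | ∃ i, E ∈ S i} ≤ Fintype.card ι * c := by
  have := pr_iUnion_le h0 h1 univ S
  simp only [mem_univ, true_and] at this
  refine this.trans ((sum_le_card_nsmul _ _ c fun i _ ↦ hS i).trans_eq ?_)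
  simp

/-- Removing a subset `R` of the random set amounts to adding a disjoint set `R`, at the cost of
a factor `p / (1 - p)` for each element of `R`. -/
lemma sum_wt_sdiff (h1 : p < 1) (g : Finset α → Finset α → ℝ) :
    ∑ E, wt p E * ∑ R ∈ E.powerset, g (E \ R) R =
      ∑ E, wt p E * ∑ R ∈ Eᶜ.powerset, g E R * (p / (1 - p)) ^ #R := by
  simp_rw [mul_sum]
  rw [sum_sigma', sum_sigma']
  refine sum_nbij' (fun x ↦ ⟨x.1 \ x.2, x.2⟩) (fun x ↦ ⟨x.1 ∪ x.2, x.2⟩) ?_ ?_ ?_ ?_ ?_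
  · rintro ⟨E, R⟩ h
    simp only [mem_sigma, mem_univ, mem_powerset, true_and] at h ⊢
    intro a ha
    simp [ha]
  · rintro ⟨E, R⟩ h
    simp only [mem_sigma, mem_univ, mem_powerset, true_and]
    exact subset_union_right
  · rintro ⟨E, R⟩ h
    simp only [mem_sigma, mem_univ, mem_powerset, true_and] at h
    simp [h]
  · rintro ⟨E, R⟩ h
    simp only [mem_sigma, mem_univ, mem_powerset, true_and] at h
    have : Disjoint E R := by
      rw [disjoint_right]; intro a ha; simpa using h ha
    simp [union_sdiff_cancel_right this]
  · rintro ⟨E, R⟩ h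
    simp only [mem_sigma, mem_univ, mem_powerset, true_and] at h
    have e1 : #E = #(E \ R) + #R := (card_sdiff_add_card_eq_card h).symm
    have e2 : #(E \ R)ᶜ = #Eᶜ + #R := by
      rw [← card_union_of_disjoint]
      · congr 1; ext a; simp; tauto
      · rw [disjoint_right]; intro a ha; simp [h ha]
    have : (1 - p) ^ #R ≠ 0 := pow_ne_zero _ (by linarith)
    simp only [wt]
    rw [e1, e2, pow_add, pow_add, div_pow]
    field_simp

lemma ex_subset_insert (p : ℝ) (a : α) (f : Finset α → ℝ) :
    ex p (fun E ↦ if a ∈ E then f E else 0) = p * ex p (fun E ↦ f (insert a E)) := by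
  have key : ∀ g : Finset α → ℝ, ex p g = ∑ E ∈ (univ.erase a).powerset,
      (wt p E * g E + wt p (insert a E) * g (insert a E)) := by
    intro g
    rw [ex, ← powerset_univ, ← insert_erase (mem_univ a), sum_powerset_insert (notMem_erase a _),
      ← sum_add_distrib]
    simp
  rw [key, key, mul_sum]
  refine sum_congr rfl fun E hE ↦ ?_
  have ha : a ∉ E := fun h ↦ by simpa using mem_powerset.1 hE h
  have e2 : #Eᶜ = #(insert a E)ᶜ + 1 := by
    rw [compl_insert, card_erase_of_mem (by simpa), Nat.sub_add_cancel]
    exact card_pos.2 ⟨a, by simpa⟩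
  simp only [ha, wt, card_insert_of_notMem ha, e2, insert_idem, mem_insert_self, if_true, if_false,
    pow_succ]
  ring

/-- Conditioned on `A ⊆ E`, the random set `E` is distributed as `E ∪ A`. -/
lemma ex_subset (p : ℝ) (A : Finset α) (f : Finset α → ℝ) :
    ex p (fun E ↦ if A ⊆ E then f E else 0) = p ^ #A * ex p (fun E ↦ f (E ∪ A)) := by
  induction A using Finset.induction generalizing f with
  | empty => simp
  | insert a A ha ih =>
    have := ih (fun E ↦ if a ∈ E then f E else 0)
    rw [card_insert_of_notMem ha, pow_succ, mul_assoc]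
    have h2 := ex_subset_insert p a (fun E ↦ f (E ∪ A))
    simp only [insert_union] at h2
    simp only [union_insert]
    rw [← h2]
    have e : (fun E ↦ if a ∈ E ∪ A then f (E ∪ A) else 0) =
        fun E ↦ if a ∈ E then f (E ∪ A) else 0 := by
      ext E; simp [ha]
    rw [e] at this
    rw [← this]
    congr 1; ext E
    simp only [insert_subset_iff]
    split_ifs <;> simp_all

lemma ex_ite_subset (p : ℝ) (A : Finset α) :
    ex p (fun E ↦ if A ⊆ E then 1 else 0) = p ^ #A := by
  rw [ex_subset, ex_one, mul_one]

lemma ex_exp_card (p s : ℝ) (X : Finset α) :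
    ex p (fun E ↦ Real.exp (s * #(E ∩ X))) = (1 - p + p * Real.exp s) ^ #X := by
  have := ex_prod p (fun a ↦ if a ∈ X then Real.exp s else 1)
  rw [show (fun E ↦ Real.exp (s * #(E ∩ X))) =
    fun E ↦ ∏ a ∈ E, (if a ∈ X then Real.exp s else 1) from ?_, this]
  · rw [← prod_const, ← prod_subset (subset_univ X)]
    · exact prod_congr rfl fun a ha ↦ by simp [ha]
    · intro a _ ha; simp [ha]
  · ext E
    rw [prod_ite_mem, prod_const, ← Real.exp_nat_mul, mul_comm]

/-- The **Harris inequality** for decreasing functions of a random set. -/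
lemma ex_mul_le_of_antitone (h0 : 0 ≤ p) (h1 : p ≤ 1) {f g : Finset α → ℝ} (hf0 : ∀ E, 0 ≤ f E)
    (hg0 : ∀ E, 0 ≤ g E) (hf : Antitone f) (hg : Antitone g) :
    ex p f * ex p g ≤ ex p (fun E ↦ f E * g E) := by
  have h := four_functions_theorem_univ (fun E : Finset α ↦ wt p E * f E) (fun E ↦ wt p E * g E)
    (fun E ↦ wt p E * (f E * g E)) (wt p)
    (fun E ↦ mul_nonneg (wt_nonneg h0 h1 E) (hf0 E))
    (fun E ↦ mul_nonneg (wt_nonneg h0 h1 E) (hg0 E))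
    (fun E ↦ mul_nonneg (wt_nonneg h0 h1 E) (mul_nonneg (hf0 E) (hg0 E)))
    (fun E ↦ wt_nonneg h0 h1 E) ?_
  · rw [sum_wt, mul_one] at h; exact h
  intro A B
  have e : wt p A * wt p B = wt p (A ∩ B) * wt p (A ∪ B) := by
    have e1 := card_inter_add_card_union A B
    have e2 := card_inter_add_card_union Aᶜ Bᶜ
    rw [← compl_union, ← compl_inter] at e2
    simp only [wt]
    calc _ = p ^ (#A + #B) * (1 - p) ^ (#Aᶜ + #Bᶜ) := by rw [pow_add, pow_add]; ring
      _ = _ := by rw [← e1, ← e2, pow_add, pow_add]; ring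
  calc wt p A * f A * (wt p B * g B) = (wt p A * wt p B) * (f A * g B) := by ring
    _ ≤ (wt p A * wt p B) * (f (A ∩ B) * g (A ∩ B)) := by
      gcongr
      · exact mul_nonneg (wt_nonneg h0 h1 A) (wt_nonneg h0 h1 B)
      · exact hg0 _
      · exact hf0 _
      · exact hf inter_subset_left
      · exact hg inter_subset_right
    _ = _ := by rw [e, inf_eq_inter, sup_eq_union]; ring

end RandomSets

/-! ### Concentration inequalities for random sets -/

section Concentration

variable {α : Type*} [Fintype α] [DecidableEq α] {p : ℝ}

section Janson

variable {ι : Type*} (I : Finset ι) (A : ι → Finset α)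

/-- The number of indices `i ∈ I` with `A i ⊆ E`. -/
def cnt (E : Finset α) : ℝ := ∑ i ∈ I, if A i ⊆ E then 1 else 0

/-- The expectation of `cnt I A`. -/
def mean (p : ℝ) : ℝ := ∑ i ∈ I, p ^ #(A i)

/-- The sum of the probabilities `ℙ(A i ∪ A j ⊆ E)` over all ordered pairs of sets that meet. -/
def overlap (p : ℝ) : ℝ := ∑ i ∈ I, ∑ j ∈ I with ¬ Disjoint (A i) (A j), p ^ #(A i ∪ A j)

variable {I A}

lemma ex_cnt (p : ℝ) : ex p (cnt I A) = mean I A p := by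
  have := ex_sum p I (fun i E ↦ if A i ⊆ E then 1 else 0)
  simp only [ex_ite_subset] at this
  exact this

lemma antitone_exp_neg_mul {f : Finset α → ℝ} (hf : Monotone f) {s : ℝ} (hs : 0 ≤ s) :
    Antitone fun E ↦ Real.exp (-(s * f E)) := fun _ _ h ↦
  Real.exp_le_exp.2 (neg_le_neg (mul_le_mul_of_nonneg_left (hf h) hs))

/-- The differential inequality behind Janson's inequality. For each `i`, both the number of sets
that meet `A i` and the number of sets that do not turn into decreasing functions of `E` under `x ↦
exp (-s * x)`, so the Harris inequality decouples them; the former number contributes the overlap.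
-/
lemma mean_sub_mul_le (h0 : 0 ≤ p) (h1 : p ≤ 1) {s : ℝ} (hs : 0 ≤ s) :
    (mean I A p - s * overlap I A p) * ex p (fun E ↦ Real.exp (-(s * cnt I A E))) ≤
      ex p (fun E ↦ cnt I A E * Real.exp (-(s * cnt I A E))) := by
  set φ := ex p (fun E ↦ Real.exp (-(s * cnt I A E))) with hφ
  have hφ0 : 0 ≤ φ := ex_nonneg h0 h1 fun E ↦ (Real.exp_pos _).le
  have e : ex p (fun E ↦ cnt I A E * Real.exp (-(s * cnt I A E))) =
      ∑ i ∈ I, p ^ #(A i) * ex p (fun E ↦ Real.exp (-(s * cnt I A (E ∪ A i)))) := by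
    simp_rw [← ex_subset p (A _) (fun E ↦ Real.exp (-(s * cnt I A E)))]
    rw [← ex_sum]
    congr 1; ext E
    rw [cnt, sum_mul]
    exact sum_congr rfl fun i _ ↦ by split_ifs <;> simp
  rw [e, mean, overlap, mul_sum, ← sum_sub_distrib, sum_mul]
  refine sum_le_sum fun i hi ↦ ?_
  -- split the count according to whether the sets meet `A i`
  set X₁ : Finset α → ℝ := fun E ↦ ∑ j ∈ I with ¬ Disjoint (A i) (A j),
    if A j ⊆ E ∪ A i then 1 else 0 with hX₁
  set X₂ : Finset α → ℝ := fun E ↦ ∑ j ∈ I with Disjoint (A i) (A j),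
    if A j ⊆ E then 1 else 0 with hX₂
  have hsplit : ∀ E, cnt I A (E ∪ A i) = X₁ E + X₂ E := by
    intro E
    rw [cnt, ← sum_filter_not_add_sum_filter I (fun j ↦ Disjoint (A i) (A j))]
    simp only [hX₁, hX₂]
    congr 1
    refine sum_congr rfl fun j hj ↦ ?_
    have hd := (mem_filter.1 hj).2
    have : A j ⊆ E ∪ A i ↔ A j ⊆ E :=
      ⟨fun h a ha ↦ (mem_union.1 (h ha)).resolve_right fun h' ↦
        (Finset.disjoint_left.1 hd h' ha), fun h ↦ h.trans subset_union_left⟩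
    simp [this]
  have hind : ∀ (B C : Finset α), Monotone fun E : Finset α ↦
      if B ⊆ E ∪ C then (1 : ℝ) else 0 := by
    intro B C E E' h
    dsimp only
    split_ifs with h1 h2 <;> try norm_num
    exact h2 (h1.trans (union_subset_union_left h))
  have hm₁ : Monotone X₁ := fun E E' h ↦ sum_le_sum fun j _ ↦ hind _ _ h
  have hm₂ : Monotone X₂ := fun E E' h ↦ sum_le_sum fun j _ ↦ by simpa using hind (A j) ∅ h
  have hX₂le : ∀ E, X₂ E ≤ cnt I A E := fun E ↦
    sum_le_sum_of_subset_of_nonneg (filter_subset _ _) fun _ _ _ ↦ by split_ifs <;> simp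
  have hharris := ex_mul_le_of_antitone h0 h1 (fun E ↦ (Real.exp_pos (-(s * X₁ E))).le)
    (fun E ↦ (Real.exp_pos (-(s * X₂ E))).le) (antitone_exp_neg_mul hm₁ hs)
    (antitone_exp_neg_mul hm₂ hs)
  have hφ2 : φ ≤ ex p (fun E ↦ Real.exp (-(s * X₂ E))) := ex_mono h0 h1 fun E ↦
    Real.exp_le_exp.2 (neg_le_neg (mul_le_mul_of_nonneg_left (hX₂le E) hs))
  have hlin : 1 - s * ex p X₁ ≤ ex p (fun E ↦ Real.exp (-(s * X₁ E))) := by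
    rw [← ex_one (α := α) p, ← ex_mul_left, ← ex_sub]
    refine ex_mono h0 h1 fun E ↦ ?_
    linarith [Real.add_one_le_exp (-(s * X₁ E))]
  have hX₁ex : p ^ #(A i) * ex p X₁ =
      ∑ j ∈ I with ¬ Disjoint (A i) (A j), p ^ #(A i ∪ A j) := by
    rw [hX₁, ex_sum, mul_sum]
    refine sum_congr rfl fun j _ ↦ ?_
    have : (fun E : Finset α ↦ if A j ⊆ E ∪ A i then (1 : ℝ) else 0) =
        fun E ↦ if A j \ A i ⊆ E then 1 else 0 := by
      ext E
      have : A j ⊆ E ∪ A i ↔ A j \ A i ⊆ E := by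
        constructor
        · intro h a ha
          exact (mem_union.1 (h (mem_sdiff.1 ha).1)).resolve_right (mem_sdiff.1 ha).2
        · intro h a ha
          by_cases ha' : a ∈ A i
          · exact mem_union_right _ ha'
          · exact mem_union_left _ (h (mem_sdiff.2 ⟨ha, ha'⟩))
      simp [this]
    rw [this, ex_ite_subset, ← pow_add, ← card_union_of_disjoint disjoint_sdiff,
      union_sdiff_self_eq_union]
  have hfin : (1 - s * ex p X₁) * φ ≤ ex p (fun E ↦ Real.exp (-(s * cnt I A (E ∪ A i)))) := by
    calc _ ≤ ex p (fun E ↦ Real.exp (-(s * X₁ E))) * φ := by gcongr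
      _ ≤ ex p (fun E ↦ Real.exp (-(s * X₁ E))) * ex p (fun E ↦ Real.exp (-(s * X₂ E))) := by
        gcongr
        exact ex_nonneg h0 h1 fun E ↦ (Real.exp_pos _).le
      _ ≤ _ := hharris
      _ = _ := by
        congr 1; ext E; rw [hsplit, ← Real.exp_add]; ring_nf
  rw [← hX₁ex]
  calc _ = p ^ #(A i) * ((1 - s * ex p X₁) * φ) := by ring
    _ ≤ _ := mul_le_mul_of_nonneg_left hfin (pow_nonneg h0 _)

/-- **Janson's inequality**, bound on the Laplace transform. -/
lemma ex_exp_neg_mul_cnt_le (h0 : 0 ≤ p) (h1 : p ≤ 1) {s : ℝ} (hs : 0 ≤ s) :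
    ex p (fun E ↦ Real.exp (-(s * cnt I A E))) ≤
      Real.exp (-(s * mean I A p) + s ^ 2 * overlap I A p / 2) := by
  set φ : ℝ → ℝ := fun s ↦ ex p (fun E ↦ Real.exp (-(s * cnt I A E))) with hφ
  set ψ : ℝ → ℝ := fun s ↦ φ s * Real.exp (s * mean I A p - s ^ 2 * overlap I A p / 2) with hψ
  have hφd : ∀ s, HasDerivAt φ (-ex p (fun E ↦ cnt I A E * Real.exp (-(s * cnt I A E)))) s := by
    intro s
    have : -ex p (fun E ↦ cnt I A E * Real.exp (-(s * cnt I A E))) =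
        ∑ E, wt p E * (Real.exp (-(s * cnt I A E)) * (-(1 * cnt I A E))) := by
      rw [ex, ← sum_neg_distrib]; exact sum_congr rfl fun E _ ↦ by ring
    rw [this]
    refine HasDerivAt.fun_sum fun E _ ↦ HasDerivAt.const_mul _ ?_
    exact (((hasDerivAt_id s).mul_const (cnt I A E)).neg).exp
  have hψd : ∀ s, HasDerivAt ψ ((-ex p (fun E ↦ cnt I A E * Real.exp (-(s * cnt I A E))) +
      (mean I A p - s * overlap I A p) * φ s) *
        Real.exp (s * mean I A p - s ^ 2 * overlap I A p / 2)) s := by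
    intro s
    have h2 : HasDerivAt (fun s ↦ s * mean I A p - s ^ 2 * overlap I A p / 2)
        (mean I A p - s * overlap I A p) s := by
      have := ((hasDerivAt_id s).mul_const (mean I A p)).sub
        (((hasDerivAt_pow 2 s).mul_const (overlap I A p)).div_const 2)
      refine this.congr_deriv ?_
      simp; ring
    refine ((hφd s).mul h2.exp).congr_deriv ?_
    ring
  have hanti : AntitoneOn ψ (Set.Ici 0) := by
    refine antitoneOn_of_deriv_nonpos (convex_Ici 0)
      (fun s _ ↦ (hψd s).continuousAt.continuousWithinAt)
      (fun s _ ↦ (hψd s).differentiableAt.differentiableWithinAt) fun s hs ↦ ?_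
    rw [interior_Ici, Set.mem_Ioi] at hs
    rw [(hψd s).deriv]
    refine mul_nonpos_of_nonpos_of_nonneg ?_ (Real.exp_pos _).le
    linarith [mean_sub_mul_le (I := I) (A := A) h0 h1 hs.le]
  have h := hanti (Set.mem_Ici.2 le_rfl) (Set.mem_Ici.2 hs) hs
  have h00 : ψ 0 = 1 := by simp [hψ, hφ, ex_one]
  rw [h00, hψ] at h
  dsimp only at h
  rw [← le_div_iff₀ (Real.exp_pos _), one_div, ← Real.exp_neg] at h
  refine h.trans_eq ?_
  congr 1; ring

/-- **Janson's inequality** for the lower tail. -/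
lemma pr_cnt_le_mean_sub (h0 : 0 ≤ p) (h1 : p ≤ 1) {D t : ℝ} (hD : overlap I A p ≤ D)
    (hD0 : 0 < D) (ht : 0 ≤ t) :
    pr p {E | cnt I A E ≤ mean I A p - t} ≤ Real.exp (-(t ^ 2 / (2 * D))) := by
  set s := t / D with hs
  have hs0 : 0 ≤ s := by positivity
  have h2 : pr p {E | cnt I A E ≤ mean I A p - t} ≤
      pr p {E | Real.exp (-(s * (mean I A p - t))) ≤ Real.exp (-(s * cnt I A E))} := by
    refine pr_mono h0 h1 fun E hE ↦ ?_
    exact Real.exp_le_exp.2 (neg_le_neg (mul_le_mul_of_nonneg_left hE hs0))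
  refine h2.trans ((pr_le_div h0 h1 (fun E ↦ (Real.exp_pos _).le) (Real.exp_pos _)).trans ?_)
  rw [div_le_iff₀ (Real.exp_pos _), ← Real.exp_add]
  refine (ex_exp_neg_mul_cnt_le h0 h1 hs0).trans (Real.exp_le_exp.2 ?_)
  have : s ^ 2 * overlap I A p ≤ s ^ 2 * D := by gcongr
  have e1 : s * t = t ^ 2 / D := by rw [hs]; ring
  have e2 : s ^ 2 * D = t ^ 2 / D := by rw [hs]; field_simp
  have e3 : t ^ 2 / (2 * D) = t ^ 2 / D / 2 := by field_simp
  nlinarith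

lemma ex_cnt_sq_le (h0 : 0 ≤ p) : ex p (fun E ↦ cnt I A E ^ 2) ≤
    mean I A p ^ 2 + overlap I A p := by
  have e : ∀ E, cnt I A E ^ 2 = ∑ i ∈ I, ∑ j ∈ I, if A i ∪ A j ⊆ E then 1 else 0 := by
    intro E
    rw [sq, cnt, sum_mul_sum]
    refine sum_congr rfl fun i _ ↦ sum_congr rfl fun j _ ↦ ?_
    simp only [union_subset_iff]
    split_ifs <;> simp_all
  simp_rw [e]
  rw [ex_sum]
  simp_rw [ex_sum, ex_ite_subset]
  rw [sq, mean, sum_mul_sum, overlap, ← sum_add_distrib]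
  refine sum_le_sum fun i _ ↦ ?_
  rw [← sum_filter_not_add_sum_filter I (fun j ↦ Disjoint (A i) (A j)), add_comm]
  refine add_le_add ?_ le_rfl
  calc _ = ∑ j ∈ I with Disjoint (A i) (A j), p ^ #(A i) * p ^ #(A j) :=
        sum_congr rfl fun j hj ↦ by
          rw [card_union_of_disjoint (mem_filter.1 hj).2, pow_add]
    _ ≤ _ := sum_le_sum_of_subset_of_nonneg (filter_subset _ _) fun _ _ _ ↦ by positivity

/-- **Chebyshev's inequality** for the upper tail of a count. -/
lemma pr_mean_add_le_cnt (h0 : 0 ≤ p) (h1 : p ≤ 1) {D t : ℝ} (hD : overlap I A p ≤ D)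
    (ht : 0 < t) :
    pr p {E | mean I A p + t ≤ cnt I A E} ≤ D / t ^ 2 := by
  have hmono : pr p {E | mean I A p + t ≤ cnt I A E} ≤
      pr p {E | t ^ 2 ≤ (cnt I A E - mean I A p) ^ 2} := by
    refine pr_mono h0 h1 fun E hE ↦ ?_
    have : t ≤ cnt I A E - mean I A p := by
      have : mean I A p + t ≤ cnt I A E := hE
      linarith
    exact pow_le_pow_left₀ ht.le this 2
  refine hmono.trans ((pr_le_div h0 h1 (fun E ↦ sq_nonneg _) (by positivity)).trans ?_)
  gcongr
  have e : (fun E ↦ (cnt I A E - mean I A p) ^ 2) =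
      fun E ↦ (cnt I A E ^ 2 - (2 * mean I A p) * cnt I A E) + mean I A p ^ 2 := by
    ext E; ring
  rw [e, ex_add, ex_sub, ex_mul_left, ex_const, ex_cnt]
  linarith [ex_cnt_sq_le (I := I) (A := A) h0]

end Janson

/-- The exponential moment bound for both tails: the sign of `σ` selects the tail, and `|σ| ≤ 1`
allows the estimate `exp σ ≤ 1 + σ + σ ^ 2`. -/
lemma pr_card_inter_le (h0 : 0 ≤ p) (h1 : p ≤ 1) (X : Finset α) {T σ l : ℝ}
    (hT : (#X : ℝ) ≤ T) (hσ : |σ| ≤ 1) :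
    pr p {E | l ≤ σ * (#(E ∩ X) - p * #X)} ≤ Real.exp (p * T * σ ^ 2 - l) := by
  have h2 : pr p {E | l ≤ σ * (#(E ∩ X) - p * #X)} ≤
      pr p {E | Real.exp (l + σ * p * #X) ≤ Real.exp (σ * #(E ∩ X))} := by
    refine pr_mono h0 h1 fun E hE ↦ ?_
    have : l ≤ σ * (#(E ∩ X) - p * #X) := hE
    refine Real.exp_le_exp.2 ?_
    linarith
  refine h2.trans ((pr_le_div h0 h1 (fun E ↦ (Real.exp_pos _).le) (Real.exp_pos _)).trans ?_)
  rw [div_le_iff₀ (Real.exp_pos _), ex_exp_card, ← Real.exp_add]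
  have hb : Real.exp σ ≤ 1 + σ + σ ^ 2 := by
    have := Real.abs_exp_sub_one_sub_id_le hσ
    linarith [abs_le.1 this]
  have h3 : 1 - p + p * Real.exp σ ≤ Real.exp (p * (σ + σ ^ 2)) := by
    have := Real.add_one_le_exp (p * (σ + σ ^ 2))
    nlinarith
  have h4 : 0 ≤ 1 - p + p * Real.exp σ := by
    have := mul_nonneg h0 (Real.exp_pos σ).le
    linarith
  refine (pow_le_pow_left₀ h4 h3 _).trans ?_
  rw [← Real.exp_nat_mul]
  refine Real.exp_le_exp.2 ?_
  have : p * #X * σ ^ 2 ≤ p * T * σ ^ 2 := by gcongr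
  nlinarith

/-- **Chernoff's inequality**, in the range in which the deviation `l` is at most `2 p T`. -/
lemma pr_abs_card_inter_sub_le (h0 : 0 < p) (h1 : p ≤ 1) (X : Finset α) {T l : ℝ}
    (hT : (#X : ℝ) ≤ T) (hT0 : 0 < T) (hl : 0 ≤ l) (hlT : l ≤ 2 * p * T) :
    pr p {E | l ≤ |(#(E ∩ X) - p * #X : ℝ)|} ≤ 2 * Real.exp (-(l ^ 2 / (4 * p * T))) := by
  set s := l / (2 * p * T) with hs
  have hs0 : 0 ≤ s := by positivity
  have hs1 : s ≤ 1 := (div_le_one (by positivity)).2 hlT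
  have e : p * T * s ^ 2 - s * l = -(l ^ 2 / (4 * p * T)) := by
    rw [hs]; field_simp; ring
  have hsub : {E : Finset α | l ≤ |(#(E ∩ X) - p * #X : ℝ)|} ⊆
      {E | s * l ≤ s * (#(E ∩ X) - p * #X)} ∪ {E | s * l ≤ (-s) * (#(E ∩ X) - p * #X)} := by
    intro E hE
    have hE : l ≤ |(#(E ∩ X) - p * #X : ℝ)| := hE
    rcases le_abs.1 hE with h | h
    · left; exact mul_le_mul_of_nonneg_left h hs0
    · right
      have := mul_le_mul_of_nonneg_left h hs0
      show s * l ≤ _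
      linarith
  refine (pr_mono h0.le h1 hsub).trans ((pr_union_le h0.le h1 _ _).trans ?_)
  have a1 := pr_card_inter_le (l := s * l) h0.le h1 X hT (σ := s) (by rwa [abs_of_nonneg hs0])
  have a2 := pr_card_inter_le (l := s * l) h0.le h1 X hT (σ := -s)
    (by rwa [abs_neg, abs_of_nonneg hs0])
  rw [neg_sq, e] at a2
  rw [e] at a1
  linarith

end Concentration

/-! ### Cuts and canonical maximum cuts -/

section Cuts

variable {V : Type*} [Fintype V] [DecidableEq V]

section Cut

variable {κ : Type*} [DecidableEq κ]

/-- The pairs of vertices that receive different colours. -/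
def cross (φ : V → κ) : Finset (Sym2 V) := {e | ¬ (e.map φ).IsDiag}

/-- The pairs of distinct vertices that receive the same colour. -/
def inside (φ : V → κ) : Finset (Sym2 V) := {e | ¬ e.IsDiag ∧ (e.map φ).IsDiag}

@[simp] lemma mk_mem_cross {φ : V → κ} {x y : V} : s(x, y) ∈ cross φ ↔ φ x ≠ φ y := by
  simp [cross]

@[simp] lemma mk_mem_inside {φ : V → κ} {x y : V} :
    s(x, y) ∈ inside φ ↔ x ≠ y ∧ φ x = φ y := by
  simp [inside]

lemma disjoint_cross_inside (φ : V → κ) : Disjoint (cross φ) (inside φ) := by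
  rw [Finset.disjoint_left]
  rintro ⟨x, y⟩ h1 h2
  exact (mk_mem_cross.1 h1) (mk_mem_inside.1 h2).2

end Cut

variable {r : ℕ} [NeZero r]

/-- The size of the cut `φ` in `E`, with ties broken by a fixed enumeration of all cuts. -/
noncomputable def score (E : Finset (Sym2 V)) (φ : V → Fin r) : ℕ :=
  #(E ∩ cross φ) * Fintype.card (V → Fin r) + (Fintype.equivFin (V → Fin r) φ : ℕ)

lemma score_injective (E : Finset (Sym2 V)) :
    Function.Injective (score E : (V → Fin r) → ℕ) := by
  intro φ ψ h
  have h1 := (Fintype.equivFin (V → Fin r) φ).2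
  have h2 := (Fintype.equivFin (V → Fin r) ψ).2
  have := congrArg (· % Fintype.card (V → Fin r)) h
  simp only [score, Nat.mul_add_mod_self_right, Nat.mod_eq_of_lt h1, Nat.mod_eq_of_lt h2] at this
  exact (Fintype.equivFin _).injective (Fin.ext this)

lemma exists_score_max (E : Finset (Sym2 V)) :
    ∃ φ : V → Fin r, ∀ ψ : V → Fin r, score E ψ ≤ score E φ := by
  obtain ⟨φ, -, h⟩ := exists_max_image univ (score E : (V → Fin r) → ℕ) univ_nonempty
  exact ⟨φ, fun ψ ↦ h ψ (mem_univ _)⟩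

variable (r) in
/-- A canonical maximum `r`-cut of the graph with edge set `E`. -/
noncomputable def maxCut (E : Finset (Sym2 V)) : V → Fin r := (exists_score_max E).choose

lemma score_le (E : Finset (Sym2 V)) (ψ : V → Fin r) : score E ψ ≤ score E (maxCut r E) :=
  (exists_score_max E).choose_spec ψ

lemma eq_maxCut {E : Finset (Sym2 V)} {φ : V → Fin r} (h : ∀ ψ : V → Fin r, score E ψ ≤ score E φ) :
    maxCut r E = φ :=
  score_injective E ((h _).antisymm (score_le E φ))

lemma card_inter_le_of_score_le {E : Finset (Sym2 V)} {φ ψ : V → Fin r}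
    (h : score E ψ ≤ score E φ) : #(E ∩ cross ψ) ≤ #(E ∩ cross φ) := by
  by_contra! hlt
  have h1 := (Fintype.equivFin (V → Fin r) φ).2
  have : (#(E ∩ cross φ) + 1) * Fintype.card (V → Fin r) ≤
    #(E ∩ cross ψ) * Fintype.card (V → Fin r) := Nat.mul_le_mul_right _ hlt
  rw [score, score] at h
  rw [add_mul, one_mul] at this
  omega

lemma card_inter_cross_le (E : Finset (Sym2 V)) (ψ : V → Fin r) :
    #(E ∩ cross ψ) ≤ #(E ∩ cross (maxCut r E)) :=
  card_inter_le_of_score_le (score_le E ψ)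

/-- Adding edges across the canonical maximum cut does not change that cut. -/
lemma maxCut_union {E L : Finset (Sym2 V)} (hL : L ⊆ cross (maxCut r E)) (hd : Disjoint E L) :
    maxCut r (E ∪ L) = maxCut r E := by
  refine eq_maxCut fun ψ ↦ ?_
  have h := score_le E ψ
  have e : ∀ φ : V → Fin r, #((E ∪ L) ∩ cross φ) = #(E ∩ cross φ) + #(L ∩ cross φ) := fun φ ↦ by
    rw [union_inter_distrib_right, card_union_of_disjoint]
    exact hd.mono inter_subset_left inter_subset_left
  have h1 : #(L ∩ cross ψ) ≤ #(L ∩ cross (maxCut r E)) := by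
    rw [inter_eq_left.2 hL]; exact card_le_card inter_subset_left
  have h2 := Nat.mul_le_mul_right (Fintype.card (V → Fin r)) h1
  rw [score, score] at h ⊢
  rw [e, e, add_mul, add_mul]
  omega

lemma card_sdiff_inter {E R : Finset (Sym2 V)} (hR : R ⊆ E) (φ : V → Fin r) :
    #((E \ R) ∩ cross φ) + #(R ∩ cross φ) = #(E ∩ cross φ) := by
  rw [← card_union_of_disjoint (disjoint_sdiff_self_left.mono inter_subset_left inter_subset_left),
    ← union_inter_distrib_right, sdiff_union_of_subset hR]

/-- Removing edges that belong to every cut of nearly maximum size does not change the canonical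
maximum cut. -/
lemma maxCut_sdiff {E R : Finset (Sym2 V)} (hR : R ⊆ E)
    (h : ∀ ψ : V → Fin r, #(E ∩ cross (maxCut r E)) ≤ #(E ∩ cross ψ) + #R → R ⊆ cross ψ) :
    maxCut r (E \ R) = maxCut r E := by
  refine eq_maxCut fun ψ ↦ ?_
  have hs := score_le E ψ
  have hφ := card_sdiff_inter hR (maxCut r E)
  rw [inter_eq_left.2 (h _ (by omega))] at hφ
  have hψ := card_sdiff_inter hR ψ
  by_cases hn : #(E ∩ cross (maxCut r E)) ≤ #(E ∩ cross ψ) + #R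
  · rw [inter_eq_left.2 (h _ hn)] at hψ
    rw [score, score] at hs ⊢
    rw [← hφ, ← hψ, add_mul, add_mul] at hs
    omega
  · have h1 := (Fintype.equivFin (V → Fin r) ψ).2
    have : (#((E \ R) ∩ cross ψ) + 1) * Fintype.card (V → Fin r) ≤
      #((E \ R) ∩ cross (maxCut r E)) * Fintype.card (V → Fin r) :=
        Nat.mul_le_mul_right _ (by omega)
    rw [add_mul, one_mul] at this
    rw [score, score]
    omega

/-! ### Uniform edge distribution -/

section Counts

variable {κ : Type*} [DecidableEq κ]

/-- The neighbours of `x` in `C`, in the graph of the edges of `E` that cross `φ`. For `φ = id`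
these are all the neighbours of `x` in `C`. -/
def nbr (E : Finset (Sym2 V)) (φ : V → κ) (C : Finset V) (x : V) : Finset V :=
  {y ∈ C | φ x ≠ φ y ∧ s(x, y) ∈ E}

/-- The number of pairs `(x, y)` with `x ∈ A` and `y ∈ C` that are adjacent in the graph of the
edges of `E` that cross `φ`. -/
def dsum (E : Finset (Sym2 V)) (φ : V → κ) (A C : Finset V) : ℕ := ∑ x ∈ A, #(nbr E φ C x)

/-- The number of ordered pairs in `A ×ˢ C` that represent the unordered pair `e` crossing `φ`. -/
def mult (φ : V → κ) (A C : Finset V) (e : Sym2 V) : ℕ :=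
  #{z ∈ A ×ˢ C | φ z.1 ≠ φ z.2 ∧ s(z.1, z.2) = e}

lemma mult_le_two (φ : V → κ) (A C : Finset V) (e : Sym2 V) : mult φ A C e ≤ 2 := by
  induction e with | _ x y
  refine (card_le_card (t := {(x, y), (y, x)}) ?_).trans card_le_two
  rintro ⟨a, b⟩ h
  simp only [mem_filter, Sym2.eq_iff] at h
  simp only [mem_insert, mem_singleton, Prod.mk.injEq]
  exact h.2.2

lemma dsum_eq_sum_mult (E : Finset (Sym2 V)) (φ : V → κ) (A C : Finset V) :
    dsum E φ A C = ∑ e ∈ E, mult φ A C e := by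
  have h1 : dsum E φ A C = #{z ∈ A ×ˢ C | φ z.1 ≠ φ z.2 ∧ s(z.1, z.2) ∈ E} := by
    rw [dsum, ← card_sigma]
    refine card_nbij' (fun z ↦ (z.1, z.2)) (fun z ↦ ⟨z.1, z.2⟩) ?_ ?_ ?_ ?_ <;>
      simp +contextual [nbr, Set.MapsTo, Set.LeftInvOn]
  rw [h1, card_eq_sum_card_fiberwise (f := fun z : V × V ↦ s(z.1, z.2)) (t := E)
    (by intro z hz; simp at hz; exact hz.2.2)]
  refine sum_congr rfl fun e he ↦ ?_
  rw [mult, filter_filter]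
  congr 1
  ext z
  simp only [mem_filter]
  constructor
  · rintro ⟨h1, ⟨h2, h3⟩, h4⟩; exact ⟨h1, h2, h4⟩
  · rintro ⟨h1, h2, h4⟩; exact ⟨h1, ⟨h2, h4 ▸ he⟩, h4⟩

/-- An edge is counted at most twice in `dsum`, which is therefore the sum of the sizes of two
intersections of `E` with fixed sets. This makes Chernoff's inequality applicable. -/
lemma dsum_eq_card_add_card (E : Finset (Sym2 V)) (φ : V → κ) (A C : Finset V) :
    dsum E φ A C = #(E ∩ ({e | 1 ≤ mult φ A C e} : Finset (Sym2 V))) +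
      #(E ∩ ({e | 2 ≤ mult φ A C e} : Finset (Sym2 V))) := by
  rw [dsum_eq_sum_mult, ← filter_mem_eq_inter, ← filter_mem_eq_inter, card_filter, card_filter,
    ← sum_add_distrib]
  refine sum_congr rfl fun e _ ↦ ?_
  have := mult_le_two φ A C e
  simp only [mem_filter, mem_univ, true_and]
  split_ifs <;> omega

lemma dsum_univ_eq (φ : V → κ) (E : Finset (Sym2 V)) :
    dsum E φ univ univ = 2 * #(E ∩ cross φ) := by
  have h : ∀ e ∈ E, mult φ univ univ e = if e ∈ cross φ then 2 else 0 := by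
    rintro ⟨x, y⟩ -
    simp only [mult, univ_product_univ]
    by_cases hxy : φ x = φ y
    · rw [if_neg (by simpa using hxy), card_eq_zero, filter_eq_empty_iff]
      rintro ⟨a, b⟩ - ⟨h1, h2⟩
      rcases Sym2.eq_iff.1 h2 with ⟨rfl, rfl⟩ | ⟨rfl, rfl⟩
      · exact h1 hxy
      · exact h1 hxy.symm
    · rw [if_pos (by simpa using hxy)]
      have hne : x ≠ y := fun h ↦ hxy (h ▸ rfl)
      rw [show ({z | φ z.1 ≠ φ z.2 ∧ s(z.1, z.2) = s(x, y)} : Finset (V × V)) =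
        {(x, y), (y, x)} from ?_, card_pair (by simp [hne])]
      ext ⟨a, b⟩
      simp only [mem_filter, mem_univ, true_and, mem_insert, mem_singleton, Prod.mk.injEq,
        Sym2.eq_iff]
      constructor
      · exact fun h ↦ h.2
      · rintro (⟨rfl, rfl⟩ | ⟨rfl, rfl⟩)
        · exact ⟨hxy, Or.inl ⟨rfl, rfl⟩⟩
        · exact ⟨Ne.symm hxy, Or.inr ⟨rfl, rfl⟩⟩
  rw [dsum_eq_sum_mult, sum_congr rfl h, sum_ite_mem, sum_const, smul_eq_mul, mul_comm]

/-- Chernoff's inequality for `dsum`; the constants are larger as `dsum` is a sum of two dependent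
binomial variables. -/
lemma pr_dsum {p : ℝ} (h0 : 0 < p) (h1 : p ≤ 1) (φ : V → κ) (A C : Finset V) {T l : ℝ}
    (hT : (Fintype.card (Sym2 V) : ℝ) ≤ T) (hT0 : 0 < T) (hl : 0 ≤ l) (hlT : l ≤ 2 * p * T) :
    pr p {E | 2 * l ≤ |(dsum E φ A C - p * dsum univ φ A C : ℝ)|} ≤
      4 * Real.exp (-(l ^ 2 / (4 * p * T))) := by
  set X : ℕ → Finset (Sym2 V) := fun k ↦ {e | k ≤ mult φ A C e} with hX
  have hXT : ∀ k, (#(X k) : ℝ) ≤ T := fun k ↦ le_trans (by exact_mod_cast card_le_univ _) hT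
  have hsub : {E | 2 * l ≤ |(dsum E φ A C - p * dsum univ φ A C : ℝ)|} ⊆
      {E | l ≤ |(#(E ∩ X 1) - p * #(X 1) : ℝ)|} ∪ {E | l ≤ |(#(E ∩ X 2) - p * #(X 2) : ℝ)|} := by
    intro E hE
    have hE : 2 * l ≤ |(dsum E φ A C - p * dsum univ φ A C : ℝ)| := hE
    rw [dsum_eq_card_add_card, dsum_eq_card_add_card univ, univ_inter, univ_inter] at hE
    push_cast at hE
    by_contra hcon
    simp only [Set.mem_union, Set.mem_ofPred_eq, not_or, not_le] at hcon
    have e : ∀ a b c d : ℝ, a + b - p * (c + d) = (a - p * c) + (b - p * d) := by intros; ring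
    rw [e] at hE
    have := hE.trans (abs_add_le _ _)
    simp only [hX] at hcon
    linarith [hcon.1, hcon.2]
  refine (pr_mono h0.le h1 hsub).trans ((pr_union_le h0.le h1 _ _).trans ?_)
  linarith [pr_abs_card_inter_sub_le h0 h1 (X 1) (hXT 1) hT0 hl hlT,
    pr_abs_card_inter_sub_le h0 h1 (X 2) (hXT 2) hT0 hl hlT]

end Counts

/-- The edges of `E` are distributed as expected from a random set of density `p`, up to an
additive error `η`, simultaneously for all pairs of vertex sets and all pairs of `r`-cuts (a pair
of cuts being encoded as a colouring by `Fin r × Fin r`). -/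
def IsUniform (r : ℕ) (p η : ℝ) (E : Finset (Sym2 V)) : Prop :=
  (∀ (φ : V → Fin r × Fin r) (A C : Finset V), |(dsum E φ A C - p * dsum univ φ A C : ℝ)| ≤ η) ∧
    ∀ A C : Finset V, |(dsum E id A C - p * dsum univ id A C : ℝ)| ≤ η

/-- The union bound over all the pairs of cuts and of vertex sets. -/
lemma pr_not_isUniform {p : ℝ} (h0 : 0 < p) (h1 : p ≤ 1) {T l : ℝ}
    (hT : (Fintype.card (Sym2 V) : ℝ) ≤ T) (hT0 : 0 < T) (hl : 0 ≤ l) (hlT : l ≤ 2 * p * T) :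
    pr p {E : Finset (Sym2 V) | ¬ IsUniform r p (2 * l) E} ≤
      2 * ((r ^ 2 * 4 : ℝ) ^ Fintype.card V * (4 * Real.exp (-(l ^ 2 / (4 * p * T))))) := by
  set B := 4 * Real.exp (-(l ^ 2 / (4 * p * T))) with hB
  have hsub : {E : Finset (Sym2 V) | ¬ IsUniform r p (2 * l) E} ⊆
      {E | ∃ i : (V → Fin r × Fin r) × Finset V × Finset V,
        E ∈ {E | 2 * l ≤ |(dsum E i.1 i.2.1 i.2.2 - p * dsum univ i.1 i.2.1 i.2.2 : ℝ)|}} ∪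
      {E | ∃ i : Finset V × Finset V,
        E ∈ {E | 2 * l ≤ |(dsum E id i.1 i.2 - p * dsum univ id i.1 i.2 : ℝ)|}} := by
    intro E hE
    have hE : ¬ IsUniform r p (2 * l) E := hE
    rw [IsUniform, not_and_or] at hE
    rcases hE with h | h
    · left
      push Not at h
      obtain ⟨φ, A, C, h⟩ := h
      exact ⟨(φ, A, C), h.le⟩
    · right
      push Not at h
      obtain ⟨A, C, h⟩ := h
      exact ⟨(A, C), h.le⟩
  refine (pr_mono h0.le h1 hsub).trans ((pr_union_le h0.le h1 _ _).trans ?_)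
  have a1 := pr_exists_le h0.le h1
    (fun i : (V → Fin r × Fin r) × Finset V × Finset V ↦
      {E | 2 * l ≤ |(dsum E i.1 i.2.1 i.2.2 - p * dsum univ i.1 i.2.1 i.2.2 : ℝ)|})
    (c := B) (fun i ↦ pr_dsum h0 h1 _ _ _ hT hT0 hl hlT)
  have a2 := pr_exists_le h0.le h1
    (fun i : Finset V × Finset V ↦
      {E | 2 * l ≤ |(dsum E id i.1 i.2 - p * dsum univ id i.1 i.2 : ℝ)|})
    (c := B) (fun i ↦ pr_dsum h0 h1 _ _ _ hT hT0 hl hlT)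
  have c1 : (Fintype.card ((V → Fin r × Fin r) × Finset V × Finset V) : ℝ) =
      (r ^ 2 * 4 : ℝ) ^ Fintype.card V := by
    simp only [Fintype.card_prod, Fintype.card_fun, Fintype.card_fin, Fintype.card_finset]
    push_cast
    rw [← mul_pow, ← mul_pow]
    congr 1; ring
  have c2 : (Fintype.card (Finset V × Finset V) : ℝ) ≤ (r ^ 2 * 4 : ℝ) ^ Fintype.card V := by
    simp only [Fintype.card_prod, Fintype.card_finset]
    push_cast
    rw [← mul_pow]
    have : (1 : ℝ) ≤ r := by exact_mod_cast NeZero.one_le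
    have : (1 : ℝ) ≤ r ^ 2 := one_le_pow₀ this
    exact pow_le_pow_left₀ (by norm_num) (by linarith) _
  have hB0 : 0 ≤ B := by positivity
  have := mul_le_mul_of_nonneg_right c2 hB0
  rw [c1] at a1
  linarith

end Cuts

/-! ### Balance of maximum cuts -/

section Robustness

variable {V : Type*} [Fintype V] [DecidableEq V] {r : ℕ} [NeZero r] {p η : ℝ}

section Basic

variable {κ : Type*} [DecidableEq κ]

lemma nbr_pair (E : Finset (Sym2 V)) (φ : V → κ) :
    nbr E (fun x ↦ (φ x, φ x)) = nbr E φ := by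
  ext C x y; simp [nbr]

lemma dsum_pair (E : Finset (Sym2 V)) (φ : V → κ) :
    dsum E (fun x ↦ (φ x, φ x)) = dsum E φ := by
  ext A C; simp only [dsum, nbr_pair]

lemma IsUniform.abs_le {E : Finset (Sym2 V)} (h : IsUniform r p η E) (φ : V → Fin r)
    (A C : Finset V) : |(dsum E φ A C - p * dsum univ φ A C : ℝ)| ≤ η := by
  have := h.1 (fun x ↦ (φ x, φ x)) A C
  simpa only [dsum_pair] using this

/-- The colour class `i` of `φ`. -/
def cls (φ : V → κ) (i : κ) : Finset V := {x | φ x = i}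

lemma card_nbr_univ (φ : V → κ) (x : V) :
    (#(nbr univ φ univ x) : ℝ) = Fintype.card V - #(cls φ (φ x)) := by
  have : nbr univ φ univ x = (cls φ (φ x))ᶜ := by
    ext y; simp [nbr, cls, eq_comm]
  rw [this, card_compl, Nat.cast_sub (card_le_univ _)]

lemma dsum_univ_univ (φ : V → Fin r) :
    (dsum univ φ univ univ : ℝ) = (Fintype.card V : ℝ) ^ 2 - ∑ i, (#(cls φ i) : ℝ) ^ 2 := by
  rw [dsum]
  push_cast
  simp_rw [card_nbr_univ]
  rw [sum_sub_distrib, sum_const, card_univ, nsmul_eq_mul, ← sq]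
  congr 1
  rw [← sum_fiberwise univ φ]
  refine sum_congr rfl fun i _ ↦ ?_
  rw [sum_congr rfl (g := fun _ ↦ (#(cls φ i) : ℝ))
    fun x hx ↦ by rw [(mem_filter.1 hx).2]]
  rw [sum_const, nsmul_eq_mul, sq]
  rfl

lemma sum_card_cls (φ : V → Fin r) : ∑ i, (#(cls φ i) : ℝ) = Fintype.card V := by
  rw [← card_univ (α := V), card_eq_sum_card_fiberwise (f := φ) (t := univ) (by simp)]
  push_cast; rfl

end Basic

variable (V r) in
lemma exists_balanced : ∃ φ : V → Fin r, ∀ i, (#(cls φ i) : ℝ) ≤ Fintype.card V / r + 1 := by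
  have hr : 0 < r := Nat.pos_of_ne_zero (NeZero.ne r)
  set N := Fintype.card V
  refine ⟨fun x ↦ ⟨(Fintype.equivFin V x : ℕ) % r, Nat.mod_lt _ hr⟩, fun i ↦ ?_⟩
  have h : #(cls (fun x : V ↦ (⟨(Fintype.equivFin V x : ℕ) % r, Nat.mod_lt _ hr⟩ : Fin r)) i) ≤
      #(range (N / r + 1)) := by
    refine card_le_card_of_injOn (fun x ↦ (Fintype.equivFin V x : ℕ) / r) ?_ ?_
    · intro x _
      simp only [coe_range, Set.mem_Iio]
      have := (Fintype.equivFin V x).2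
      exact Nat.lt_succ_of_le (Nat.div_le_div_right this.le)
    · intro x hx y hy hxy
      simp only [cls, coe_filter, mem_univ, true_and, Set.mem_ofPred_eq] at hx hy
      have h2 : (Fintype.equivFin V x : ℕ) % r = (Fintype.equivFin V y : ℕ) % r :=
        congrArg Fin.val (hx.trans hy.symm)
      have h3 : (Fintype.equivFin V x : ℕ) / r = (Fintype.equivFin V y : ℕ) / r := hxy
      apply (Fintype.equivFin V).injective
      apply Fin.ext
      rw [← Nat.div_add_mod (Fintype.equivFin V x : ℕ) r, h2, h3, Nat.div_add_mod]
  rw [card_range] at h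
  calc _ ≤ ((N / r + 1 : ℕ) : ℝ) := by exact_mod_cast h
    _ ≤ _ := by push_cast; gcongr; exact Nat.cast_div_le

/-- In a uniform graph, a maximum cut separates almost as many pairs as a balanced partition does.
-/
lemma sum_sq_cls_le {E : Finset (Sym2 V)} (hE : IsUniform r p η E) (hp : 0 < p) :
    ∑ i, (#(cls (maxCut r E) i) : ℝ) ^ 2 ≤
      (Fintype.card V : ℝ) ^ 2 / r + Fintype.card V + 2 * η / p := by
  obtain ⟨ψ, hψ⟩ := exists_balanced V r
  set φ := maxCut r E
  have h1 : (dsum E ψ univ univ : ℝ) ≤ dsum E φ univ univ := by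
    rw [dsum_univ_eq, dsum_univ_eq]
    exact_mod_cast Nat.mul_le_mul_left 2 (card_inter_cross_le E ψ)
  have h2 := abs_le.1 (hE.abs_le φ univ univ)
  have h3 := abs_le.1 (hE.abs_le ψ univ univ)
  have h4 : (dsum univ ψ univ univ : ℝ) - 2 * η / p ≤ dsum univ φ univ univ := by
    rw [sub_le_iff_le_add, ← sub_le_iff_le_add', le_div_iff₀ hp]
    nlinarith [h2.1, h2.2, h3.1, h3.2]
  rw [dsum_univ_univ, dsum_univ_univ] at h4
  have h5 : ∑ i, (#(cls ψ i) : ℝ) ^ 2 ≤ (Fintype.card V : ℝ) ^ 2 / r + Fintype.card V := by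
    calc _ ≤ ∑ i, (#(cls ψ i) : ℝ) * (Fintype.card V / r + 1) := by
          refine sum_le_sum fun i _ ↦ ?_
          rw [sq]; gcongr; exact hψ i
      _ = _ := by rw [← sum_mul, sum_card_cls]; ring
  linarith

/-- The classes of the maximum cut of a uniform graph have almost equal sizes. -/
lemma abs_card_cls_sub_le {E : Finset (Sym2 V)} (hE : IsUniform r p η E) (hp : 0 < p) {b : ℝ}
    (hb0 : 0 ≤ b) (hb : Fintype.card V + 2 * η / p ≤ b ^ 2) (i : Fin r) :
    |(#(cls (maxCut r E) i) : ℝ) - Fintype.card V / r| ≤ b := by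
  refine abs_le_of_sq_le_sq ?_ hb0
  have hr : (r : ℝ) ≠ 0 := by exact_mod_cast NeZero.ne r
  have h1 := sum_sq_cls_le hE hp
  calc _ ≤ ∑ i, ((#(cls (maxCut r E) i) : ℝ) - Fintype.card V / r) ^ 2 :=
        single_le_sum (f := fun i ↦ ((#(cls (maxCut r E) i) : ℝ) - Fintype.card V / r) ^ 2)
          (fun _ _ ↦ sq_nonneg _) (mem_univ i)
    _ = ∑ i, (#(cls (maxCut r E) i) : ℝ) ^ 2 - (Fintype.card V : ℝ) ^ 2 / r := by
        simp_rw [sub_sq]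
        rw [sum_add_distrib, sum_sub_distrib, ← sum_mul, ← mul_sum, sum_card_cls]
        simp only [sum_const, card_univ, Fintype.card_fin, nsmul_eq_mul]
        field_simp
        ring
    _ ≤ _ := by linarith

/-! ### Random deletions at a vertex -/

section Star

/-- The edges from `x` to the vertices of `S`. -/
def star (x : V) (S : Finset V) : Finset (Sym2 V) := S.image fun y ↦ s(x, y)

lemma card_star (x : V) (S : Finset V) : #(star x S) = #S :=
  card_image_of_injective _ fun y z h ↦ by
    rcases Sym2.eq_iff.1 h with h | h
    · exact h.2
    · exact h.2.trans h.1

lemma star_subset_star {x : V} {S T : Finset V} (h : S ⊆ T) : star x S ⊆ star x T :=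
  image_subset_image h

/-- The edges at `x` that cross the canonical maximum cut. -/
noncomputable def cutStar (r : ℕ) [NeZero r] (E : Finset (Sym2 V)) (x : V) : Finset (Sym2 V) :=
  star x (nbr E (maxCut r E) univ x)

lemma mem_star_nbr {E : Finset (Sym2 V)} {φ : V → Fin r} {x : V} {e : Sym2 V} :
    e ∈ star x (nbr E φ univ x) ↔ e ∈ E ∧ e ∈ cross φ ∧ x ∈ e := by
  simp only [star, mem_image, nbr, mem_filter, mem_univ, true_and]
  constructor
  · rintro ⟨y, ⟨h1, h2⟩, rfl⟩
    exact ⟨h2, by simpa using h1, by simp⟩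
  · rintro ⟨h1, h2, h3⟩
    obtain ⟨y, rfl⟩ := Sym2.mem_iff_exists.1 h3
    exact ⟨y, ⟨by simpa using h2, h1⟩, rfl⟩

/-- The probability that the canonical maximum cut survives the deletion of a random set of edges
of the cut at `x`, each edge being deleted with probability `ρ`. -/
noncomputable def robustness (r : ℕ) [NeZero r] (ρ : ℝ) (E : Finset (Sym2 V)) (x : V) : ℝ :=
  ∑ L ∈ (cutStar r E x).powerset with maxCut r (E \ L) = maxCut r E,
    ρ ^ #L * (1 - ρ) ^ (#(cutStar r E x) - #L)

/-- The identity that makes maximum cuts robust: deleting edges of the cut at `x` at random and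
adding random edges across the cut at `x` are inverse operations, and the second one never changes
the canonical maximum cut. -/
lemma ex_le_ex_robustness (h0 : 0 ≤ p) (h1 : p < 1) {ρ : ℝ} (hρ0 : 0 ≤ ρ) (hρ1 : ρ ≤ 1) (x : V) :
    ex p (fun E ↦ (1 - ρ) ^ #(nbr E (maxCut r E) univ x) *
      (1 + ρ * (p / (1 - p))) ^
        (#(nbr univ (maxCut r E) univ x) - #(nbr E (maxCut r E) univ x))) ≤
      ex p (fun E ↦ robustness r ρ E x) := by
  classical
  set g : Finset (Sym2 V) → Finset (Sym2 V) → ℝ := fun E L ↦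
    if L ⊆ star x (nbr univ (maxCut r E) univ x) then ρ ^ #L * (1 - ρ) ^ #(cutStar r E x) else 0
    with hg
  have key := sum_wt_sdiff h1 g
  -- Deleting `R`: the weight of `E \ R` counts `R` only if `R` lies across the maximum cut of `E \
  -- R`, and then `maxCut_union` shows that `E` has the same maximum cut.
  have lhs : ∀ E, ∑ R ∈ E.powerset, g (E \ R) R ≤ robustness r ρ E x := by
    intro E
    rw [robustness, hg]
    dsimp only
    have hmem : ∀ R ∈ E.powerset, R ⊆ star x (nbr univ (maxCut r (E \ R)) univ x) →
        maxCut r (E \ R) = maxCut r E ∧ R ⊆ cutStar r E x ∧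
          #(cutStar r (E \ R) x) = #(cutStar r E x) - #R := by
      intro R hR hRS
      rw [mem_powerset] at hR
      have hm : maxCut r (E \ R) = maxCut r E := by
        rw [← maxCut_union (E := E \ R) (L := R) (fun e he ↦ (mem_star_nbr.1 (hRS he)).2.1)
          disjoint_sdiff_self_left, sdiff_union_of_subset hR]
      have hRc : R ⊆ cutStar r E x := fun e he ↦ by
        have h := mem_star_nbr.1 (hRS he)
        rw [hm] at h
        exact mem_star_nbr.2 ⟨hR he, h.2⟩
      refine ⟨hm, hRc, ?_⟩
      rw [← card_sdiff_of_subset hRc]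
      congr 1
      ext e
      simp only [cutStar, Finset.mem_sdiff, mem_star_nbr, hm]
      tauto
    rw [← sum_filter, sum_congr rfl fun R hR ↦ by
      rw [(hmem R (mem_filter.1 hR).1 (mem_filter.1 hR).2).2.2]]
    refine sum_le_sum_of_subset_of_nonneg (fun R hR ↦ ?_) fun R _ _ ↦ ?_
    · obtain ⟨hR1, hR2⟩ := mem_filter.1 hR
      obtain ⟨h1, h2, -⟩ := hmem R hR1 hR2
      exact mem_filter.2 ⟨mem_powerset.2 h2, h1⟩
    · exact mul_nonneg (pow_nonneg hρ0 _) (pow_nonneg (by linarith) _)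
  -- Adding `R`: the subsets of the absent cut edges at `x` are summed by the binomial theorem.
  have rhs : ∀ E, ∑ R ∈ Eᶜ.powerset, g E R * (p / (1 - p)) ^ #R =
      (1 - ρ) ^ #(nbr E (maxCut r E) univ x) * (1 + ρ * (p / (1 - p))) ^
        (#(nbr univ (maxCut r E) univ x) - #(nbr E (maxCut r E) univ x)) := by
    intro E
    set S := star x (nbr univ (maxCut r E) univ x) with hS
    have hc : #(Eᶜ ∩ S) = #(nbr univ (maxCut r E) univ x) - #(nbr E (maxCut r E) univ x) := by
      have h1 : Eᶜ ∩ S = S \ cutStar r E x := by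
        ext e
        simp only [hS, cutStar, mem_inter, mem_compl, Finset.mem_sdiff, mem_star_nbr, mem_univ, true_and]
        tauto
      rw [h1, card_sdiff_of_subset, hS, cutStar, card_star, card_star]
      intro e he
      exact mem_star_nbr.2 ⟨mem_univ _, (mem_star_nbr.1 he).2⟩
    have h2 : ∑ R ∈ Eᶜ.powerset, g E R * (p / (1 - p)) ^ #R =
        ∑ R ∈ (Eᶜ ∩ S).powerset, (1 - ρ) ^ #(cutStar r E x) *
          ((ρ * (p / (1 - p))) ^ #R * 1 ^ (#(Eᶜ ∩ S) - #R)) := by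
      have : (Eᶜ ∩ S).powerset = Eᶜ.powerset.filter (· ⊆ S) := by
        ext R; simp only [mem_powerset, mem_filter, subset_inter_iff]
      rw [this, sum_filter]
      refine sum_congr rfl fun R _ ↦ ?_
      simp only [hg]
      split_ifs
      · rw [mul_pow, one_pow]; ring
      · rw [zero_mul]
    rw [h2, ← mul_sum, sum_pow_mul_eq_add_pow, hc, cutStar, card_star, add_comm]
  simp only [rhs] at key
  rw [ex, ← key, ex]
  exact sum_le_sum fun E _ ↦ mul_le_mul_of_nonneg_left (lhs E) (wt_nonneg h0 h1.le E)

/-- One minus the robustness is the probability that the cut is destroyed. -/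
lemma one_sub_robustness (ρ : ℝ) (E : Finset (Sym2 V)) (x : V) :
    1 - robustness r ρ E x = ∑ L ∈ (cutStar r E x).powerset with ¬ maxCut r (E \ L) = maxCut r E,
      ρ ^ #L * (1 - ρ) ^ (#(cutStar r E x) - #L) := by
  have h := sum_pow_mul_eq_add_pow ρ (1 - ρ) (cutStar r E x)
  rw [← sum_filter_add_sum_filter_not _ (fun L ↦ maxCut r (E \ L) = maxCut r E)] at h
  simp only [add_sub_cancel, one_pow] at h
  rw [robustness]
  linarith

/-- Estimate for the left-hand side of `ex_le_ex_robustness` at a vertex with at most `(1 + ζ) p t`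
cut edges, where `t` is its number of potential cut edges: the two factors nearly cancel. -/
lemma one_sub_le_pow_mul_pow {ρ ζ t d' : ℝ} {d m : ℕ} (h0 : 0 ≤ p) (h1 : p < 1) (hρ0 : 0 ≤ ρ)
    (hρ1 : ρ ≤ 1 / 2) (hζ0 : 0 ≤ ζ) (hζ1 : ζ ≤ 1) (hd : (d : ℝ) ≤ (1 + ζ) * (p * t)) (ht : 0 ≤ t)
    (hm : (m : ℝ) = t - d) (hd' : p * t ≤ d') :
    1 - ρ * d' * (ζ + 4 * ρ + 2 * p) ≤ (1 - ρ) ^ d * (1 + ρ * (p / (1 - p))) ^ m := by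
  have hp1 : 0 < 1 - p := by linarith
  have e1 : Real.exp (-(ρ + 2 * ρ ^ 2)) ≤ 1 - ρ := by
    rw [Real.exp_neg, inv_le_comm₀ (Real.exp_pos _) (by linarith)]
    refine le_trans ?_ (Real.add_one_le_exp _)
    rw [inv_le_iff_one_le_mul₀ (by linarith)]
    nlinarith [mul_nonneg hρ0 hρ0, mul_nonneg (mul_nonneg hρ0 hρ0) (by linarith : 0 ≤ 1 - 2 * ρ)]
  have e2 : Real.exp (ρ * p) ≤ 1 + ρ * (p / (1 - p)) := by
    have h3 : 0 < 1 - p + ρ * p := by positivity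
    have h4 : Real.exp (-(ρ * p)) ≥ 1 - ρ * p := by linarith [Real.add_one_le_exp (-(ρ * p))]
    rw [Real.exp_neg, ge_iff_le] at h4
    have h5 : 0 < 1 - ρ * p := by nlinarith
    have h6 : Real.exp (ρ * p) ≤ (1 - ρ * p)⁻¹ := by
      rw [le_inv_comm₀ (Real.exp_pos _) h5]; exact h4
    refine h6.trans ?_
    rw [inv_le_iff_one_le_mul₀ h5]
    have : (1 + ρ * (p / (1 - p))) * (1 - ρ * p) - 1 =
        ρ * p ^ 2 * (1 - ρ) / (1 - p) := by field_simp; ring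
    have h7 : 0 ≤ ρ * p ^ 2 * (1 - ρ) / (1 - p) := by
      apply div_nonneg _ hp1.le
      exact mul_nonneg (by positivity) (by linarith)
    linarith
  -- The main terms `-ρ * d` and `ρ * p * m` nearly cancel as `d` is about `p * t`.
  have e3 : Real.exp (-(ρ + 2 * ρ ^ 2) * d + ρ * p * m) ≤
      (1 - ρ) ^ d * (1 + ρ * (p / (1 - p))) ^ m := by
    rw [Real.exp_add, mul_comm _ (d : ℝ), Real.exp_nat_mul, mul_comm _ (m : ℝ), Real.exp_nat_mul]
    have : 0 ≤ 1 - ρ := by linarith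
    gcongr
  refine le_trans ?_ e3
  refine le_trans ?_ (Real.add_one_le_exp _)
  rw [hm]
  have k0 : 0 ≤ p * t := mul_nonneg h0 ht
  have k1 : ρ * (p * t) * (ζ + 4 * ρ + 2 * p) ≤ ρ * d' * (ζ + 4 * ρ + 2 * p) := by gcongr
  have k2 : (ρ + 2 * ρ ^ 2 + ρ * p) * d ≤ (ρ + 2 * ρ ^ 2 + ρ * p) * ((1 + ζ) * (p * t)) := by gcongr
  have k3 : (2 * ρ ^ 2 + ρ * p) * ((1 + ζ) * (p * t)) ≤ (2 * ρ ^ 2 + ρ * p) * (2 * (p * t)) := by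
    gcongr; linarith
  nlinarith

/-- The vertices at which the canonical maximum cut is likely not to survive the random deletion
of edges. -/
noncomputable def fragile (r : ℕ) [NeZero r] (ρ : ℝ) (E : Finset (Sym2 V)) : Finset V :=
  {x | robustness r ρ E x < 1 / 2}

/-- In a uniform graph, few vertices have too many neighbours across the maximum cut. -/
lemma card_high_degree_le {E : Finset (Sym2 V)} (hE : IsUniform r p η E) (hp : 0 < p) {ζ : ℝ}
    (hζ : 0 < ζ) {t : ℝ} (ht0 : 0 < t) (ht : ∀ x, t ≤ #(nbr univ (maxCut r E) univ x)) :
    (#{x | (1 + ζ) * (p * #(nbr univ (maxCut r E) univ x)) < #(nbr E (maxCut r E) univ x)} : ℝ) ≤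
      η / (ζ * p * t) := by
  set φ := maxCut r E
  set A : Finset V := {x | (1 + ζ) * (p * #(nbr univ φ univ x)) < #(nbr E φ univ x)} with hA
  have h1 := (abs_le.1 (hE.abs_le φ A univ)).2
  have h2 : (1 + ζ) * p * dsum univ φ A univ ≤ dsum E φ A univ := by
    simp only [dsum]
    push_cast
    rw [mul_sum]
    refine sum_le_sum fun x hx ↦ ?_
    have := (mem_filter.1 hx).2
    rw [mul_assoc]; exact this.le
  have h3 : #A * t ≤ dsum univ φ A univ := by
    simp only [dsum]
    push_cast
    rw [← nsmul_eq_mul]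
    exact card_nsmul_le_sum _ _ _ fun x _ ↦ ht x
  rw [le_div_iff₀ (by positivity)]
  have h4 := mul_le_mul_of_nonneg_left h3 (mul_pos hζ hp).le
  nlinarith

lemma robustness_le_one {ρ : ℝ} (hρ0 : 0 ≤ ρ) (hρ1 : ρ ≤ 1) (E : Finset (Sym2 V)) (x : V) :
    robustness r ρ E x ≤ 1 := by
  have : 0 ≤ 1 - robustness r ρ E x := by
    rw [one_sub_robustness]
    exact sum_nonneg fun _ _ ↦ mul_nonneg (pow_nonneg hρ0 _) (pow_nonneg (by linarith) _)
  linarith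

/-- The expected number of fragile vertices is small. -/
lemma ex_card_fragile_le (h0 : 0 < p) (h1 : p < 1) {ρ ζ t : ℝ} (hρ0 : 0 ≤ ρ) (hρ1 : ρ ≤ 1 / 2)
    (hζ0 : 0 < ζ) (hζ1 : ζ ≤ 1) (ht0 : 0 < t)
    (ht : ∀ E : Finset (Sym2 V), IsUniform r p η E →
      ∀ x, t ≤ #(nbr univ (maxCut r E) univ x)) (hη : 0 ≤ η) :
    ex p (fun E ↦ (#(fragile r ρ E : Finset V) : ℝ)) ≤
      2 * (Fintype.card V * (ρ * (p * Fintype.card V) * (ζ + 4 * ρ + 2 * p)) + η / (ζ * p * t) +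
        Fintype.card V * pr p {E : Finset (Sym2 V) | ¬ IsUniform r p η E}) := by
  classical
  have hρ1' : ρ ≤ 1 := by linarith
  set ε := ρ * (p * Fintype.card V) * (ζ + 4 * ρ + 2 * p) with hε
  have hε0 : 0 ≤ ε := by positivity
  set low : Finset (Sym2 V) → V → ℝ := fun E x ↦ (1 - ρ) ^ #(nbr E (maxCut r E) univ x) *
      (1 + ρ * (p / (1 - p))) ^
        (#(nbr univ (maxCut r E) univ x) - #(nbr E (maxCut r E) univ x)) with hlow
  have hlow0 : ∀ E x, 0 ≤ low E x := fun E x ↦ by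
    have : 0 ≤ p / (1 - p) := div_nonneg h0.le (by linarith)
    exact mul_nonneg (pow_nonneg (by linarith) _) (pow_nonneg (by positivity) _)
  -- a vertex is fragile with probability at most twice its expected deficiency
  have s1 : ∀ E, (#(fragile r ρ E : Finset V) : ℝ) ≤ 2 * ∑ x, (1 - robustness r ρ E x) := by
    intro E
    rw [mul_sum, fragile, card_filter]
    push_cast
    refine sum_le_sum fun x _ ↦ ?_
    have := robustness_le_one (r := r) hρ0 hρ1' E x
    split_ifs with h <;> linarith
  have s2 : ∀ E, ∑ x, (1 - low E x) ≤ Fintype.card V * ε + η / (ζ * p * t) +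
      Fintype.card V * ({E : Finset (Sym2 V) | ¬ IsUniform r p η E}.indicator 1 E : ℝ) := by
    intro E
    by_cases hE : IsUniform r p η E
    · rw [Set.indicator_of_notMem (by simpa using hE), mul_zero, add_zero]
      refine le_trans ?_ (add_le_add le_rfl (card_high_degree_le hE h0 hζ0 ht0 (ht E hE)))
      rw [card_filter]
      push_cast
      rw [← nsmul_eq_mul, ← card_univ, ← sum_const, ← sum_add_distrib]
      refine sum_le_sum fun x _ ↦ ?_
      split_ifs with h
      · linarith [hlow0 E x]
      · rw [not_lt] at h
        have hm : ((#(nbr univ (maxCut r E) univ x) - #(nbr E (maxCut r E) univ x) : ℕ) : ℝ) =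
            #(nbr univ (maxCut r E) univ x) - #(nbr E (maxCut r E) univ x) := by
          rw [Nat.cast_sub]
          exact card_le_card fun y hy ↦ by
            simp only [nbr, mem_filter, mem_univ, true_and, and_true] at hy ⊢; exact hy.1
        have := one_sub_le_pow_mul_pow (d' := p * Fintype.card V) h0.le h1 hρ0 hρ1 hζ0.le hζ1 h
          (Nat.cast_nonneg _) hm (by gcongr; exact card_le_univ _)
        simp only [hlow]
        linarith
    · rw [Set.indicator_of_mem (by exact hE), Pi.one_apply, mul_one]
      have : ∑ x, (1 - low E x) ≤ Fintype.card V := by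
        calc _ ≤ ∑ _x : V, (1 : ℝ) := sum_le_sum fun x _ ↦ by linarith [hlow0 E x]
          _ = _ := by simp
      have h3 : 0 ≤ η / (ζ * p * t) := by positivity
      have h4 : 0 ≤ (Fintype.card V : ℝ) * ε := by positivity
      linarith
  have s3 : ex p (fun E : Finset (Sym2 V) ↦ ∑ x, (1 - robustness r ρ E x)) ≤
      ex p (fun E ↦ ∑ x, (1 - low E x)) := by
    rw [ex_sum, ex_sum]
    refine sum_le_sum fun x _ ↦ ?_
    rw [ex_sub, ex_sub]
    linarith [ex_le_ex_robustness (r := r) h0.le h1 hρ0 hρ1' x]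
  have s4 := ex_mono h0.le h1.le s2
  rw [ex_add, ex_const, ex_mul_left] at s4
  refine (ex_mono h0.le h1.le s1).trans ?_
  rw [ex_mul_left]
  have := s3.trans s4
  simp only [pr]
  linarith

end Star

end Robustness

/-! ### Stability of near-maximum cuts -/

section Stability

variable {V : Type*} [Fintype V] [DecidableEq V] {r : ℕ} [NeZero r] {p η : ℝ}

/-- If many edges of the maximum cut at `z` are not in the near-maximum cut `ψ`, then deleting
random edges of the cut at `z` makes `ψ` overtake the maximum cut, so `z` is fragile. -/
lemma mul_card_lost_le {E : Finset (Sym2 V)} {ρ : ℝ} (hρ0 : 0 ≤ ρ) (hρ1 : ρ ≤ 1) {K : ℕ}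
    {ψ : V → Fin r} (hψ : #(E ∩ cross (maxCut r E)) ≤ #(E ∩ cross ψ) + K) {z : V}
    (hz : z ∉ fragile r ρ E) :
    ρ * #{y ∈ nbr E (maxCut r E) univ z | ψ z = ψ y} ≤ 4 * (K + 1) := by
  classical
  set φ := maxCut r E with hφ
  set S := cutStar r E z with hS
  set D := star z {y ∈ nbr E φ univ z | ψ z = ψ y} with hD
  rw [← card_star z, ← hD]
  by_contra! hlt
  have hz : 1 / 2 ≤ robustness r ρ E z := by
    by_contra! h; exact hz (by simpa [fragile] using h)
  have hDS : D ⊆ S := star_subset_star (filter_subset _ _)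
  have hSE : S ⊆ E := fun e he ↦ (mem_star_nbr.1 he).1
  have hSφ : S ⊆ cross φ := fun e he ↦ (mem_star_nbr.1 he).2.1
  have hDψ : Disjoint D (cross ψ) := by
    rw [Finset.disjoint_left]
    intro e he
    obtain ⟨y, hy, rfl⟩ := mem_image.1 he
    simpa using (mem_filter.1 hy).2
  -- if the deleted set contains more than `K` of the lost edges, then the cut does not survive
  have hL : ∀ L ∈ S.powerset, maxCut r (E \ L) = maxCut r E → #(L ∩ D) ≤ K := by
    intro L hL hm
    rw [mem_powerset] at hL
    have h1 := card_inter_cross_le (E \ L) ψ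
    rw [hm, ← hφ] at h1
    have h2 := card_sdiff_inter (hL.trans hSE) ψ
    have h3 := card_sdiff_inter (hL.trans hSE) φ
    rw [inter_eq_left.2 (hL.trans hSφ)] at h3
    have h4 : #(L ∩ D) + #(L ∩ cross ψ) ≤ #L := by
      rw [← card_union_of_disjoint (hDψ.mono inter_subset_right inter_subset_right)]
      exact card_le_card (union_subset inter_subset_left inter_subset_left)
    omega
  -- Compute the expectation of `2 ^ (-#(L ∩ D))` for the random set `L` of deleted edges; if the
  -- cut survives, then this is at least `2 ^ (-K)`.
  have hsum : robustness r ρ E z ≤ 2 ^ K * (1 - ρ / 2) ^ #D := by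
    have e1 : ∑ L ∈ S.powerset, ρ ^ #L * (1 - ρ) ^ (#S - #L) * (1 / 2 : ℝ) ^ #(L ∩ D) =
        (1 - ρ / 2) ^ #D := by
      have := prod_add (fun e ↦ ρ * if e ∈ D then (1 / 2 : ℝ) else 1) (fun _ ↦ 1 - ρ) S
      rw [← prod_const, ← inter_eq_right.2 hDS, ← prod_ite_mem, inter_eq_right.2 hDS]
      refine Eq.trans ?_ (this.symm.trans ?_)
      · refine sum_congr rfl fun L hL ↦ ?_
        rw [prod_mul_distrib, prod_const, prod_const, prod_ite_mem, prod_const,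
          card_sdiff_of_subset (mem_powerset.1 hL)]
        ring
      · refine prod_congr rfl fun e _ ↦ ?_
        split_ifs <;> ring
    rw [← e1, mul_sum, robustness]
    refine (sum_le_sum (f := fun L ↦ ρ ^ #L * (1 - ρ) ^ (#S - #L)) (g := fun L ↦
      2 ^ K * (ρ ^ #L * (1 - ρ) ^ (#S - #L) * (1 / 2 : ℝ) ^ #(L ∩ D))) fun L hL' ↦ ?_).trans
      (sum_le_sum_of_subset_of_nonneg (filter_subset _ _) fun L _ _ ↦ ?_)
    · obtain ⟨h1, h2⟩ := mem_filter.1 hL'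
      have h3 := hL L h1 h2
      have h4 : (1 : ℝ) ≤ 2 ^ K * (1 / 2) ^ #(L ∩ D) := by
        rw [one_div, inv_pow, ← div_eq_mul_inv, one_le_div (by positivity)]
        exact pow_le_pow_right₀ (by norm_num) h3
      have h5 : 0 ≤ ρ ^ #L * (1 - ρ) ^ (#S - #L) :=
        mul_nonneg (pow_nonneg hρ0 _) (pow_nonneg (by linarith) _)
      nlinarith
    · have : 0 ≤ 1 - ρ := by linarith
      positivity
  have h2 : (1 - ρ / 2) ^ #D ≤ (1 / 4 : ℝ) ^ (K + 1) := by
    have h3 : 1 - ρ / 2 ≤ Real.exp (-(ρ / 2)) := by linarith [Real.add_one_le_exp (-(ρ / 2))]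
    calc (1 - ρ / 2) ^ #D ≤ Real.exp (-(ρ / 2)) ^ #D := pow_le_pow_left₀ (by linarith) h3 _
      _ = Real.exp (-(ρ * #D / 2)) := by rw [← Real.exp_nat_mul]; ring_nf
      _ ≤ Real.exp (((K + 1 : ℕ) : ℝ) * (-2)) := by
        refine Real.exp_le_exp.2 ?_
        push_cast; linarith
      _ = Real.exp (-2) ^ (K + 1) := Real.exp_nat_mul _ _
      _ ≤ _ := by
        refine pow_le_pow_left₀ (Real.exp_pos _).le ?_ _
        rw [Real.exp_neg, inv_le_comm₀ (Real.exp_pos _) (by norm_num)]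
        have := Real.add_one_le_exp (1 : ℝ)
        have h5 : Real.exp 2 = Real.exp 1 * Real.exp 1 := by rw [← Real.exp_add]; norm_num
        rw [h5]
        norm_num
        nlinarith
  have h6 : (2 : ℝ) ^ K * (1 / 4) ^ (K + 1) < 1 / 2 := by
    rw [pow_succ, ← mul_assoc, ← mul_pow]
    have : ((2 : ℝ) * (1 / 4)) ^ K ≤ 1 := pow_le_one₀ (by norm_num) (by norm_num)
    linarith
  have h7 : (2 : ℝ) ^ K * (1 - ρ / 2) ^ #D ≤ 2 ^ K * (1 / 4) ^ (K + 1) := by gcongr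
  linarith

/-- If few pairs are separated by `φ` but not by `ψ`, then each class of `ψ` is mostly contained
in a class of `φ`. -/
lemma exists_matching (φ ψ : V → Fin r) : ∃ i : Fin r → Fin r,
    (#{z | φ z ≠ i (ψ z)} : ℝ) ^ 2 ≤ r ^ 2 * ∑ z, (#{y | φ z ≠ φ y ∧ ψ z = ψ y} : ℝ) := by
  classical
  have h : ∀ j, ∃ a : Fin r, ∀ b, #{x | ψ x = j ∧ φ x = b} ≤ #{x | ψ x = j ∧ φ x = a} := by
    intro j
    obtain ⟨a, -, ha⟩ := exists_max_image univ
      (fun b : Fin r ↦ #{x | ψ x = j ∧ φ x = b}) univ_nonempty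
    exact ⟨a, fun b ↦ ha b (mem_univ _)⟩
  choose i hi using h
  refine ⟨i, ?_⟩
  have hr : (0 : ℝ) < r := by exact_mod_cast Nat.pos_of_ne_zero (NeZero.ne r)
  set Δ : Finset V := {z | φ z ≠ i (ψ z)} with hΔ
  set d : Fin r → ℝ := fun j ↦ #{z ∈ Δ | ψ z = j} with hd
  have h1 : (#Δ : ℝ) = ∑ j, d j := by
    rw [card_eq_sum_card_fiberwise (f := ψ) (t := univ) (by simp)]; push_cast; rfl
  have h2 : ∀ z ∈ Δ, d (ψ z) ≤ r * #{y | φ z ≠ φ y ∧ ψ z = ψ y} := by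
    intro z hz
    have hz := (mem_filter.1 hz).2
    have h3 : #{x | ψ x = ψ z ∧ φ x = i (ψ z)} ≤ #{y | φ z ≠ φ y ∧ ψ z = ψ y} := by
      refine card_le_card fun y hy ↦ ?_
      simp only [mem_filter, mem_univ, true_and] at hy ⊢
      exact ⟨fun h ↦ hz (h.trans hy.2), hy.1.symm⟩
    have h4 : #{x ∈ Δ | ψ x = ψ z} ≤ r * #{x | ψ x = ψ z ∧ φ x = i (ψ z)} := by
      calc #{x ∈ Δ | ψ x = ψ z} ≤ #{x | ψ x = ψ z} := card_le_card fun x hx ↦ by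
            simp only [mem_filter, mem_univ, true_and] at hx ⊢; exact hx.2
        _ = ∑ b, #{x | ψ x = ψ z ∧ φ x = b} := by
            rw [card_eq_sum_card_fiberwise (f := φ) (t := univ) (by simp)]
            simp only [filter_filter]
        _ ≤ ∑ _b : Fin r, #{x | ψ x = ψ z ∧ φ x = i (ψ z)} := sum_le_sum fun b _ ↦ hi _ b
        _ = _ := by simp
    have := h4.trans (Nat.mul_le_mul_left r h3)
    simp only [hd]
    exact_mod_cast this
  have h5 : ∑ j, d j ^ 2 ≤ r * ∑ z, (#{y | φ z ≠ φ y ∧ ψ z = ψ y} : ℝ) := by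
    calc ∑ j, d j ^ 2 = ∑ z ∈ Δ, d (ψ z) := by
          rw [← sum_fiberwise Δ ψ]
          refine sum_congr rfl fun j _ ↦ ?_
          rw [sum_congr rfl (g := fun _ ↦ d j) fun z hz ↦ by rw [(mem_filter.1 hz).2], sum_const,
            nsmul_eq_mul, sq]
      _ ≤ ∑ z ∈ Δ, r * (#{y | φ z ≠ φ y ∧ ψ z = ψ y} : ℝ) := sum_le_sum h2
      _ ≤ _ := by
          rw [mul_sum]
          exact sum_le_sum_of_subset_of_nonneg (subset_univ _) fun _ _ _ ↦ by positivity
  have h6 := sq_sum_le_card_mul_sum_sq (s := (univ : Finset (Fin r))) (f := d)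
  rw [card_univ, Fintype.card_fin] at h6
  rw [h1]
  calc _ ≤ _ := h6
    _ ≤ r * (r * ∑ z, (#{y | φ z ≠ φ y ∧ ψ z = ψ y} : ℝ)) := by gcongr
    _ = _ := by ring

/-- Small sets whose vertices all have many neighbours inside the set, except for a set `B`, are
contained in one small set. -/
lemma exists_absorbing {E : Finset (Sym2 V)} (hE : IsUniform r p η E) (hp : 0 < p) (φ : V → Fin r)
    (B : Finset V) {g τ : ℝ} (hg : 0 < g) (hτ : p * τ ≤ g / 2)
    (hB : #B + 2 * (2 * η / g) ≤ τ) :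
    ∃ A : Finset V, (#A : ℝ) ≤ 2 * η / g ∧ ∀ D : Finset V, Disjoint D B → #B + #D ≤ τ →
      (∀ z ∈ D, g ≤ #(nbr E φ (B ∪ D) z)) → D ⊆ A := by
  classical
  -- sets with this property that are not too large are very small
  have small : ∀ D : Finset V, #B + #D ≤ τ → (∀ z ∈ D, g ≤ #(nbr E φ (B ∪ D) z)) →
      (#D : ℝ) ≤ 2 * η / g := by
    intro D hD hz
    have h1 := (abs_le.1 (hE.abs_le φ D (B ∪ D))).2
    have h2 : #D * g ≤ dsum E φ D (B ∪ D) := by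
      rw [dsum]; push_cast; rw [← nsmul_eq_mul]; exact card_nsmul_le_sum _ _ _ hz
    have h3 : (dsum univ φ D (B ∪ D) : ℝ) ≤ #D * (#B + #D) := by
      rw [dsum]; push_cast; rw [← nsmul_eq_mul]
      refine sum_le_card_nsmul _ _ _ fun z _ ↦ ?_
      exact_mod_cast (card_filter_le _ _).trans (card_union_le _ _)
    rw [le_div_iff₀ hg]
    have h4 : p * (dsum univ φ D (B ∪ D) : ℝ) ≤ #D * (g / 2) := by
      calc _ ≤ p * (#D * (#B + #D)) := by gcongr
        _ ≤ p * (#D * τ) := by gcongr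
        _ = #D * (p * τ) := by ring
        _ ≤ _ := by gcongr
    linarith
  set P : Finset (Finset V) := {D | Disjoint D B ∧ (#D : ℝ) ≤ 2 * η / g ∧
    ∀ z ∈ D, g ≤ #(nbr E φ (B ∪ D) z)} with hP
  -- The small sets with the property are closed under unions, since a union of two of them is not
  -- too large and hence small again. The largest one is therefore the union of all of them.
  have union : ∀ C ∈ P, ∀ D ∈ P, C ∪ D ∈ P := by
    intro C hC D hD
    simp only [hP, mem_filter, mem_univ, true_and] at hC hD ⊢
    have hn : ∀ z ∈ C ∪ D, g ≤ #(nbr E φ (B ∪ (C ∪ D)) z) := by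
      intro z hz
      rcases mem_union.1 hz with h | h
      · refine (hC.2.2 z h).trans ?_
        exact_mod_cast card_le_card (filter_subset_filter _
          (union_subset_union_right subset_union_left))
      · refine (hD.2.2 z h).trans ?_
        exact_mod_cast card_le_card (filter_subset_filter _
          (union_subset_union_right subset_union_right))
    refine ⟨disjoint_union_left.2 ⟨hC.1, hD.1⟩, small _ ?_ hn, hn⟩
    have : (#(C ∪ D) : ℝ) ≤ #C + #D := by exact_mod_cast card_union_le _ _
    linarith [hC.2.1, hD.2.1]
  by_cases hne : P.Nonempty
  · obtain ⟨A, hA, hmax⟩ := exists_max_image P card hne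
    refine ⟨A, ?_, fun D hD1 hD2 hD3 ↦ ?_⟩
    · simp only [hP, mem_filter, mem_univ, true_and] at hA
      exact hA.2.1
    · have hD : D ∈ P := by
        simp only [hP, mem_filter, mem_univ, true_and]
        exact ⟨hD1, small D hD2 hD3, hD3⟩
      have := eq_of_subset_of_card_le (subset_union_left (s₁ := A) (s₂ := D))
        (hmax _ (union A hA D hD))
      rw [this]; exact subset_union_right
  · refine ⟨∅, ?_, fun D hD1 hD2 hD3 ↦ ?_⟩
    · by_contra! hcon
      rw [card_empty, Nat.cast_zero] at hcon
      refine hne ⟨∅, ?_⟩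
      exfalso
      have h1 := (abs_nonneg _).trans (hE.abs_le φ ∅ ∅)
      have : 0 ≤ 2 * η / g := by positivity
      linarith
    · refine absurd ⟨D, ?_⟩ hne
      simp only [hP, mem_filter, mem_univ, true_and]
      exact ⟨hD1, small D hD2 hD3, hD3⟩

/-- The vertices with unusually few neighbours in some other class of the cut `φ`. -/
noncomputable def poor (p : ℝ) (E : Finset (Sym2 V)) (φ : V → Fin r) : Finset V :=
  {z | ∃ i, φ z ≠ i ∧ #(nbr E φ (cls φ i) z) < p * #(cls φ i) / 2}

/-- In a uniform graph, few vertices have far fewer neighbours than expected in some other class.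
-/
lemma card_poor_le {E : Finset (Sym2 V)} (hE : IsUniform r p η E) (hp : 0 < p) (φ : V → Fin r)
    {t : ℝ} (ht : 0 < t) (hcls : ∀ i, t ≤ #(cls φ i)) :
    (#(poor p E φ) : ℝ) ≤ r * (2 * η / (p * t)) := by
  classical
  set A : Fin r → Finset V := fun i ↦ {z | φ z ≠ i ∧ #(nbr E φ (cls φ i) z) < p * #(cls φ i) / 2}
    with hA
  have h1 : poor p E φ ⊆ univ.biUnion A := fun z hz ↦ by
    simp only [poor, mem_filter, mem_univ, true_and] at hz
    obtain ⟨i, hi⟩ := hz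
    exact mem_biUnion.2 ⟨i, mem_univ _, by simpa [hA] using hi⟩
  have h2 : ∀ i, (#(A i) : ℝ) ≤ 2 * η / (p * t) := by
    intro i
    have h3 := (abs_le.1 (hE.abs_le φ (A i) (cls φ i))).1
    have h4 : (dsum E φ (A i) (cls φ i) : ℝ) ≤ #(A i) * (p * #(cls φ i) / 2) := by
      rw [dsum]; push_cast; rw [← nsmul_eq_mul]
      refine sum_le_card_nsmul _ _ _ fun z hz ↦ ?_
      simp only [hA, mem_filter, mem_univ, true_and] at hz
      exact hz.2.le
    have h5 : (dsum univ φ (A i) (cls φ i) : ℝ) = #(A i) * #(cls φ i) := by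
      rw [dsum]; push_cast
      rw [sum_congr rfl (g := fun _ ↦ (#(cls φ i) : ℝ)), sum_const, nsmul_eq_mul]
      intro z hz
      simp only [hA, mem_filter, mem_univ, true_and] at hz
      congr 2
      ext y
      simp only [nbr, cls, mem_filter, mem_univ, true_and, and_true]
      exact ⟨fun h ↦ h.1, fun h ↦ ⟨h, by rw [h]; exact hz.1⟩⟩
    rw [le_div_iff₀ (by positivity)]
    rw [h5] at h3
    have h6 : (#(A i) : ℝ) * (p * t) ≤ #(A i) * (p * #(cls φ i)) := by gcongr; exact hcls i
    nlinarith
  calc (#(poor p E φ) : ℝ) ≤ ∑ i, (#(A i) : ℝ) := by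
        exact_mod_cast (card_le_card h1).trans card_biUnion_le
    _ ≤ ∑ _i : Fin r, 2 * η / (p * t) := sum_le_sum fun i _ ↦ h2 i
    _ = _ := by simp

/-- In a uniform graph with few fragile vertices, there is a small set `B` of vertices such that the
canonical maximum cut survives the deletion of any few edges that avoid `B`: all cuts of nearly
maximum size agree, up to the names of the classes, outside `B`. -/
lemma exists_contested {E : Finset (Sym2 V)} (hE : IsUniform r p η E) (hp : 0 < p) {ρ : ℝ}
    (hρ0 : 0 < ρ) (hρ1 : ρ ≤ 1) (K : ℕ) {n : ℝ} (hn : Fintype.card V = n) (hn0 : 0 < n)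
    (hcls : ∀ i, n / (2 * r) ≤ #(cls (maxCut r E) i))
    (hK : 4 * (K + 1) / ρ ≤ p * n / (2 ^ 14 * r ^ 4))
    (hfr : (#(fragile r ρ E : Finset V) : ℝ) ≤ n / (2 ^ 14 * r ^ 4))
    (hη : η ≤ p * n ^ 2 / (2 ^ 16 * r ^ 4)) :
    ∃ B : Finset V, (#B : ℝ) ≤ #(fragile r ρ E : Finset V) + 20 * r ^ 2 * (η / (p * n)) ∧
      ∀ R ⊆ E ∩ cross (maxCut r E), #R ≤ K → (∀ e ∈ R, ∀ x ∈ e, x ∉ B) →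
        maxCut r (E \ R) = maxCut r E := by
  classical
  set φ := maxCut r E with hφ
  set F : Finset V := fragile r ρ E with hF
  set B₀ := F ∪ poor p E φ with hB₀
  have hr : (1 : ℝ) ≤ r := by exact_mod_cast Nat.one_le_iff_ne_zero.2 (NeZero.ne r)
  have hr0 : (0 : ℝ) < r := by linarith
  have hη0 : 0 ≤ η := (abs_nonneg _).trans (hE.abs_le φ ∅ ∅)
  have hr4 : (r : ℝ) ≤ r ^ 4 := le_self_pow₀ hr (by norm_num)
  have hr24 : (r : ℝ) ^ 2 ≤ r ^ 4 := pow_le_pow_right₀ hr (by norm_num)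
  have hr34 : (r : ℝ) ^ 3 ≤ r ^ 4 := pow_le_pow_right₀ hr (by norm_num)
  set g := p * n / (8 * r) with hg
  have hg0 : 0 < g := by positivity
  -- numerical consequences of the hypotheses
  have hpoor : (#(poor p E φ) : ℝ) ≤ 4 * r ^ 2 * (η / (p * n)) := by
    refine (card_poor_le hE hp φ (t := n / (2 * r)) (by positivity) hcls).trans_eq ?_
    field_simp; ring
  have hb : 2 * η / g = 16 * r * (η / (p * n)) := by rw [hg]; field_simp; ring
  have hηn : r ^ 3 * (η / (p * n)) ≤ n / 2 ^ 16 := by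
    have : η / (p * n) ≤ n / (2 ^ 16 * r ^ 4) := by
      rw [div_le_iff₀ (by positivity)]
      refine hη.trans_eq ?_
      field_simp
    calc _ ≤ (r : ℝ) ^ 4 * (n / (2 ^ 16 * r ^ 4)) := by gcongr
      _ = _ := by field_simp
  have hηn2 : r ^ 2 * (η / (p * n)) ≤ n / 2 ^ 16 / r := by
    rw [le_div_iff₀ hr0]; refine Eq.trans_le ?_ hηn; ring
  have hηn1 : r * (η / (p * n)) ≤ n / 2 ^ 16 / r := by
    refine le_trans ?_ hηn2
    have : 0 ≤ η / (p * n) := by positivity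
    gcongr
    exact le_self_pow₀ hr (by norm_num)
  have hFn : (#F : ℝ) ≤ n / 2 ^ 14 / r := by
    refine hfr.trans ?_
    rw [div_div]
    gcongr
  have hKn : 4 * (K + 1) / ρ ≤ g / 2 := by
    refine hK.trans ?_
    rw [hg, div_div]
    gcongr p * n / ?_
    nlinarith
  have hB₀c : (#B₀ : ℝ) ≤ #F + #(poor p E φ) := by exact_mod_cast card_union_le _ _
  obtain ⟨A, hA, hAD⟩ := exists_absorbing hE hp φ B₀ hg0 (τ := n / (16 * r))
    (by rw [hg]; apply le_of_eq; field_simp; norm_num) (by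
      rw [hb]
      have : n / (16 * r) = n / 16 / r := by rw [div_div]
      rw [this]
      have h3 : n / r = 16 * (n / 16 / r) := by field_simp
      have h4 : n / 2 ^ 16 / r = (n / r) / 2 ^ 16 := by field_simp
      have h5 : n / 2 ^ 14 / r = (n / r) / 2 ^ 14 := by field_simp
      have h6 : 0 < n / r := by positivity
      rw [h4] at hηn2 hηn1
      rw [h5] at hFn
      linarith)
  refine ⟨B₀ ∪ A, ?_, fun R hR hRK hRB ↦ ?_⟩
  · have h1 : (#(B₀ ∪ A) : ℝ) ≤ #B₀ + #A := by exact_mod_cast card_union_le _ _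
    rw [hb] at hA
    have : r * (η / (p * n)) ≤ r ^ 2 * (η / (p * n)) := by
      have : 0 ≤ η / (p * n) := by positivity
      gcongr
      exact le_self_pow₀ hr (by norm_num)
    linarith
  refine maxCut_sdiff (hR.trans inter_subset_left) fun ψ hψ ↦ ?_
  rw [← hφ] at hψ
  have hψK : #(E ∩ cross φ) ≤ #(E ∩ cross ψ) + K := hψ.trans (by omega)
  have hlost : ∀ z, z ∉ F → (#{y ∈ nbr E φ univ z | ψ z = ψ y} : ℝ) ≤ 4 * (K + 1) / ρ := by
    intro z hz
    rw [le_div_iff₀' hρ0]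
    exact mul_card_lost_le hρ0.le hρ1 hψK hz
  -- few pairs are separated by `φ` but not by `ψ`
  have hD : ∑ z, (#{y | φ z ≠ φ y ∧ ψ z = ψ y} : ℝ) ≤ n ^ 2 / (2 ^ 12 * r ^ 4) := by
    have h1 := (abs_le.1 (hE.1 (fun x ↦ (φ x, ψ x)) univ univ)).1
    have h2 := (abs_le.1 (hE.abs_le ψ univ univ)).2
    have split : ∀ (G : Finset (Sym2 V)) (z : V),
        #(nbr G (fun x ↦ (φ x, ψ x)) univ z) =
          #{y ∈ nbr G φ univ z | ψ z = ψ y} + #(nbr G ψ univ z) := by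
      intro G z
      rw [← card_union_of_disjoint]
      · congr 1
        ext y
        simp only [nbr, mem_filter, mem_univ, true_and, mem_union, ne_eq, Prod.mk.injEq]
        tauto
      · rw [Finset.disjoint_left]
        intro y h1 h2
        simp only [nbr, mem_filter, mem_univ, true_and] at h1 h2
        exact h2.1 h1.2
    have hs : ∀ G : Finset (Sym2 V), (dsum G (fun x ↦ (φ x, ψ x)) univ univ : ℝ) =
        ∑ z, (#{y ∈ nbr G φ univ z | ψ z = ψ y} : ℝ) + dsum G ψ univ univ := by
      intro G
      simp only [dsum, split]
      push_cast
      rw [sum_add_distrib]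
    have hu : ∀ z, {y ∈ nbr univ φ univ z | ψ z = ψ y} =
        ({y | φ z ≠ φ y ∧ ψ z = ψ y} : Finset V) := by
      intro z; ext y; simp [nbr]
    rw [hs, hs] at h1
    simp only [hu] at h1
    have h3 : ∑ z, (#{y ∈ nbr E φ univ z | ψ z = ψ y} : ℝ) ≤
        n * (4 * (K + 1) / ρ) + (p * (#F * n) + η) := by
      have h4 : (dsum E φ F univ : ℝ) ≤ p * (#F * n) + η := by
        have h5 := (abs_le.1 (hE.abs_le φ F univ)).2
        have h6 : (dsum univ φ F univ : ℝ) ≤ #F * n := by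
          rw [dsum]; push_cast; rw [← nsmul_eq_mul, ← hn]
          exact sum_le_card_nsmul _ _ _ fun z _ ↦ by exact_mod_cast card_le_univ _
        have := mul_le_mul_of_nonneg_left h6 hp.le
        linarith
      calc ∑ z, (#{y ∈ nbr E φ univ z | ψ z = ψ y} : ℝ)
          ≤ ∑ z, (4 * (K + 1) / ρ + if z ∈ F then (#(nbr E φ univ z) : ℝ) else 0) := by
            refine sum_le_sum fun z _ ↦ ?_
            split_ifs with h
            · have h7 : (#{y ∈ nbr E φ univ z | ψ z = ψ y} : ℝ) ≤ #(nbr E φ univ z) := by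
                exact_mod_cast card_filter_le _ _
              have h8 : 0 ≤ 4 * (K + 1) / ρ := by positivity
              linarith
            · rw [add_zero]; exact hlost z h
        _ = n * (4 * (K + 1) / ρ) + dsum E φ F univ := by
            rw [sum_add_distrib, sum_const, card_univ, nsmul_eq_mul, hn, sum_ite_mem, univ_inter,
              dsum]
            push_cast; rfl
        _ ≤ _ := by linarith
    have h9 : p * ∑ z, (#{y | φ z ≠ φ y ∧ ψ z = ψ y} : ℝ) ≤
        p * (n ^ 2 / (2 ^ 12 * r ^ 4)) := by
      have k1 : n * (4 * (K + 1) / ρ) ≤ n * (p * n / (2 ^ 14 * r ^ 4)) := by gcongr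
      have k2 : p * (#F * n) ≤ p * (n / (2 ^ 14 * r ^ 4) * n) := by gcongr
      have k3 : n * (p * n / (2 ^ 14 * r ^ 4)) + p * (n / (2 ^ 14 * r ^ 4) * n) +
          3 * (p * n ^ 2 / (2 ^ 16 * r ^ 4)) ≤ p * (n ^ 2 / (2 ^ 12 * r ^ 4)) := by
        have : 0 < p * n ^ 2 / r ^ 4 := by positivity
        have e1 : n * (p * n / (2 ^ 14 * r ^ 4)) = p * n ^ 2 / r ^ 4 / 2 ^ 14 := by field_simp
        have e2 : p * (n / (2 ^ 14 * r ^ 4) * n) = p * n ^ 2 / r ^ 4 / 2 ^ 14 := by field_simp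
        have e3 : p * n ^ 2 / (2 ^ 16 * r ^ 4) = p * n ^ 2 / r ^ 4 / 2 ^ 16 := by field_simp
        have e4 : p * (n ^ 2 / (2 ^ 12 * r ^ 4)) = p * n ^ 2 / r ^ 4 / 2 ^ 12 := by field_simp
        rw [e1, e2, e3, e4]
        linarith
      linarith
    exact le_of_mul_le_mul_left h9 hp
  -- Each class of `ψ` is matched with the class of `φ` that contains most of it. Few vertices are
  -- outside the matched classes; call the set of these `Δ`.
  obtain ⟨i, hi⟩ := exists_matching φ ψ
  set Δ : Finset V := {z | φ z ≠ i (ψ z)} with hΔ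
  have hΔn : (#Δ : ℝ) ≤ n / (64 * r) := by
    refine abs_le_of_sq_le_sq' ?_ (by positivity) |>.2
    refine hi.trans ((mul_le_mul_of_nonneg_left hD (by positivity)).trans_eq ?_)
    field_simp; norm_num
  -- The matching is a bijection, since an unmatched class of `φ` would be contained in `Δ`.
  have hinj : Function.Injective i := by
    refine Finite.injective_iff_surjective.2 fun a ↦ ?_
    by_contra! hcon
    have : cls φ a ⊆ Δ := fun z hz ↦ by
      simp only [cls, hΔ, mem_filter, mem_univ, true_and] at hz ⊢
      rw [hz]; exact (hcon _).symm
    have h1 : (#(cls φ a) : ℝ) ≤ #Δ := by exact_mod_cast card_le_card this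
    have h2 := hcls a
    have h3 : n / (64 * r) < n / (2 * r) := by
      apply div_lt_div_of_pos_left hn0 (by positivity); linarith
    linarith
  -- A vertex of `Δ` that is not poor has many neighbours in the class of `φ` matched with its
  -- class of `ψ`. If it is not fragile either, then most of these are not in its class of `ψ`, and
  -- so are in `Δ`.
  have hnbr : ∀ z ∈ Δ \ B₀, g ≤ #(nbr E φ (B₀ ∪ Δ \ B₀) z) := by
    intro z hz
    obtain ⟨hzΔ, hzB⟩ := Finset.mem_sdiff.1 hz
    simp only [hB₀, mem_union, not_or] at hzB
    have hzΔ' : φ z ≠ i (ψ z) := by simpa [hΔ] using hzΔ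
    have h1 : p * #(cls φ (i (ψ z))) / 2 ≤ #(nbr E φ (cls φ (i (ψ z))) z) := by
      by_contra! hcon
      exact hzB.2 (by simp only [poor, mem_filter, mem_univ, true_and]; exact ⟨_, hzΔ', hcon⟩)
    have h2 := hlost z hzB.1
    have h3 : nbr E φ (cls φ (i (ψ z))) z ⊆
        {y ∈ nbr E φ univ z | ψ z = ψ y} ∪ nbr E φ (B₀ ∪ Δ \ B₀) z := by
      intro y hy
      simp only [nbr, cls, mem_filter, mem_univ, true_and, mem_union] at hy ⊢
      by_cases hψy : ψ z = ψ y
      · left; exact ⟨hy.2, hψy⟩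
      · right
        refine ⟨?_, hy.2⟩
        have : y ∈ Δ := by
          simp only [hΔ, mem_filter, mem_univ, true_and]
          rw [hy.1]
          exact fun h ↦ hψy (hinj h)
        by_cases hyB : y ∈ B₀
        · exact Or.inl hyB
        · exact Or.inr (Finset.mem_sdiff.2 ⟨this, hyB⟩)
    have h4 : (#(nbr E φ (cls φ (i (ψ z))) z) : ℝ) ≤
        #{y ∈ nbr E φ univ z | ψ z = ψ y} + #(nbr E φ (B₀ ∪ Δ \ B₀) z) := by
      exact_mod_cast (card_le_card h3).trans (card_union_le _ _)
    have h5 := mul_le_mul_of_nonneg_left (hcls (i (ψ z))) hp.le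
    have h6 : p * (n / (2 * r)) = 4 * g := by rw [hg]; field_simp; norm_num
    linarith
  -- Therefore the absorbing set, which does not depend on `ψ`, contains these vertices.
  have hΔA : Δ \ B₀ ⊆ A := by
    refine hAD _ disjoint_sdiff_self_left ?_ hnbr
    have h1 : (#(Δ \ B₀) : ℝ) ≤ #Δ := by exact_mod_cast card_le_card sdiff_subset
    have h3 : n / (64 * r) = n / r / 64 := by field_simp
    have h4 : n / 2 ^ 16 / r = (n / r) / 2 ^ 16 := by field_simp
    have h5 : n / 2 ^ 14 / r = (n / r) / 2 ^ 14 := by field_simp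
    have h6 : 0 < n / r := by positivity
    have h7 : n / (16 * r) = n / r / 16 := by field_simp
    rw [h4] at hηn2
    rw [h5] at hFn
    rw [h3] at hΔn
    rw [h7]
    linarith
  -- an edge of the maximum cut that avoids `B` joins two different classes of `ψ`
  intro e he
  have hecr := (mem_inter.1 (hR he)).2
  have hnot := hRB e he
  induction e with | _ x y
  rw [mk_mem_cross] at hecr ⊢
  have hgood : ∀ w ∈ s(x, y), φ w = i (ψ w) := by
    intro w hw
    by_contra hcon
    refine hnot w hw ?_
    by_cases hwB : w ∈ B₀
    · exact mem_union_left _ hwB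
    · exact mem_union_right _ (hΔA (Finset.mem_sdiff.2 ⟨by simpa [hΔ] using hcon, hwB⟩))
  intro hxy
  apply hecr
  rw [hgood x (by simp), hgood y (by simp), hxy]

end Stability

section Uniform

variable {α : Type*} [Fintype α] [DecidableEq α] {p : ℝ} {ι : Type*} [DecidableEq ι]

/-! ### Upper tails of all subcounts at once -/

lemma overlap_mono (h0 : 0 ≤ p) {I J : Finset ι} (A : ι → Finset α) (h : I ⊆ J) :
    overlap I A p ≤ overlap J A p :=
  (sum_le_sum fun _ _ ↦ sum_le_sum_of_subset_of_nonneg (filter_subset_filter _ h)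
    fun _ _ _ ↦ pow_nonneg h0 _).trans
    (sum_le_sum_of_subset_of_nonneg h fun _ _ _ ↦ sum_nonneg fun _ _ ↦ pow_nonneg h0 _)

/-- Janson's inequality bounds lower tails of counts with exponentially small error. Applied to the
complementary counts, and combined with Chebyshev's inequality for the total count, it bounds the
upper tails of exponentially many subcounts simultaneously. -/
lemma pr_exists_mean_add_le_cnt (h0 : 0 ≤ p) (h1 : p ≤ 1) {β : Type*} [Fintype β]
    (I : Finset ι) (J : β → Finset ι) (hJ : ∀ b, J b ⊆ I) (A : ι → Finset α) {D t : ℝ}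
    (hD : overlap I A p ≤ D) (hD0 : 0 < D) (ht : 0 < t) :
    pr p {E | ∃ b, mean (J b) A p + 2 * t ≤ cnt (J b) A E} ≤
      D / t ^ 2 + Fintype.card β * Real.exp (-(t ^ 2 / (2 * D))) := by
  have hsplit : ∀ b E, cnt I A E = cnt (J b) A E + cnt (I \ J b) A E := fun b E ↦ by
    rw [cnt, cnt, cnt, add_comm, sum_sdiff (hJ b)]
  have hmean : ∀ b, mean I A p = mean (J b) A p + mean (I \ J b) A p := fun b ↦ by
    rw [mean, mean, mean, add_comm, sum_sdiff (hJ b)]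
  have hsub : {E | ∃ b, mean (J b) A p + 2 * t ≤ cnt (J b) A E} ⊆
      {E | mean I A p + t ≤ cnt I A E} ∪
        {E | ∃ b, E ∈ {E | cnt (I \ J b) A E ≤ mean (I \ J b) A p - t}} := by
    rintro E ⟨b, hb⟩
    by_contra hcon
    simp only [Set.mem_union, Set.mem_ofPred_eq, not_or, not_le, not_exists] at hcon
    have := hcon.2 b
    linarith [hcon.1, hsplit b E, hmean b]
  refine (pr_mono h0 h1 hsub).trans ((pr_union_le h0 h1 _ _).trans (add_le_add ?_ ?_))
  · exact pr_mean_add_le_cnt h0 h1 hD ht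
  · exact pr_exists_le h0 h1 _ fun b ↦
      pr_cnt_le_mean_sub h0 h1 ((overlap_mono h0 A sdiff_subset).trans hD) hD0 ht.le

end Uniform

/-! ### Copies of a fixed graph -/

section Copies

variable {U V : Type*} [Fintype U] [DecidableEq U] [Fintype V] [DecidableEq V] {p : ℝ}

/-- The image of the edge set `S` under an injection. -/
def img (S : Finset (Sym2 U)) (f : U ↪ V) : Finset (Sym2 V) := S.map f.sym2Map

/-- The edge sets of the copies on the vertex set `V` of the graph with edge set `S`. -/
noncomputable def copies (V : Type*) [Fintype V] [DecidableEq V] (S : Finset (Sym2 U)) :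
    Finset (Finset (Sym2 V)) := univ.image (img S)

lemma card_img (S : Finset (Sym2 U)) (f : U ↪ V) : #(img S f) = #S := card_map _

lemma card_of_mem_copies {S : Finset (Sym2 U)} {C : Finset (Sym2 V)} (hC : C ∈ copies V S) :
    #C = #S := by
  obtain ⟨f, -, rfl⟩ := mem_image.1 hC
  exact card_img S f

lemma sum_copies_le {S : Finset (Sym2 U)} {g : Finset (Sym2 V) → ℝ} (hg : ∀ C, 0 ≤ g C) :
    ∑ C ∈ copies V S, g C ≤ ∑ f : U ↪ V, g (img S f) := by
  rw [sum_comp g (img S)]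
  refine sum_le_sum fun C hC ↦ ?_
  have : 1 ≤ #{f : U ↪ V | img S f = C} := by
    obtain ⟨f, -, rfl⟩ := mem_image.1 hC
    exact card_pos.2 ⟨f, by simp⟩
  rw [nsmul_eq_mul]
  have h2 : (1 : ℝ) ≤ #{f : U ↪ V | img S f = C} := by exact_mod_cast this
  nlinarith [hg C]

/-- The vertices covered by the edges of `J`. -/
def verts (J : Finset (Sym2 U)) : Finset U := {x | ∃ e ∈ J, x ∈ e}

/-- The edges of `B` that `f'` maps into `img A f`. -/
def common (A B : Finset (Sym2 U)) (f f' : U ↪ V) : Finset (Sym2 U) :=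
  {e ∈ B | f'.sym2Map e ∈ img A f}

lemma img_common (A B : Finset (Sym2 U)) (f f' : U ↪ V) :
    img (common A B f f') f' = img A f ∩ img B f' := by
  ext e
  simp only [img, common, Finset.mem_map, mem_filter, mem_inter]
  constructor
  · rintro ⟨e, ⟨h1, h2⟩, rfl⟩; exact ⟨h2, e, h1, rfl⟩
  · rintro ⟨h2, e, h1, rfl⟩; exact ⟨e, ⟨h1, h2⟩, rfl⟩

lemma card_union_img (A B : Finset (Sym2 U)) (f f' : U ↪ V) :
    #(img A f ∪ img B f') + #(common A B f f') = #A + #B := by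
  rw [← card_img (common A B f f') f', img_common, card_union_add_card_inter, card_img, card_img]

/-- An injection whose image overlaps the copy `img A f` exactly in `J` maps `verts J` into the
range of `f`. -/
lemma card_common_eq_le (A B J : Finset (Sym2 U)) (f : U ↪ V) :
    #{f' : U ↪ V | common A B f f' = J} ≤
      Fintype.card U ^ #(verts J) * Fintype.card V ^ (Fintype.card U - #(verts J)) := by
  classical
  -- The vertices in `verts J` go to the image of `f`, and the other ones are arbitrary.
  set t : U → Finset V := fun x ↦ if x ∈ verts J then univ.map f else univ with ht
  calc _ ≤ #(Fintype.piFinset t) := by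
        refine card_le_card_of_injOn (fun f' ↦ f') (fun f' hf' ↦ ?_)
          (fun a _ b _ h ↦ DFunLike.coe_injective h)
        have hf' : common A B f f' = J := by simpa using hf'
        rw [mem_coe, Fintype.mem_piFinset]
        intro x
        simp only [ht]
        split_ifs with hx
        · simp only [verts, mem_filter, mem_univ, true_and] at hx
          obtain ⟨e, he, hxe⟩ := hx
          rw [← hf'] at he
          obtain ⟨y, rfl⟩ := Sym2.mem_iff_exists.1 hxe
          simp only [common, img, mem_filter, Finset.mem_map, Function.Embedding.sym2Map_apply] at he
          obtain ⟨-, d, -, hd⟩ := he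
          induction d with | _ a b
          rw [Sym2.map_mk, Sym2.map_mk, Sym2.eq_iff] at hd
          simp only [Finset.mem_map, mem_univ, true_and]
          rcases hd with h | h
          · exact ⟨a, h.1⟩
          · exact ⟨b, h.2⟩
        · exact mem_univ _
    _ = ∏ x, #(t x) := Fintype.card_piFinset _
    _ = ∏ x, if x ∈ verts J then Fintype.card U else Fintype.card V := by
        refine prod_congr rfl fun x _ ↦ ?_
        simp only [ht]
        split_ifs
        · rw [card_map, card_univ]
        · rw [card_univ]
    _ = _ := by
        rw [prod_ite, prod_const, prod_const]
        congr 2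
        · simp
        · rw [← card_compl]; congr 1; ext; simp

/-- The expected number of pairs of copies (labelled, of the graphs with edge sets `A` and `B`) whose
common part belongs to a given class of graphs, none of which is rare in the random graph. -/
lemma sum_common_le (h0 : 0 < p) (A B : Finset (Sym2 U)) (Q : Finset (Sym2 U) → Prop)
    [DecidablePred Q] {Φ n : ℝ} (hn : Fintype.card V = n) (hn0 : 0 < n) (hΦ0 : 0 < Φ)
    (hΦ : ∀ J ⊆ B, Q J → Φ ≤ n ^ #(verts J) * p ^ #J) :
    ∑ f : U ↪ V, ∑ f' : U ↪ V with Q (common A B f f'), p ^ #(img A f ∪ img B f') ≤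
      (Fintype.card U : ℝ) ^ Fintype.card U * 2 ^ #B *
        (n ^ Fintype.card U * p ^ #A) * (n ^ Fintype.card U * p ^ #B) / Φ := by
  classical
  set u := Fintype.card U
  have key : ∀ f : U ↪ V, ∑ f' : U ↪ V with Q (common A B f f'), p ^ #(img A f ∪ img B f') ≤
      (u : ℝ) ^ u * 2 ^ #B * p ^ #A * (n ^ u * p ^ #B) / Φ := by
    intro f
    have h1 : ∀ J ∈ B.powerset, ∑ f' : U ↪ V with Q (common A B f f') ∧ common A B f f' = J,
        p ^ #(img A f ∪ img B f') ≤ (u : ℝ) ^ u * p ^ #A * (n ^ u * p ^ #B) / Φ := by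
      intro J hJ
      rw [mem_powerset] at hJ
      by_cases hQ : Q J
      · have hcard := card_common_eq_le A B J f
        have hv : #(verts J) ≤ u := card_le_univ _
        have hJp : p ^ (#A + #B) = p ^ (#A + #B - #J) * p ^ #J := by
          rw [← pow_add, Nat.sub_add_cancel ((card_le_card hJ).trans (Nat.le_add_left _ _))]
        have hterm : ∀ f' ∈ ({f' : U ↪ V | Q (common A B f f') ∧ common A B f f' = J} :
            Finset (U ↪ V)), p ^ #(img A f ∪ img B f') = p ^ (#A + #B - #J) := by
          intro f' hf'
          have := card_union_img A B f f'
          rw [(mem_filter.1 hf').2.2] at this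
          congr 1; omega
        rw [sum_congr rfl hterm, sum_const, nsmul_eq_mul]
        have h2 : (#{f' : U ↪ V | Q (common A B f f') ∧ common A B f f' = J} : ℝ) ≤
            (u : ℝ) ^ #(verts J) * n ^ (u - #(verts J)) := by
          have h3 : #{f' : U ↪ V | Q (common A B f f') ∧ common A B f f' = J} ≤
            u ^ #(verts J) * Fintype.card V ^ (u - #(verts J)) :=
              le_trans (card_le_card fun f' hf' ↦ by
                simp only [mem_filter, mem_univ, true_and] at hf' ⊢; exact hf'.2) hcard
          rw [← hn]
          exact_mod_cast h3
        have hU : (u : ℝ) ^ #(verts J) ≤ (u : ℝ) ^ u := by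
          rcases Nat.eq_zero_or_pos u with h | h
          · have : #(verts J) = 0 := by omega
            rw [this, h]
          · exact pow_le_pow_right₀ (by exact_mod_cast h) hv
        rw [le_div_iff₀ hΦ0]
        calc _ ≤ ((u : ℝ) ^ u * n ^ (u - #(verts J))) * p ^ (#A + #B - #J) *
              (n ^ #(verts J) * p ^ #J) := by
              have := hΦ J hJ hQ
              gcongr
              exact h2.trans (by gcongr)
          _ = (u : ℝ) ^ u * (n ^ (u - #(verts J)) * n ^ #(verts J)) *
              (p ^ (#A + #B - #J) * p ^ #J) := by ring
          _ = _ := by rw [← hJp, ← pow_add, Nat.sub_add_cancel hv, pow_add]; ring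
      · rw [filter_false_of_mem]
        · rw [sum_empty]; positivity
        · rintro f' - ⟨h2, h3⟩
          exact hQ (h3 ▸ h2)
    calc _ = ∑ J ∈ B.powerset, ∑ f' : U ↪ V with Q (common A B f f') ∧ common A B f f' = J,
          p ^ #(img A f ∪ img B f') := by
          rw [← sum_fiberwise_of_maps_to (t := B.powerset) (g := fun f' ↦ common A B f f')]
          · simp only [filter_filter]
          · intro f' _; exact mem_powerset.2 (filter_subset _ _)
      _ ≤ ∑ _J ∈ B.powerset, (u : ℝ) ^ u * p ^ #A * (n ^ u * p ^ #B) / Φ := sum_le_sum h1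
      _ = _ := by
          rw [sum_const, card_powerset, nsmul_eq_mul]; push_cast; ring
  refine (sum_le_sum fun f _ ↦ key f).trans ?_
  rw [sum_const, nsmul_eq_mul, card_univ]
  have hcard : (Fintype.card (U ↪ V) : ℝ) ≤ n ^ u := by
    rw [← hn]
    have : Fintype.card (U ↪ V) ≤ Fintype.card (U → V) :=
      Fintype.card_le_of_injective _ DFunLike.coe_injective
    rw [Fintype.card_fun] at this
    exact_mod_cast this
  calc _ ≤ n ^ u * ((u : ℝ) ^ u * 2 ^ #B * p ^ #A * (n ^ u * p ^ #B) / Φ) := by gcongr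
    _ = _ := by ring

end Copies

section Switching

variable {α : Type*} [Fintype α] [DecidableEq α] {p : ℝ}

/-! ### The switching inequality -/

/-- **Switching.** Suppose that every pair `(E, e)` with `e ∈ good E` can be switched to pairs
`(E \ R, e)` for sets `R` of total `w`-weight at least one, where `e` belongs to a small set
`Y (E \ R)` and `R` is contained in a small set `M (E \ R) e`. Then `good` is small on average:
re-inserting `R` costs a factor `p / (1 - p)` for each element, and the sum of
`(w * p / (1 - p)) ^ #R` over the subsets `R` of `M` is at most `exp (w * p / (1 - p) * #M)`. -/
lemma ex_card_le_of_switching (h0 : 0 ≤ p) (h1 : p < 1) (good Y : Finset α → Finset α)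
    (tr : Finset α → α → Finset (Finset α)) (M : Finset α → α → Finset α) {w Λ Y₀ : ℝ}
    (hw : 0 ≤ w) (hY₀ : 0 ≤ Y₀)
    (htr : ∀ E, ∀ e ∈ good E, ∀ R ∈ tr E e, R ⊆ E ∧ e ∈ Y (E \ R) ∧ R ⊆ M (E \ R) e ∧
      (#(Y (E \ R)) : ℝ) ≤ Y₀ ∧ w * (p / (1 - p)) * #(M (E \ R) e) ≤ Λ)
    (hsum : ∀ E, ∀ e ∈ good E, 1 ≤ ∑ R ∈ tr E e, w ^ #R) :
    ex p (fun E ↦ (#(good E) : ℝ)) ≤ Y₀ * Real.exp Λ := by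
  classical
  set Q : Finset α → α → Prop := fun E e ↦
    (#(Y E) : ℝ) ≤ Y₀ ∧ w * (p / (1 - p)) * #(M E e) ≤ Λ with hQ
  set g : Finset α → Finset α → ℝ := fun E R ↦
    ∑ e ∈ Y E, if R ⊆ M E e ∧ Q E e then w ^ #R else 0 with hg
  have hp : 0 ≤ p / (1 - p) := div_nonneg h0 (by linarith)
  -- `g (E \ R) R` is the weight of the switchings that lead from `E` to `E \ R`.
  have step1 : ∀ E, (#(good E) : ℝ) ≤ ∑ R ∈ E.powerset, g (E \ R) R := by
    intro E
    calc (#(good E) : ℝ) = ∑ e ∈ good E, (1 : ℝ) := by simp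
      _ ≤ ∑ e ∈ good E, ∑ R ∈ tr E e, w ^ #R := sum_le_sum (hsum E)
      _ ≤ ∑ e ∈ good E, ∑ R ∈ E.powerset,
          if e ∈ Y (E \ R) ∧ R ⊆ M (E \ R) e ∧ Q (E \ R) e then w ^ #R else 0 := by
          refine sum_le_sum fun e he ↦ ?_
          rw [← sum_filter]
          refine sum_le_sum_of_subset_of_nonneg (fun R hR ↦ ?_) fun _ _ _ ↦ pow_nonneg hw _
          obtain ⟨a, b, c, d⟩ := htr E e he R hR
          simp only [mem_filter, mem_powerset]
          exact ⟨a, b, c, d⟩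
      _ = ∑ R ∈ E.powerset, ∑ e ∈ good E,
          if e ∈ Y (E \ R) ∧ R ⊆ M (E \ R) e ∧ Q (E \ R) e then w ^ #R else 0 := sum_comm
      _ ≤ _ := by
          refine sum_le_sum fun R _ ↦ ?_
          simp only [hg]
          rw [← sum_filter, ← sum_filter]
          refine sum_le_sum_of_subset_of_nonneg (fun e he ↦ ?_) fun _ _ _ ↦ pow_nonneg hw _
          simp only [mem_filter] at he ⊢
          exact he.2
  -- The weight of the switchings that lead to `E`, with the cost of inserting `R`: there are at
  -- most `Y₀` choices of `e`, and `R` is an arbitrary subset of `M E e`.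
  have step2 : ∀ E, ∑ R ∈ Eᶜ.powerset, g E R * (p / (1 - p)) ^ #R ≤ Y₀ * Real.exp Λ := by
    intro E
    calc _ ≤ ∑ R : Finset α, g E R * (p / (1 - p)) ^ #R := by
          refine sum_le_sum_of_subset_of_nonneg (subset_univ _) fun R _ _ ↦ ?_
          refine mul_nonneg (sum_nonneg fun e _ ↦ ?_) (pow_nonneg hp _)
          split_ifs <;> positivity
      _ = ∑ e ∈ Y E, ∑ R : Finset α,
            if R ⊆ M E e ∧ Q E e then (w * (p / (1 - p))) ^ #R else 0 := by
          simp only [hg, sum_mul]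
          rw [sum_comm]
          refine sum_congr rfl fun e _ ↦ sum_congr rfl fun R _ ↦ ?_
          split_ifs
          · rw [mul_pow]
          · rw [zero_mul]
      _ ≤ ∑ e ∈ Y E, if (#(Y E) : ℝ) ≤ Y₀ then Real.exp Λ else 0 := by
          refine sum_le_sum fun e _ ↦ ?_
          by_cases hq : Q E e
          · rw [if_pos hq.1]
            simp only [hq, and_true]
            rw [← sum_filter]
            have : ({R | R ⊆ M E e} : Finset (Finset α)) = (M E e).powerset := by
              ext R; simp
            rw [this]
            have e1 := sum_pow_mul_eq_add_pow (w * (p / (1 - p))) 1 (M E e)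
            simp only [one_pow, mul_one] at e1
            rw [e1]
            calc _ ≤ Real.exp (w * (p / (1 - p))) ^ #(M E e) :=
                  pow_le_pow_left₀ (by positivity) (Real.add_one_le_exp _) _
              _ = Real.exp (w * (p / (1 - p)) * #(M E e)) := by
                  rw [← Real.exp_nat_mul]; ring_nf
              _ ≤ _ := Real.exp_le_exp.2 hq.2
          · simp only [hq, and_false, if_false, sum_const_zero]
            split_ifs <;> positivity
      _ ≤ _ := by
          split_ifs with h
          · rw [sum_const, nsmul_eq_mul]
            gcongr
          · simp; positivity
  calc _ ≤ ∑ E, wt p E * ∑ R ∈ E.powerset, g (E \ R) R := ex_mono h0 h1.le step1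
    _ = ∑ E, wt p E * ∑ R ∈ Eᶜ.powerset, g E R * (p / (1 - p)) ^ #R := sum_wt_sdiff h1 g
    _ ≤ ex p (fun _ ↦ Y₀ * Real.exp Λ) := ex_mono h0 h1.le step2
    _ = _ := ex_const _ _

/-- The sets that contain exactly one element of each member of the family `D`. -/
def transversals {ι : Type*} (I : Finset ι) (D : ι → Finset α) : Finset (Finset α) :=
  {R ∈ (I.biUnion D).powerset | ∀ i ∈ I, #(R ∩ D i) = 1}

lemma card_of_mem_transversals {ι : Type*} {I : Finset ι} {D : ι → Finset α}
    (hd : (I : Set ι).PairwiseDisjoint D) {R : Finset α} (hR : R ∈ transversals I D) :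
    #R = #I := by
  simp only [transversals, mem_filter, mem_powerset] at hR
  have : R = I.biUnion fun i ↦ R ∩ D i := by
    rw [← inter_biUnion, inter_eq_left.2 hR.1]
  rw [this, card_biUnion, sum_congr rfl hR.2, sum_const, smul_eq_mul, mul_one]
  intro i hi j hj hij
  exact (hd hi hj hij).mono inter_subset_right inter_subset_right

/-- There are at least `d ^ #I` transversals, each with `#I` elements. -/
lemma one_le_sum_transversals {ι : Type*} [DecidableEq ι] {I : Finset ι} {D : ι → Finset α}
    (hd : (I : Set ι).PairwiseDisjoint D) {d : ℕ} (hd0 : 0 < d) (hD : ∀ i ∈ I, #(D i) = d) :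
    (1 : ℝ) ≤ ∑ R ∈ transversals I D, (1 / (d : ℝ)) ^ #R := by
  have hcard : d ^ #I ≤ #(transversals I D) := by
    calc d ^ #I = #(I.pi D) := by rw [card_pi, prod_congr rfl hD, prod_const]
      _ ≤ _ := by
        have huniq : ∀ a ∈ I.pi D, ∀ i (hi : i ∈ I),
            (I.attach.image fun j ↦ a j.1 j.2) ∩ D i = {a i hi} := by
          intro a ha i hi
          rw [Finset.mem_pi] at ha
          ext x
          simp only [mem_inter, mem_image, mem_attach, true_and, Subtype.exists, mem_singleton]
          constructor
          · rintro ⟨⟨j, hj, rfl⟩, hx⟩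
            by_contra hne
            have hij : j ≠ i := by rintro rfl; exact hne rfl
            exact Finset.disjoint_left.1 (hd hj hi hij) (ha j hj) hx
          · rintro rfl; exact ⟨⟨i, hi, rfl⟩, ha i hi⟩
        refine card_le_card_of_injOn (fun a ↦ I.attach.image fun j ↦ a j.1 j.2) ?_ ?_
        · intro a ha
          simp only [transversals, coe_filter, mem_powerset, Set.mem_ofPred_eq]
          refine ⟨fun x hx ↦ ?_, fun i hi ↦ by rw [huniq a ha i hi, card_singleton]⟩
          simp only [mem_image, mem_attach, true_and, Subtype.exists] at hx
          obtain ⟨j, hj, rfl⟩ := hx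
          exact mem_biUnion.2 ⟨j, hj, Finset.mem_pi.1 ha j hj⟩
        · intro a ha b hb hab
          funext i hi
          have h1 := huniq a ha i hi
          have h2 := huniq b hb i hi
          simp only at hab
          rw [hab, h2] at h1
          exact (singleton_injective h1).symm
  rw [sum_congr rfl fun R hR ↦ by rw [card_of_mem_transversals hd hR], sum_const, nsmul_eq_mul,
    one_div, inv_pow, ← div_eq_mul_inv, one_le_div (by positivity)]
  exact_mod_cast hcard

end Switching

section Closers

variable {U V : Type*} [Fintype U] [DecidableEq U] [Fintype V] [DecidableEq V] {p : ℝ}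
  {r : ℕ} [NeZero r] {S : Finset (Sym2 U)} {E : Finset (Sym2 V)}

/-! ### Copies closed by an edge inside a part of the maximum cut -/

/-- The copies that consist of `e` and edges of the canonical maximum cut of `E`. -/
noncomputable def closers (S : Finset (Sym2 U)) (r : ℕ) [NeZero r] (E : Finset (Sym2 V))
    (e : Sym2 V) : Finset (Finset (Sym2 V)) :=
  {C ∈ copies V S | e ∈ C ∧ C.erase e ⊆ E ∩ cross (maxCut r E)}

/-- The edges of `E` that lie inside a part of its canonical maximum cut. -/
noncomputable def inner (r : ℕ) [NeZero r] (E : Finset (Sym2 V)) : Finset (Sym2 V) :=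
  E ∩ inside (maxCut r E)

/-- No edge of `E` inside a part can be added to the canonical maximum cut of `E` without creating
a copy. -/
def IsSaturated (S : Finset (Sym2 U)) (r : ℕ) [NeZero r] (E : Finset (Sym2 V)) : Prop :=
  ∀ e ∈ inner r E, (closers S r E e).Nonempty

/-- The copies in `E`. -/
noncomputable def copiesIn (S : Finset (Sym2 U)) (E : Finset (Sym2 V)) :
    Finset (Finset (Sym2 V)) := {C ∈ copies V S | C ⊆ E}

/-- The number of copies in `E` that contain the edge `f`. -/
noncomputable def copyDeg (S : Finset (Sym2 U)) (E : Finset (Sym2 V)) (f : Sym2 V) : ℕ :=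
  #{C ∈ copiesIn S E | f ∈ C}

/-- The pairs `(C, f)` where the copy `C` has `e` as its only edge not in the cut `φ` and `f ≠ e` is
an edge of `C` such that the rest of `C` is contained in `E`. -/
noncomputable def nearClosers (S : Finset (Sym2 U)) (φ : V → Fin r) (E : Finset (Sym2 V))
    (e : Sym2 V) : Finset (Finset (Sym2 V) × Sym2 V) :=
  {x ∈ copies V S ×ˢ univ | e ∈ x.1 ∧ x.2 ∈ x.1 ∧ x.2 ≠ e ∧ x.1.erase e ⊆ cross φ ∧
    x.1.erase x.2 ⊆ E}

/-- The edges inside the parts that can be added to the maximum cut without creating a copy. -/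
noncomputable def unclosed (S : Finset (Sym2 U)) (r : ℕ) [NeZero r] (E : Finset (Sym2 V)) :
    Finset (Sym2 V) := {e ∈ inner r E | closers S r E e = ∅}

lemma mem_closers {e : Sym2 V} {C : Finset (Sym2 V)} : C ∈ closers S r E e ↔
    C ∈ copies V S ∧ e ∈ C ∧ C.erase e ⊆ E ∩ cross (maxCut r E) := by
  simp [closers]

lemma mem_copiesIn {C : Finset (Sym2 V)} : C ∈ copiesIn S E ↔ C ∈ copies V S ∧ C ⊆ E := by
  simp [copiesIn]

lemma closers_subset {e : Sym2 V} (he : e ∈ E) : closers S r E e ⊆ copiesIn S E := by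
  intro C hC
  obtain ⟨h1, h2, h3⟩ := mem_closers.1 hC
  refine mem_copiesIn.2 ⟨h1, fun f hf ↦ ?_⟩
  by_cases hfe : f = e
  · exact hfe ▸ he
  · exact (mem_inter.1 (h3 (mem_erase.2 ⟨hfe, hf⟩))).1

lemma notMem_cross_of_mem_inner {e : Sym2 V} (he : e ∈ inner r E) :
    e ∉ cross (maxCut r E) := fun h ↦
  Finset.disjoint_left.1 (disjoint_cross_inside _) h (mem_inter.1 he).2

/-- A copy is closed by at most one edge. -/
lemma pairwiseDisjoint_closers :
    ((inner r E : Finset (Sym2 V)) : Set (Sym2 V)).PairwiseDisjoint (closers S r E) := by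
  intro e _ e' he' hne
  rw [Function.onFun, Finset.disjoint_left]
  intro C hC hC'
  refine notMem_cross_of_mem_inner he' (mem_inter.1 ((mem_closers.1 hC).2.2 ?_)).2
  exact mem_erase.2 ⟨hne.symm, (mem_closers.1 hC').2.1⟩

lemma sum_closers_le (g : Finset (Sym2 V) → ℕ) :
    ∑ e ∈ inner r E, ∑ C ∈ closers S r E e, g C ≤ ∑ C ∈ copiesIn S E, g C := by
  rw [← sum_biUnion pairwiseDisjoint_closers]
  refine sum_le_sum_of_subset fun C hC ↦ ?_
  obtain ⟨e, he, hC⟩ := mem_biUnion.1 hC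
  exact closers_subset (mem_inter.1 he).1 hC

/-- Double counting of the pairs of a copy and one of its edges. -/
lemma sum_copiesIn (X : Finset (Sym2 V)) (g : Sym2 V → ℕ) :
    ∑ C ∈ copiesIn S E, ∑ f ∈ C ∩ X, g f = ∑ f ∈ E ∩ X, copyDeg S E f * g f := by
  have : ∀ C ∈ copiesIn S E, ∑ f ∈ C ∩ X, g f = ∑ f ∈ E ∩ X, if f ∈ C then g f else 0 := by
    intro C hC
    rw [← sum_filter]
    refine sum_congr ?_ fun _ _ ↦ rfl
    ext f
    simp only [mem_inter, mem_filter]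
    have := @(mem_copiesIn.1 hC).2 f
    tauto
  rw [sum_congr rfl this, sum_comm]
  refine sum_congr rfl fun f _ ↦ ?_
  rw [← sum_filter, sum_const, smul_eq_mul, copyDeg]

/-- Few edges close a copy that uses an edge of a small set `X`. -/
lemma card_touching_le (X : Finset (Sym2 V)) :
    #{e ∈ inner r E | ∃ C ∈ closers S r E e, ∃ f ∈ C.erase e, f ∈ X} ≤
      ∑ f ∈ E ∩ X, copyDeg S E f := by
  calc _ ≤ ∑ e ∈ inner r E, ∑ C ∈ closers S r E e, ∑ f ∈ C ∩ X, 1 := by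
        rw [card_filter]
        refine sum_le_sum fun e _ ↦ ?_
        split_ifs with h
        · obtain ⟨C, hC, f, hf, hfX⟩ := h
          refine le_trans ?_ (single_le_sum (f := fun C ↦ ∑ f ∈ C ∩ X, 1)
            (fun C _ ↦ Nat.zero_le (∑ f ∈ C ∩ X, 1)) hC)
          simp only [sum_const, smul_eq_mul, mul_one]
          exact card_pos.2 ⟨f, mem_inter.2 ⟨(mem_erase.1 hf).2, hfX⟩⟩
        · exact Nat.zero_le _
    _ ≤ ∑ C ∈ copiesIn S E, ∑ f ∈ C ∩ X, 1 := sum_closers_le fun C ↦ ∑ f ∈ C ∩ X, 1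
    _ = _ := by rw [sum_copiesIn]; simp

/-- Bounds the total number of copies that can be destroyed by switching, over all the edges inside
the parts. -/
lemma sum_closers_copyDeg_le :
    ∑ e ∈ inner r E, ∑ C ∈ closers S r E e, ∑ f ∈ C.erase e, copyDeg S E f ≤
      ∑ f ∈ E, copyDeg S E f ^ 2 := by
  calc _ ≤ ∑ e ∈ inner r E, ∑ C ∈ closers S r E e, ∑ f ∈ C ∩ univ, copyDeg S E f :=
        sum_le_sum fun e _ ↦ sum_le_sum fun C _ ↦ sum_le_sum_of_subset fun f hf ↦
          mem_inter.2 ⟨(mem_erase.1 hf).2, mem_univ _⟩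
    _ ≤ _ := sum_closers_le fun C ↦ ∑ f ∈ C ∩ univ, copyDeg S E f
    _ = _ := by rw [sum_copiesIn]; simp [sq]

/-- The pairs of different copies in `E` with at least two common edges. -/
noncomputable def clusters (S : Finset (Sym2 U)) (E : Finset (Sym2 V)) :
    Finset (Finset (Sym2 V) × Finset (Sym2 V)) :=
  {x ∈ copiesIn S E ×ˢ copiesIn S E | x.1 ≠ x.2 ∧ 2 ≤ #(x.1 ∩ x.2)}

open scoped Classical in
/-- The copies closed by an edge `e` all contain `e`; if two of them share another edge, they form
a cluster. -/
lemma card_clustered_le :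
    #{e ∈ inner r E | ¬ (closers S r E e : Set (Finset (Sym2 V))).PairwiseDisjoint
      (fun C ↦ C.erase e)} ≤ #(clusters S E) := by
  set g : Finset (Sym2 V) → ℕ := fun C ↦ #{C' ∈ copiesIn S E | C ≠ C' ∧ 2 ≤ #(C ∩ C')} with hg
  have h : #(clusters S E) = ∑ C ∈ copiesIn S E, g C := by
    rw [clusters, card_filter, sum_product]
    simp only [hg, card_filter]
  rw [h]
  refine le_trans ?_ (sum_closers_le (r := r) g)
  rw [card_filter]
  refine sum_le_sum fun e he ↦ ?_
  split_ifs with h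
  · exact Nat.zero_le _
  · simp only [Set.PairwiseDisjoint, Set.Pairwise, Function.onFun, not_forall, mem_coe] at h
    obtain ⟨C, hC, C', hC', hne, hd⟩ := h
    refine le_trans ?_ (single_le_sum (fun _ _ ↦ Nat.zero_le _) hC)
    rw [Finset.not_disjoint_iff] at hd
    obtain ⟨f, hf, hf'⟩ := hd
    have heE := (mem_inter.1 he).1
    refine card_pos.2 ⟨C', mem_filter.2 ⟨closers_subset heE hC', hne, ?_⟩⟩
    rw [mem_erase] at hf hf'
    rw [← card_pair hf.1]
    refine card_le_card fun x hx ↦ ?_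
    rw [mem_insert, mem_singleton] at hx
    rcases hx with rfl | rfl
    · exact mem_inter.2 ⟨hf.2, hf'.2⟩
    · exact mem_inter.2 ⟨(mem_closers.1 hC).2.1, (mem_closers.1 hC').2.1⟩

/-- The near-copies counted by `nearClosers`, over all edges inside the parts of `φ`. -/
noncomputable def nearIndex (S : Finset (Sym2 U)) (φ : V → Fin r) :
    Finset (Finset (Sym2 V) × Sym2 V) :=
  {x ∈ copies V S ×ˢ univ | x.2 ∈ x.1 ∧ ∃ e ∈ x.1, e ∈ inside φ ∧ x.2 ≠ e ∧ x.1.erase e ⊆ cross φ}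

/-- Each near-copy has only one edge inside the parts, and so is counted for one edge only. -/
lemma sum_card_nearClosers_le :
    (∑ e ∈ inner r E, (#(nearClosers S (maxCut r E) E e) : ℝ)) ≤
      cnt (nearIndex S (maxCut r E)) (fun x ↦ x.1.erase x.2) E := by
  have hd : ((inner r E : Finset (Sym2 V)) : Set (Sym2 V)).PairwiseDisjoint
      (nearClosers S (maxCut r E) E) := by
    intro e _ e' he' hne
    rw [Function.onFun, Finset.disjoint_left]
    rintro ⟨C, f⟩ hC hC'
    simp only [nearClosers, mem_filter] at hC hC'
    exact notMem_cross_of_mem_inner he' (hC.2.2.2.2.1 (mem_erase.2 ⟨hne.symm, hC'.2.1⟩))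
  rw [← Nat.cast_sum, ← card_biUnion hd, cnt, sum_boole, Nat.cast_le]
  refine card_le_card fun x hx ↦ ?_
  obtain ⟨e, he, hx⟩ := mem_biUnion.1 hx
  simp only [nearClosers, nearIndex, mem_filter] at hx ⊢
  exact ⟨⟨hx.1, hx.2.2.1, e, hx.2.1, (mem_inter.1 he).2, hx.2.2.2.1, hx.2.2.2.2.1⟩,
    hx.2.2.2.2.2⟩

/-- The second moment of the copy degrees counts pairs of copies that meet. -/
lemma sum_copyDeg_sq_le :
    ∑ f ∈ E, copyDeg S E f ^ 2 ≤
      #S * #{x ∈ copiesIn S E ×ˢ copiesIn S E | ¬ Disjoint x.1 x.2} := by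
  have h1 : ∑ f ∈ E, copyDeg S E f ^ 2 = ∑ C ∈ copiesIn S E, ∑ f ∈ C ∩ univ, copyDeg S E f := by
    rw [sum_copiesIn]; simp [sq]
  rw [h1, card_filter, sum_product, mul_sum]
  refine sum_le_sum fun C hC ↦ ?_
  simp only [copyDeg, card_filter, inter_univ]
  rw [sum_comm, mul_sum]
  refine sum_le_sum fun C' _ ↦ ?_
  rw [← card_filter]
  split_ifs with h
  · rw [filter_false_of_mem fun f hf hf' ↦ Finset.disjoint_left.1 h hf hf']
    simp
  · rw [mul_one, ← card_of_mem_copies (mem_copiesIn.1 hC).1]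
    exact card_filter_le _ _

/-! ### Switching at a good edge -/

/-- Deleting cut edges does not affect the edges inside the parts, if the cut stays the same. -/
lemma inner_sdiff {R : Finset (Sym2 V)} (hR : R ⊆ E ∩ cross (maxCut r E))
    (hcut : maxCut r (E \ R) = maxCut r E) : inner r (E \ R) = inner r E := by
  ext e
  simp only [inner, hcut, mem_inter, Finset.mem_sdiff]
  constructor
  · rintro ⟨⟨h1, -⟩, h2⟩; exact ⟨h1, h2⟩
  · rintro ⟨h1, h2⟩
    exact ⟨⟨h1, fun h ↦ Finset.disjoint_left.1 (disjoint_cross_inside _)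
      (mem_inter.1 (hR h)).2 h2⟩, h2⟩

/-- After deleting `R` from a saturated graph, an edge that no longer closes a copy belongs to a
copy that meets `R`. -/
lemma card_unclosed_sdiff_le (hsat : IsSaturated S r E) {R : Finset (Sym2 V)}
    (hR : R ⊆ E ∩ cross (maxCut r E)) (hcut : maxCut r (E \ R) = maxCut r E) :
    #(unclosed S r (E \ R)) ≤ #S * ∑ f ∈ R, copyDeg S E f := by
  calc _ ≤ #(R.biUnion fun f ↦ ({C ∈ copiesIn S E | f ∈ C} : Finset (Finset (Sym2 V))).biUnion
        id) := by
        refine card_le_card fun e he ↦ ?_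
        rw [unclosed, mem_filter, inner_sdiff hR hcut] at he
        obtain ⟨C, hC⟩ := hsat e he.1
        have hC' := mem_closers.1 hC
        have : ¬ C ∈ closers S r (E \ R) e := by rw [he.2]; exact notMem_empty _
        rw [mem_closers, hcut] at this
        have h3 : ∃ f ∈ C.erase e, f ∈ R := by
          by_contra! hcon
          refine this ⟨hC'.1, hC'.2.1, fun f hf ↦ ?_⟩
          have := mem_inter.1 (hC'.2.2 hf)
          exact mem_inter.2 ⟨Finset.mem_sdiff.2 ⟨this.1, hcon f hf⟩, this.2⟩
        obtain ⟨f, hf, hfR⟩ := h3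
        refine mem_biUnion.2 ⟨f, hfR, mem_biUnion.2 ⟨C, mem_filter.2
          ⟨closers_subset (mem_inter.1 he.1).1 hC, (mem_erase.1 hf).2⟩, hC'.2.1⟩⟩
    _ ≤ ∑ f ∈ R, copyDeg S E f * #S := by
        refine card_biUnion_le.trans (sum_le_sum fun f _ ↦ ?_)
        refine card_biUnion_le_card_mul _ _ _ fun C hC ↦ ?_
        exact (card_of_mem_copies (mem_copiesIn.1 (mem_filter.1 hC).1).1).le
    _ = _ := by rw [← sum_mul, mul_comm]

lemma one_le_copyDeg {f : Sym2 V} {C : Finset (Sym2 V)} (hC : C ∈ copiesIn S E) (hf : f ∈ C) :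
    1 ≤ copyDeg S E f :=
  card_pos.2 ⟨C, mem_filter.2 ⟨hC, hf⟩⟩

/-- The switching inequality for the random graph: an edge `e` inside a part of the maximum cut is
switched to an edge that closes no copy, by deleting one edge from each copy that `e` closes. -/
lemma ex_card_good_le (h0 : 0 ≤ p) (h1 : p < 1) (hS : 2 ≤ #S) {Λ Y₀ : ℝ} {K : ℕ} (hY₀ : 0 ≤ Y₀)
    (hK : Y₀ ≤ K) (good : Finset (Sym2 V) → Finset (Sym2 V)) (B : Finset (Sym2 V) → Finset V)
    (hB : ∀ E, (good E).Nonempty → IsSaturated S r E ∧ ∀ R ⊆ E ∩ cross (maxCut r E), #R ≤ K →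
      (∀ e ∈ R, ∀ x ∈ e, x ∉ B E) → maxCut r (E \ R) = maxCut r E)
    (hgood : ∀ E, ∀ e ∈ good E, e ∈ inner r E ∧
      (∀ C ∈ closers S r E e, ∀ f ∈ C.erase e, ∀ x ∈ f, x ∉ B E) ∧
      (closers S r E e : Set (Finset (Sym2 V))).PairwiseDisjoint (fun C ↦ C.erase e) ∧
      ((#S * ∑ C ∈ closers S r E e, ∑ f ∈ C.erase e, copyDeg S E f : ℕ) : ℝ) ≤ Y₀ ∧
      1 / ((#S - 1 : ℕ) : ℝ) * (p / (1 - p)) * #(nearClosers S (maxCut r E) E e) ≤ Λ) :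
    ex p (fun E ↦ (#(good E) : ℝ)) ≤ Y₀ * Real.exp Λ := by
  have hcard : ∀ (E : Finset (Sym2 V)) (e : Sym2 V), ∀ C ∈ closers S r E e,
      #(C.erase e) = #S - 1 := fun E e C hC ↦ by
    obtain ⟨a, b, -⟩ := mem_closers.1 hC
    rw [card_erase_of_mem b, card_of_mem_copies a]
  refine ex_card_le_of_switching (α := Sym2 V) h0 h1 good (unclosed S r)
    (fun E e ↦ transversals (closers S r E e) fun C : Finset (Sym2 V) ↦ C.erase e)
    (fun E e ↦ (nearClosers S (maxCut r E) E e).image fun x : Finset (Sym2 V) × Sym2 V ↦ x.2)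
    (w := 1 / ((#S - 1 : ℕ) : ℝ))
    (by positivity) hY₀ ?_ ?_
  · intro E e he R hR
    obtain ⟨he1, g1, g4, g5, g3⟩ := hgood E e he
    obtain ⟨hsat, hB⟩ := hB E ⟨e, he⟩
    have hRcard := card_of_mem_transversals g4 hR
    simp only [transversals, mem_filter, mem_powerset] at hR
    obtain ⟨hR1, hR2⟩ := hR
    have heE := (mem_inter.1 he1).1
    have hRcut : R ⊆ E ∩ cross (maxCut r E) := fun f hf ↦ by
      obtain ⟨C, hC, hfC⟩ := mem_biUnion.1 (hR1 hf)
      exact (mem_closers.1 hC).2.2 hfC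
    have hload : ∑ f ∈ R, copyDeg S E f ≤ ∑ C ∈ closers S r E e, ∑ f ∈ C.erase e,
        copyDeg S E f := by
      rw [← sum_biUnion g4]
      exact sum_le_sum_of_subset hR1
    have hRle : #R ≤ ∑ f ∈ R, copyDeg S E f := by
      rw [card_eq_sum_ones]
      refine sum_le_sum fun f hf ↦ ?_
      obtain ⟨C, hC, hfC⟩ := mem_biUnion.1 (hR1 hf)
      exact one_le_copyDeg (closers_subset heE hC) (mem_erase.1 hfC).2
    have hSR : #S * ∑ f ∈ R, copyDeg S E f ≤ #S * ∑ C ∈ closers S r E e, ∑ f ∈ C.erase e,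
        copyDeg S E f := Nat.mul_le_mul_left _ hload
    have hRK : #R ≤ K := by
      have h5 : #R ≤ #S * ∑ f ∈ R, copyDeg S E f := by nlinarith
      have : ((#R : ℕ) : ℝ) ≤ K := (Nat.cast_le.2 (h5.trans hSR)).trans (g5.trans hK)
      exact_mod_cast this
    have hcut : maxCut r (E \ R) = maxCut r E := by
      refine hB R hRcut hRK fun f hf ↦ ?_
      obtain ⟨C, hC, hfC⟩ := mem_biUnion.1 (hR1 hf)
      exact g1 C hC f hfC
    have hmono : nearClosers S (maxCut r (E \ R)) (E \ R) e ⊆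
        nearClosers S (maxCut r E) E e := by
      intro x hx
      rw [hcut] at hx
      simp only [nearClosers, mem_filter] at hx ⊢
      exact ⟨hx.1, hx.2.1, hx.2.2.1, hx.2.2.2.1, hx.2.2.2.2.1,
        hx.2.2.2.2.2.trans sdiff_subset⟩
    refine ⟨hRcut.trans inter_subset_left, ?_, ?_, ?_, ?_⟩
    · -- The edge `e` closes nothing after the deletion: a copy that it still closes would avoid
      -- `R`.
      rw [unclosed, mem_filter, inner_sdiff hRcut hcut]
      refine ⟨he1, eq_empty_of_forall_notMem fun C hC ↦ ?_⟩
      rw [mem_closers, hcut] at hC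
      have hC' : C ∈ closers S r E e :=
        mem_closers.2 ⟨hC.1, hC.2.1, hC.2.2.trans (inter_subset_inter_right sdiff_subset)⟩
      have := hR2 C hC'
      obtain ⟨f, hf⟩ := card_pos.1 (this ▸ one_pos)
      rw [mem_inter] at hf
      exact (Finset.mem_sdiff.1 (mem_inter.1 (hC.2.2 hf.2)).1).2 hf.1
    · -- Each edge of `R` completes a near-copy of `E \ R`, as `R` has only one edge in each copy
      -- closed by `e`.
      intro f hf
      obtain ⟨C, hC, hfC⟩ := mem_biUnion.1 (hR1 hf)
      obtain ⟨hC1, hC2, hC3⟩ := mem_closers.1 hC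
      refine mem_image.2 ⟨(C, f), ?_, rfl⟩
      have hfe := mem_erase.1 hfC
      simp only [nearClosers, mem_filter, mem_product, mem_univ, and_true, hcut]
      refine ⟨hC1, hC2, hfe.2, hfe.1, fun x hx ↦ (mem_inter.1 (hC3 hx)).2, fun x hx ↦ ?_⟩
      have hxe := mem_erase.1 hx
      refine Finset.mem_sdiff.2 ⟨(mem_copiesIn.1 (closers_subset heE hC)).2 hxe.2, fun hxR ↦ ?_⟩
      by_cases hx1 : x = e
      · exact notMem_cross_of_mem_inner he1 (hx1 ▸ (mem_inter.1 (hRcut hxR)).2)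
      · have := card_le_one.1 (hR2 C hC).le x (mem_inter.2 ⟨hxR, mem_erase.2 ⟨hx1, hxe.2⟩⟩) f
          (mem_inter.2 ⟨hf, hfC⟩)
        exact hxe.1 this
    · -- Few edges stop closing a copy.
      have := (card_unclosed_sdiff_le hsat hRcut hcut).trans hSR
      exact (Nat.cast_le.2 this).trans g5
    · -- There are few near-copies before the deletion, and hence also after it.
      refine le_trans ?_ g3
      have : #((nearClosers S (maxCut r (E \ R)) (E \ R) e).image Prod.snd) ≤
          #(nearClosers S (maxCut r E) E e) := card_image_le.trans (card_le_card hmono)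
      have hp : 0 ≤ p / (1 - p) := div_nonneg h0 (by linarith)
      gcongr
  · intro E e he
    exact one_le_sum_transversals (hgood E e he).2.2.1 (by omega) (hcard E e)

end Closers

section Moments

variable {U V : Type*} [Fintype U] [DecidableEq U] [Fintype V] [DecidableEq V] {p : ℝ}
  {r : ℕ} [NeZero r] {S : Finset (Sym2 U)}

/-! ### Moments of copy counts -/

/-- First moment bound for pairs of copies, in terms of labelled copies. -/
lemma ex_card_pairs_le (h0 : 0 ≤ p) (W : Finset (Sym2 V) → Finset (Sym2 V) → Prop)
    [∀ C C', Decidable (W C C')] :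
    ex p (fun E ↦ (#{x ∈ copiesIn S E ×ˢ copiesIn S E | W x.1 x.2} : ℝ)) ≤
      ∑ f : U ↪ V, ∑ f' : U ↪ V with W (img S f) (img S f'), p ^ #(img S f ∪ img S f') := by
  have e1 : ∀ E, (#{x ∈ copiesIn S E ×ˢ copiesIn S E | W x.1 x.2} : ℝ) =
      ∑ C ∈ copies V S, ∑ C' ∈ copies V S with W C C', if C ∪ C' ⊆ E then (1 : ℝ) else 0 := by
    intro E
    rw [card_filter, sum_product, copiesIn]
    push_cast
    rw [sum_filter]
    refine sum_congr rfl fun C _ ↦ ?_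
    rw [sum_filter, sum_filter]
    split_ifs with h
    · refine sum_congr rfl fun C' _ ↦ ?_
      by_cases h1 : C' ⊆ E <;> simp [h, h1, union_subset_iff]
    · symm
      refine sum_eq_zero fun C' _ ↦ ?_
      simp [h, union_subset_iff]
  simp_rw [e1]
  rw [ex_sum]
  calc _ = ∑ C ∈ copies V S, ∑ C' ∈ copies V S with W C C', p ^ #(C ∪ C') := by
        refine sum_congr rfl fun C _ ↦ ?_
        rw [ex_sum]
        exact sum_congr rfl fun C' _ ↦ ex_ite_subset p _
    _ ≤ ∑ f : U ↪ V, ∑ C' ∈ copies V S with W (img S f) C', p ^ #(img S f ∪ C') :=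
        sum_copies_le (g := fun C ↦ ∑ C' ∈ copies V S with W C C', p ^ #(C ∪ C'))
          fun _ ↦ sum_nonneg fun _ _ ↦ pow_nonneg h0 _
    _ ≤ _ := by
        refine sum_le_sum fun f _ ↦ ?_
        rw [sum_filter, sum_filter]
        exact sum_copies_le (g := fun C' ↦ if W (img S f) C' then p ^ #(img S f ∪ C') else 0)
          fun C' ↦ by split_ifs <;> positivity

lemma disjoint_img_iff {A B : Finset (Sym2 U)} {f f' : U ↪ V} :
    Disjoint (img A f) (img B f') ↔ ¬ (common A B f f').Nonempty := by
  rw [Finset.disjoint_iff_inter_eq_empty, ← img_common, not_nonempty_iff_eq_empty, img, map_eq_empty]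

/-- The expected number of pairs of copies that meet; `Φ` is a lower bound, up to constants, for
the expected number of copies of each nonempty subgraph. -/
lemma ex_card_meeting_le (h0 : 0 < p) {Φ n : ℝ} (hn : Fintype.card V = n) (hn0 : 0 < n)
    (hΦ0 : 0 < Φ) (hΦ : ∀ J ⊆ S, J.Nonempty → Φ ≤ n ^ #(verts J) * p ^ #J) :
    ex p (fun E : Finset (Sym2 V) ↦
        (#{x ∈ copiesIn S E ×ˢ copiesIn S E | ¬ Disjoint x.1 x.2} : ℝ)) ≤
      (Fintype.card U : ℝ) ^ Fintype.card U * 2 ^ #S *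
        (n ^ Fintype.card U * p ^ #S) * (n ^ Fintype.card U * p ^ #S) / Φ := by
  refine (ex_card_pairs_le h0.le fun C C' : Finset (Sym2 V) ↦ ¬ Disjoint C C').trans ?_
  refine le_trans (le_of_eq ?_) (sum_common_le h0 S S (fun J ↦ J.Nonempty) hn hn0 hΦ0 hΦ)
  refine sum_congr rfl fun f _ ↦ sum_congr (filter_congr fun f' _ ↦ ?_) fun _ _ ↦ rfl
  rw [disjoint_img_iff, not_not]

/-- In a cluster the common part is a proper subgraph with at least two edges, so `Φ` only has to
bound the expected number of copies of such subgraphs. -/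
lemma ex_card_clusters_le (h0 : 0 < p) {Φ n : ℝ} (hn : Fintype.card V = n)
    (hn0 : 0 < n) (hΦ0 : 0 < Φ)
    (hΦ : ∀ J ⊆ S, 2 ≤ #J → #J < #S → Φ ≤ n ^ #(verts J) * p ^ #J) :
    ex p (fun E : Finset (Sym2 V) ↦ (#(clusters S E) : ℝ)) ≤
      (Fintype.card U : ℝ) ^ Fintype.card U * 2 ^ #S *
        (n ^ Fintype.card U * p ^ #S) * (n ^ Fintype.card U * p ^ #S) / Φ := by
  refine (ex_card_pairs_le h0.le fun C C' : Finset (Sym2 V) ↦ C ≠ C' ∧ 2 ≤ #(C ∩ C')).trans ?_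
  refine le_trans (sum_le_sum fun f _ ↦ ?_)
    (sum_common_le h0 S S (fun J ↦ 2 ≤ #J ∧ #J < #S) hn hn0 hΦ0 fun J hJ h ↦ hΦ J hJ h.1 h.2)
  refine sum_le_sum_of_subset_of_nonneg (fun f' hf' ↦ ?_) fun _ _ _ ↦ pow_nonneg h0.le _
  simp only [mem_filter, mem_univ, true_and] at hf' ⊢
  rw [← card_img (common S S f f') f', img_common]
  refine ⟨hf'.2, ?_⟩
  by_contra! hle
  rw [← card_img S f] at hle
  have h1 := eq_of_subset_of_card_le inter_subset_left hle
  refine hf'.1 (eq_of_subset_of_card_le (inter_eq_left.1 h1) ?_)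
  rw [card_img, card_img]

/-- The pairs of a copy and one of its edges. -/
noncomputable def flags (V : Type*) [Fintype V] [DecidableEq V] (S : Finset (Sym2 U)) :
    Finset (Finset (Sym2 V) × Sym2 V) := {x ∈ copies V S ×ˢ univ | x.2 ∈ x.1}

lemma nearIndex_subset (φ : V → Fin r) : nearIndex S φ ⊆ flags V S := fun x hx ↦ by
  simp only [nearIndex, flags, mem_filter] at hx ⊢
  exact ⟨hx.1, hx.2.1⟩

lemma sum_flags_le {g : Finset (Sym2 V) × Sym2 V → ℝ} (hg : ∀ x, 0 ≤ g x) :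
    ∑ x ∈ flags V S, g x ≤ ∑ s ∈ S, ∑ f : U ↪ V, g (img S f, f.sym2Map s) := by
  rw [flags, sum_filter, sum_product, sum_comm (s := S)]
  calc _ = ∑ C ∈ copies V S, ∑ e ∈ C, g (C, e) := by
        refine sum_congr rfl fun C _ ↦ ?_
        rw [← sum_filter]
        simp
    _ ≤ ∑ f : U ↪ V, ∑ e ∈ img S f, g (img S f, e) :=
        sum_copies_le (g := fun C ↦ ∑ e ∈ C, g (C, e)) fun _ ↦ sum_nonneg fun _ _ ↦ hg _
    _ = _ := by
        refine sum_congr rfl fun f _ ↦ ?_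
        rw [img, sum_map]

lemma img_erase (f : U ↪ V) (s : Sym2 U) : (img S f).erase (f.sym2Map s) = img (S.erase s) f := by
  rw [img, img, map_erase]

/-- The overlap of the family of copies with one edge removed. Common parts are proper subgraphs,
since an edge is missing. -/
lemma overlap_flags_le (h0 : 0 < p) {Φ n : ℝ} (hn : Fintype.card V = n) (hn0 : 0 < n)
    (hΦ0 : 0 < Φ) (hΦ : ∀ J ⊆ S, J.Nonempty → #J < #S → Φ ≤ n ^ #(verts J) * p ^ #J) :
    overlap (flags V S) (fun x ↦ x.1.erase x.2) p ≤
      #S * (#S * ((Fintype.card U : ℝ) ^ Fintype.card U * 2 ^ #S *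
        (n ^ Fintype.card U * p ^ (#S - 1)) * (n ^ Fintype.card U * p ^ (#S - 1)) / Φ)) := by
  calc _ ≤ ∑ s ∈ S, ∑ f : U ↪ V, ∑ s' ∈ S, ∑ f' : U ↪ V,
        if (common (S.erase s) (S.erase s') f f').Nonempty then
          p ^ #(img (S.erase s) f ∪ img (S.erase s') f') else 0 := by
        refine (sum_flags_le fun x ↦ sum_nonneg fun _ _ ↦ pow_nonneg h0.le _).trans ?_
        refine sum_le_sum fun s _ ↦ sum_le_sum fun f _ ↦ ?_
        rw [sum_filter]
        refine (sum_flags_le fun x ↦ by split_ifs <;> positivity).trans (le_of_eq ?_)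
        refine sum_congr rfl fun s' _ ↦ sum_congr rfl fun f' _ ↦ ?_
        simp only [img_erase, disjoint_img_iff, not_not]
    _ = ∑ s ∈ S, ∑ s' ∈ S, ∑ f : U ↪ V, ∑ f' : U ↪ V
        with (common (S.erase s) (S.erase s') f f').Nonempty,
          p ^ #(img (S.erase s) f ∪ img (S.erase s') f') := by
        refine sum_congr rfl fun s _ ↦ ?_
        rw [sum_comm]
        simp only [sum_filter]
    _ ≤ ∑ s ∈ S, ∑ s' ∈ S, ((Fintype.card U : ℝ) ^ Fintype.card U * 2 ^ #S *
        (n ^ Fintype.card U * p ^ (#S - 1)) * (n ^ Fintype.card U * p ^ (#S - 1)) / Φ) := by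
        refine sum_le_sum fun s hs ↦ sum_le_sum fun s' hs' ↦ ?_
        have hlt : ∀ J ⊆ S.erase s', #J < #S := fun J hJ ↦
          (card_le_card hJ).trans_lt (card_erase_lt_of_mem hs')
        have := sum_common_le h0 (S.erase s) (S.erase s') (fun J ↦ J.Nonempty) hn hn0 hΦ0
          fun J hJ hne ↦ hΦ J (hJ.trans (erase_subset _ _)) hne (hlt J hJ)
        rw [card_erase_of_mem hs, card_erase_of_mem hs'] at this
        refine this.trans ?_
        gcongr
        · norm_num
        · omega
    _ = _ := by simp only [sum_const, nsmul_eq_mul]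

/-- If each pair inside a part of `φ` closes at most `N` potential copies, then the expected number
of near-copies is at most `p ^ (#S - 1)` for each choice of such a pair, a potential copy and its
second missing edge. -/
lemma mean_nearIndex_le (h0 : 0 ≤ p) (φ : V → Fin r) {N : ℝ}
    (hN : ∀ e ∈ inside φ, (#{C ∈ copies V S | e ∈ C ∧ C.erase e ⊆ cross φ} : ℝ) ≤ N) :
    mean (nearIndex S φ) (fun x ↦ x.1.erase x.2) p ≤
      ((#S - 1 : ℕ) : ℝ) * p ^ (#S - 1) * (#(inside φ) * N) := by
  set 𝒞 : Sym2 V → Finset (Finset (Sym2 V)) := fun e ↦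
    {C ∈ copies V S | e ∈ C ∧ C.erase e ⊆ cross φ} with h𝒞
  have hcard : #(nearIndex S φ) ≤ ∑ e ∈ inside φ, #(𝒞 e) * (#S - 1) := by
    calc _ ≤ #((inside φ).biUnion fun e ↦ (𝒞 e).biUnion fun C ↦ (C.erase e).image fun f ↦ (C, f)) := by
          refine card_le_card fun x hx ↦ ?_
          simp only [nearIndex, mem_filter, mem_product, mem_univ, and_true] at hx
          obtain ⟨h1, h2, e, h3, h4, h5, h6⟩ := hx
          exact mem_biUnion.2 ⟨e, h4, mem_biUnion.2 ⟨x.1, mem_filter.2 ⟨h1, h3, h6⟩,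
            mem_image.2 ⟨x.2, mem_erase.2 ⟨h5, h2⟩, rfl⟩⟩⟩
      _ ≤ _ := by
          refine card_biUnion_le.trans (sum_le_sum fun e _ ↦ ?_)
          refine card_biUnion_le_card_mul _ _ _ fun C hC ↦ card_image_le.trans ?_
          obtain ⟨a, b, -⟩ := mem_filter.1 hC
          rw [card_erase_of_mem b, card_of_mem_copies a]
  have hmean : mean (nearIndex S φ) (fun x ↦ x.1.erase x.2) p =
      #(nearIndex S φ) * p ^ (#S - 1) := by
    rw [mean, ← nsmul_eq_mul, ← sum_const]
    refine sum_congr rfl fun x hx ↦ ?_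
    simp only [nearIndex, mem_filter, mem_product] at hx
    rw [card_erase_of_mem hx.2.1, card_of_mem_copies hx.1.1]
  have h2 : (#(nearIndex S φ) : ℝ) ≤ ((#S - 1 : ℕ) : ℝ) * (#(inside φ) * N) := by
    calc _ ≤ ((∑ e ∈ inside φ, #(𝒞 e) * (#S - 1) : ℕ) : ℝ) := by exact_mod_cast hcard
      _ = (∑ e ∈ inside φ, (#(𝒞 e) : ℝ)) * ((#S - 1 : ℕ) : ℝ) := by
          rw [sum_mul, Nat.cast_sum]; exact sum_congr rfl fun e _ ↦ by push_cast; ring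
      _ ≤ (#(inside φ) * N) * ((#S - 1 : ℕ) : ℝ) := by
          refine mul_le_mul_of_nonneg_right ?_ (Nat.cast_nonneg _)
          rw [← nsmul_eq_mul]
          exact sum_le_card_nsmul _ _ _ hN
      _ = _ := by ring
  rw [hmean]
  calc _ ≤ ((#S - 1 : ℕ) : ℝ) * (#(inside φ) * N) * p ^ (#S - 1) := by gcongr
    _ = _ := by ring

/-! ### Many edges inside the parts are good -/

open scoped Classical in
/-- The edges inside the parts of the maximum cut at which the switching is possible. -/
noncomputable def goodEdges (S : Finset (Sym2 U)) (r : ℕ) [NeZero r] (B : Finset V)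
    (Y₀ q Λ : ℝ) (E : Finset (Sym2 V)) : Finset (Sym2 V) :=
  {e ∈ inner r E | (∀ C ∈ closers S r E e, ∀ f ∈ C.erase e, ∀ x ∈ f, x ∉ B) ∧
    (closers S r E e : Set (Finset (Sym2 V))).PairwiseDisjoint (fun C ↦ C.erase e) ∧
    ((#S * ∑ C ∈ closers S r E e, ∑ f ∈ C.erase e, copyDeg S E f : ℕ) : ℝ) ≤ Y₀ ∧
    q * #(nearClosers S (maxCut r E) E e) ≤ Λ}

lemma card_filter_mul_le {ι : Type*} (I : Finset ι) (f : ι → ℝ) (hf : ∀ i ∈ I, 0 ≤ f i) (c : ℝ)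
    [DecidablePred fun i ↦ c ≤ f i] : #{i ∈ I | c ≤ f i} * c ≤ ∑ i ∈ I, f i := by
  rw [← nsmul_eq_mul]
  exact (card_nsmul_le_sum _ _ _ fun i hi ↦ (mem_filter.1 hi).2).trans
    (sum_le_sum_of_subset_of_nonneg (filter_subset _ _) fun i hi _ ↦ hf i hi)

/-- Many edges inside the parts are good. The bad ones close a copy touching `B`, close two copies
that share another edge, close copies whose destruction affects too many other copies, or have too
many near-copies. The edges of the last kind are at most a proportion `1 - κ` of all, by Markov's
inequality. -/
lemma card_inner_le (B : Finset V) {Y₀ q Λ κ Z : ℝ} (hY₀ : 0 < Y₀) (hΛ : 0 < Λ) (hq : 0 ≤ q)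
    {E : Finset (Sym2 V)}
    (hnear : q * cnt (nearIndex S (maxCut r E)) (fun x ↦ x.1.erase x.2) E ≤
      (1 - κ) * Λ * #(inner r E)) (hZ : (∑ f ∈ E, (copyDeg S E f : ℝ) ^ 2) ≤ Z) :
    κ * #(inner r E) ≤ #(goodEdges S r B Y₀ q Λ E) +
      √(#(E ∩ ({f | ∃ x ∈ f, x ∈ B} : Finset (Sym2 V))) * Z) + #(clusters S E) + #S * Z / Y₀ := by
  classical
  set X : Finset (Sym2 V) := {f | ∃ x ∈ f, x ∈ B} with hX
  set N := inner r E
  set b1 : Finset (Sym2 V) := {e ∈ N | ∃ C ∈ closers S r E e, ∃ f ∈ C.erase e, f ∈ X}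
  set b2 : Finset (Sym2 V) := {e ∈ N | ¬ (closers S r E e : Set (Finset (Sym2 V))).PairwiseDisjoint
      (fun C ↦ C.erase e)}
  set b3 : Finset (Sym2 V) := {e ∈ N | Y₀ ≤
    (((#S * ∑ C ∈ closers S r E e, ∑ f ∈ C.erase e, copyDeg S E f : ℕ) : ℝ))}
  set b4 : Finset (Sym2 V) := {e ∈ N | Λ ≤ q * #(nearClosers S (maxCut r E) E e)}
  have hcov : N ⊆ goodEdges S r B Y₀ q Λ E ∪ b1 ∪ b2 ∪ b3 ∪ b4 := by
    intro e he
    by_contra hcon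
    simp only [goodEdges, b1, b2, b3, b4, mem_union, mem_filter, not_or, not_and, he,
      not_exists, hX, mem_univ, true_and, not_le, not_not] at hcon
    obtain ⟨⟨⟨⟨h1, h2⟩, h3⟩, h4⟩, h5⟩ := hcon
    exact lt_asymm (h1 he h2 h3 h4.le) h5
  have hc : (#N : ℝ) ≤ #(goodEdges S r B Y₀ q Λ E) + #b1 + #b2 + #b3 + #b4 := by
    have := (card_le_card hcov).trans ((card_union_le _ _).trans
      (Nat.add_le_add_right ((card_union_le _ _).trans (Nat.add_le_add_right
        ((card_union_le _ _).trans (Nat.add_le_add_right (card_union_le _ _) _)) _)) _))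
    exact_mod_cast this
  -- By the Cauchy-Schwarz inequality, few copies contain an edge of `X`.
  have h1 : (#b1 : ℝ) ≤ √(#(E ∩ X) * Z) := by
    have : (#b1 : ℝ) ≤ ∑ f ∈ E ∩ X, (copyDeg S E f : ℝ) := by
      rw [← Nat.cast_sum, Nat.cast_le]
      refine le_trans (card_le_card ?_) (card_touching_le (r := r) X)
      intro e he
      rw [mem_filter] at he ⊢
      exact he
    refine this.trans (Real.le_sqrt_of_sq_le (sq_sum_le_card_mul_sum_sq.trans ?_))
    gcongr
    exact (sum_le_sum_of_subset_of_nonneg inter_subset_left fun _ _ _ ↦ sq_nonneg _).trans hZ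
  have h2 : (#b2 : ℝ) ≤ #(clusters S E) := by
    rw [Nat.cast_le]
    refine le_trans (card_le_card ?_) (card_clustered_le (r := r))
    intro e he
    rw [mem_filter] at he ⊢
    exact he
  -- Markov's inequality over the edges inside the parts.
  have h3 : (#b3 : ℝ) ≤ #S * Z / Y₀ := by
    rw [le_div_iff₀ hY₀]
    refine (card_filter_mul_le N (fun e ↦ ((#S * ∑ C ∈ closers S r E e, ∑ f ∈ C.erase e,
      copyDeg S E f : ℕ) : ℝ)) (fun _ _ ↦ Nat.cast_nonneg _) Y₀).trans ?_
    have := sum_closers_copyDeg_le (S := S) (r := r) (E := E)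
    have h : ((∑ e ∈ N, ∑ C ∈ closers S r E e, ∑ f ∈ C.erase e, copyDeg S E f : ℕ) : ℝ) ≤ Z :=
      le_trans (by exact_mod_cast this) hZ
    push_cast at h ⊢
    rw [← mul_sum]
    gcongr
  -- Markov's inequality for the near-copies, of which an average edge has few.
  have h4 : (#b4 : ℝ) ≤ (1 - κ) * #N := by
    have h := card_filter_mul_le N (fun e ↦ q * #(nearClosers S (maxCut r E) E e))
      (fun _ _ ↦ by positivity) Λ
    rw [← mul_sum] at h
    have h' := (h.trans (mul_le_mul_of_nonneg_left sum_card_nearClosers_le hq)).trans hnear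
    refine le_of_mul_le_mul_right (h'.trans_eq ?_) hΛ
    ring
  linarith

end Moments

section Typical

variable {V : Type*} [Fintype V] [DecidableEq V] {p η n w : ℝ} {r : ℕ} [NeZero r]
  {E : Finset (Sym2 V)}

/-! ### Typical properties of the maximum cut -/

/-- Every pair of different vertices either crosses `φ` or lies inside a class. -/
lemma dsum_id_eq (φ : V → Fin r) (E : Finset (Sym2 V)) :
    dsum E id univ univ = dsum E φ univ univ + 2 * #(E ∩ inside φ) := by
  rw [dsum_univ_eq, dsum_univ_eq, ← mul_add, ← card_union_of_disjoint]
  · congr 2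
    rw [← inter_union_distrib_left]
    congr 1
    ext e
    induction e with | _ x y
    simp only [mk_mem_cross, mem_union, mk_mem_inside, id]
    by_cases h : φ x = φ y
    · simp [h]
    · have : x ≠ y := fun h' ↦ h (h' ▸ rfl)
      simp [h, this]
  · exact (disjoint_cross_inside φ).mono inter_subset_right inter_subset_right

/-- By convexity, a partition into `r` classes has at least about `n ^ 2 / (2 * r)` pairs inside
its classes. -/
lemma card_inside_ge (φ : V → Fin r) (hn : Fintype.card V = n) (hr : 2 * r ≤ n) :
    n ^ 2 / (4 * r) ≤ #(inside φ) := by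
  have hr0 : (0 : ℝ) < r := by exact_mod_cast Nat.pos_of_ne_zero (NeZero.ne r)
  have h1 := dsum_id_eq φ univ
  have h2 := dsum_univ_univ φ
  have h3 : (dsum univ (id : V → V) univ univ : ℝ) = n ^ 2 - n := by
    have : ∀ x : V, #(nbr univ id univ x) = Fintype.card V - 1 := fun x ↦ by
      have : nbr univ id univ x = univ.erase x := by
        ext y; simp [nbr, eq_comm]
      rw [this, card_erase_of_mem (mem_univ _), card_univ]
    rw [dsum, sum_congr rfl fun x _ ↦ this x, sum_const, card_univ, smul_eq_mul, ← hn]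
    rcases Nat.eq_zero_or_pos (Fintype.card V) with h | h
    · simp [h]
    · rw [Nat.cast_mul, Nat.cast_sub h]; push_cast; ring
  have h4 : (Fintype.card V : ℝ) ^ 2 ≤ r * ∑ i, (#(cls φ i) : ℝ) ^ 2 := by
    rw [← sum_card_cls φ]
    refine sq_sum_le_card_mul_sum_sq.trans_eq ?_
    simp
  rw [univ_inter] at h1
  have h5 : (dsum univ (id : V → V) univ univ : ℝ) =
    dsum univ φ univ univ + 2 * #(inside φ) := by exact_mod_cast h1
  rw [hn] at h2 h4
  rw [div_le_iff₀ (by positivity)]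
  nlinarith

/-- A uniform graph has about as many edges inside the parts of its maximum cut as expected. -/
lemma IsUniform.card_inner_ge (hE : IsUniform r p η E) :
    p * #(inside (maxCut r E)) - η ≤ #(inner r E) := by
  set φ := maxCut r E
  have h1 := dsum_id_eq φ E
  have h2 := dsum_id_eq φ univ
  rw [univ_inter] at h2
  have h1' : (dsum E (id : V → V) univ univ : ℝ) =
    dsum E φ univ univ + 2 * #(inner r E) := by exact_mod_cast h1
  have h2' : (dsum univ (id : V → V) univ univ : ℝ) =
    dsum univ φ univ univ + 2 * #(inside φ) := by exact_mod_cast h2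
  have h3 := _root_.abs_le.1 (hE.2 univ univ)
  have h4 := _root_.abs_le.1 (hE.abs_le φ univ univ)
  rw [h1', h2'] at h3
  linarith [h3.1, h4.2]

/-- In a uniform graph, few edges (loops included) touch a small set of vertices. -/
lemma IsUniform.card_touching_le (hE : IsUniform r p η E) (h0 : 0 ≤ p)
    (hn : Fintype.card V = n) (hpn : 1 ≤ p * n) (B : Finset V) :
    (#(E ∩ ({f | ∃ x ∈ f, x ∈ B} : Finset (Sym2 V))) : ℝ) ≤ 2 * (p * n * #B) + η := by
  have h1 : E ∩ ({f | ∃ x ∈ f, x ∈ B} : Finset (Sym2 V)) ⊆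
      (B.biUnion fun x ↦ star x (nbr E id univ x)) ∪ B.image fun x ↦ s(x, x) := by
    intro f hf
    simp only [mem_inter, mem_filter, mem_univ, true_and] at hf
    obtain ⟨hfE, x, hx, hxB⟩ := hf
    obtain ⟨y, rfl⟩ := Sym2.mem_iff_exists.1 hx
    by_cases hxy : x = y
    · subst hxy
      exact mem_union_right _ (mem_image_of_mem _ hxB)
    · refine mem_union_left _ (mem_biUnion.2 ⟨x, hxB, mem_image.2 ⟨y, ?_, rfl⟩⟩)
      simp [nbr, hfE, hxy]
  have h2 : #(E ∩ ({f | ∃ x ∈ f, x ∈ B} : Finset (Sym2 V))) ≤ dsum E id B univ + #B := by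
    refine (card_le_card h1).trans ((card_union_le _ _).trans (add_le_add ?_ card_image_le))
    refine card_biUnion_le.trans (sum_le_sum fun x _ ↦ (card_star _ _).le)
  have h3 := (_root_.abs_le.1 (hE.2 B univ)).2
  have h4 : (dsum univ (id : V → V) B univ : ℝ) ≤ #B * n := by
    rw [dsum, ← hn]
    push_cast
    rw [← nsmul_eq_mul]
    refine sum_le_card_nsmul _ _ _ fun x _ ↦ ?_
    exact_mod_cast card_le_univ _
  have h5 : (#(E ∩ ({f | ∃ x ∈ f, x ∈ B} : Finset (Sym2 V))) : ℝ) ≤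
    dsum E id B univ + #B := by exact_mod_cast h2
  have h6 : (#B : ℝ) ≤ p * n * #B := by nlinarith [Nat.cast_nonneg (α := ℝ) #B]
  have h7 := mul_le_mul_of_nonneg_left h4 h0
  nlinarith

/-- The parameter `w` is a small number, such as a small negative power of `n` or of `p * n`, and
controls all error terms. The exponents `80` and `39` here, and the smaller ones below, leave room
for the losses in the later steps, which are each a few powers of `w`. -/
lemma pr_not_isUniform_le (h0 : 0 < p) (h1 : p ≤ 1) (hn : Fintype.card V = n) (hn0 : 1 ≤ n)
    (hw0 : 0 < w) (hw1 : w ≤ 1) (hw : 4 * (Real.log (4 * r ^ 2) + 1) * w ^ 2 ≤ 1)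
    (hp : 1 ≤ p * n * w ^ 80) :
    pr p {E : Finset (Sym2 V) | ¬ IsUniform r p (2 * (p * n ^ 2 * w ^ 39)) E} ≤
      8 * Real.exp (-n) := by
  have hr0 : (0 : ℝ) < r := by exact_mod_cast Nat.pos_of_ne_zero (NeZero.ne r)
  have hT : (Fintype.card (Sym2 V) : ℝ) ≤ n ^ 2 := by
    rw [Sym2.card, Nat.choose_two_right, ← hn]
    have : (Fintype.card V + 1) * (Fintype.card V + 1 - 1) / 2 ≤ Fintype.card V ^ 2 := by
      apply Nat.div_le_of_le_mul
      have : 1 ≤ Fintype.card V := by rw [← hn] at hn0; exact_mod_cast hn0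
      simp only [Nat.add_sub_cancel]; nlinarith
    exact_mod_cast this
  have h := pr_not_isUniform (r := r) (V := V) h0 h1 hT (by positivity)
    (l := p * n ^ 2 * w ^ 39) (by positivity) (by
      have : w ^ 39 ≤ 1 := pow_le_one₀ hw0.le hw1
      nlinarith [mul_pos h0 (pow_pos (zero_lt_one.trans_le hn0) 2)])
  refine h.trans ?_
  have hexp : n * (Real.log (4 * r ^ 2) + 1) ≤
      (p * n ^ 2 * w ^ 39) ^ 2 / (4 * p * n ^ 2) := by
    rw [le_div_iff₀ (by positivity)]
    have e : (p * n ^ 2 * w ^ 39) ^ 2 * w ^ 2 = p * n ^ 2 * n * (p * n * w ^ 80) := by ring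
    have : n * (Real.log (4 * r ^ 2) + 1) * (4 * p * n ^ 2) * w ^ 2 ≤
        (p * n ^ 2 * w ^ 39) ^ 2 * w ^ 2 := by
      rw [e]
      calc _ = p * n ^ 2 * n * (4 * (Real.log (4 * r ^ 2) + 1) * w ^ 2) := by ring
        _ ≤ p * n ^ 2 * n * (p * n * w ^ 80) := by
            have : 0 ≤ n := by linarith
            exact mul_le_mul_of_nonneg_left (hw.trans hp) (by positivity)
    exact le_of_mul_le_mul_right this (by positivity)
  have hpow : ((r : ℝ) ^ 2 * 4) ^ Fintype.card V = Real.exp (n * Real.log (4 * r ^ 2)) := by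
    rw [← hn, Real.exp_nat_mul, Real.exp_log (by positivity), mul_comm]
  rw [hpow]
  calc _ = 8 * Real.exp (n * Real.log (4 * r ^ 2) +
        -((p * n ^ 2 * w ^ 39) ^ 2 / (4 * p * n ^ 2))) := by rw [Real.exp_add]; ring
    _ ≤ _ := by gcongr; linarith

lemma IsUniform.abs_card_cls_sub_le' (hE : IsUniform r p (2 * (p * n ^ 2 * w ^ 39)) E)
    (h0 : 0 < p) (h1 : p ≤ 1) (hn : Fintype.card V = n) (hn0 : 1 ≤ n) (hw0 : 0 < w) (hw1 : w ≤ 1)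
    (hp : 1 ≤ p * n * w ^ 80) (i : Fin r) :
    |(#(cls (maxCut r E) i) : ℝ) - n / r| ≤ 3 * n * w ^ 19 := by
  rw [← hn]
  refine abs_card_cls_sub_le hE h0 (by positivity) ?_ i
  rw [hn]
  have h2 : n ≤ n ^ 2 * w ^ 39 := by
    have a : p * n * w ^ 80 ≤ n * w ^ 39 := by
      have : w ^ 80 ≤ w ^ 39 := pow_le_pow_of_le_one hw0.le hw1 (by norm_num)
      have : p * n * w ^ 80 ≤ 1 * n * w ^ 39 := by gcongr
      linarith
    nlinarith
  have h3 : w ^ 39 ≤ w ^ 38 := pow_le_pow_of_le_one hw0.le hw1 (by norm_num)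
  have h4 : n ^ 2 * w ^ 39 ≤ n ^ 2 * w ^ 38 := by gcongr
  have e : 2 * (2 * (p * n ^ 2 * w ^ 39)) / p = 4 * (n ^ 2 * w ^ 39) := by field_simp; ring
  rw [e]
  have e2 : (3 * n * w ^ 19) ^ 2 = 9 * (n ^ 2 * w ^ 38) := by ring
  rw [e2]
  have : 0 ≤ n ^ 2 * w ^ 38 := by positivity
  linarith

/-- Cut edges are deleted with probability `1 / (p * n * w ^ 16)`, so that about `w ^ (-16)` of
them disappear at a typical vertex. This is more than any switching deletes, but too few to affect
the maximum cut. -/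
lemma pr_fragile_le (hr : 2 ≤ r) (h0 : 0 < p) (h1 : p < 1) (hn : Fintype.card V = n) (hn0 : 1 ≤ n)
    (hw0 : 0 < w) (hw : 4 * (Real.log (4 * r ^ 2) + 1) * w ^ 2 ≤ 1) (hw12 : 12 * w ≤ 1)
    (hp : 1 ≤ p * n * w ^ 80) (hp' : p ≤ w ^ 32) :
    pr p {E : Finset (Sym2 V) | n * w ^ 6 ≤ #(fragile r (1 / (p * n * w ^ 16)) E : Finset V)} ≤
      46 * w := by
  have hw1 : w ≤ 1 := by linarith
  have hn00 : 0 < n := by linarith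
  set ρ := 1 / (p * n * w ^ 16) with hρ
  have hρ0 : 0 < ρ := by positivity
  have hρw : ρ ≤ w ^ 64 := by
    rw [hρ, div_le_iff₀ (by positivity)]
    calc 1 ≤ p * n * w ^ 80 := hp
      _ = _ := by ring
  have hww : w ^ 64 ≤ w := pow_le_of_le_one hw0.le hw1 (by norm_num)
  have hr2 : (2 : ℝ) ≤ r := by exact_mod_cast hr
  have hdeg : ∀ E : Finset (Sym2 V), IsUniform r p (2 * (p * n ^ 2 * w ^ 39)) E →
      ∀ x, n / 4 ≤ #(nbr univ (maxCut r E) univ x) := by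
    intro E hE x
    rw [card_nbr_univ, hn]
    have h3 := (abs_le.1 (hE.abs_card_cls_sub_le' h0 h1.le hn hn0 hw0 hw1 hp (maxCut r E x))).2
    have h4 : n / r ≤ n / 2 := by gcongr
    have h5 : w ^ 19 ≤ w := pow_le_of_le_one hw0.le hw1 (by norm_num)
    nlinarith
  have hex := ex_card_fragile_le (r := r) h0 h1 hρ0.le (by linarith) (pow_pos hw0 32)
    (pow_le_one₀ hw0.le hw1) (by positivity : 0 < n / 4) hdeg (by positivity)
  have hun := pr_not_isUniform_le (V := V) (r := r) h0 h1.le hn hn0 hw0 hw1 hw hp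
  have hexp : Real.exp (-n) ≤ w ^ 7 := by
    have a : n * w ^ 7 ≥ 1 := by
      calc 1 ≤ p * n * w ^ 80 := hp
        _ ≤ 1 * n * w ^ 7 := by
          have : w ^ 80 ≤ w ^ 7 := pow_le_pow_of_le_one hw0.le hw1 (by norm_num)
          gcongr
        _ = _ := by ring
    rw [Real.exp_neg, inv_le_comm₀ (Real.exp_pos _) (by positivity)]
    calc (w ^ 7)⁻¹ ≤ n := by rw [inv_le_iff_one_le_mul₀ (by positivity)]; exact a
      _ ≤ Real.exp n := by linarith [Real.add_one_le_exp n]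
  -- `ex_card_fragile_le` with `ζ = w ^ 32` and `t = n / 4`.
  have hmain : ex p (fun E : Finset (Sym2 V) ↦ (#(fragile r ρ E : Finset V) : ℝ)) ≤
      46 * n * w ^ 7 := by
    refine hex.trans ?_
    rw [hn]
    have t1 : ρ * (p * n) * (w ^ 32 + 4 * ρ + 2 * p) ≤ 7 * w ^ 7 := by
      have a : ρ * (p * n) = 1 / w ^ 16 := by rw [hρ]; field_simp
      have b : w ^ 32 + 4 * ρ + 2 * p ≤ 7 * w ^ 32 := by
        have : w ^ 64 ≤ w ^ 32 := pow_le_pow_of_le_one hw0.le hw1 (by norm_num)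
        linarith
      rw [a]
      calc _ ≤ 1 / w ^ 16 * (7 * w ^ 32) := by gcongr
        _ = 7 * w ^ 16 := by field_simp
        _ ≤ _ := by
          gcongr 7 * ?_
          exact pow_le_pow_of_le_one hw0.le hw1 (by norm_num)
    have t2 : 2 * (p * n ^ 2 * w ^ 39) / (w ^ 32 * p * (n / 4)) = 8 * n * w ^ 7 := by
      field_simp; ring
    have t3 : pr p {E : Finset (Sym2 V) | ¬ IsUniform r p (2 * (p * n ^ 2 * w ^ 39)) E} ≤
        8 * w ^ 7 := hun.trans (by gcongr)
    rw [t2]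
    have := mul_le_mul_of_nonneg_left t1 hn00.le
    have := mul_le_mul_of_nonneg_left t3 hn00.le
    nlinarith
  refine (pr_le_div h0.le h1.le (fun E ↦ Nat.cast_nonneg _) (by positivity)).trans ?_
  rw [div_le_iff₀ (by positivity)]
  exact hmain.trans_eq (by ring)

end Typical

section Saturation

variable {U V : Type*} [Fintype U] [DecidableEq U] [Fintype V] [DecidableEq V]
  {p n w κ τ Λ N A : ℝ} {r : ℕ} [NeZero r] {S : Finset (Sym2 U)}

/-! ### The probability of saturation -/

lemma exp_neg_le_pow (h1 : p ≤ 1) (hn0 : 0 < n) (hw0 : 0 < w) (hw1 : w ≤ 1)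
    (hp : 1 ≤ p * n * w ^ 80) : Real.exp (-n) ≤ w := by
  have a : 1 ≤ n * w := by
    have : w ^ 80 ≤ w := pow_le_of_le_one hw0.le hw1 (by norm_num)
    calc 1 ≤ p * n * w ^ 80 := hp
      _ ≤ 1 * n * w := by gcongr
      _ = _ := by ring
  rw [Real.exp_neg, inv_le_comm₀ (Real.exp_pos _) (by positivity)]
  calc w⁻¹ ≤ n := by rw [inv_le_iff_one_le_mul₀ (by positivity)]; exact a
    _ ≤ Real.exp n := by linarith [Real.add_one_le_exp n]

/-- The properties of the random graph that make the switching possible at many edges inside the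
parts of its maximum cut. The parameter `w` is small and controls the error terms, and `2 * τ` is
the deviation allowed in the counts of near-copies, relative to `n ^ v * p ^ (#S - 1)` with
`v = Fintype.card U`, simultaneously for all cuts. -/
structure IsTypical (S : Finset (Sym2 U)) (r : ℕ) [NeZero r] (p n w τ : ℝ)
    (E : Finset (Sym2 V)) : Prop where
  uniform : IsUniform r p (2 * (p * n ^ 2 * w ^ 39)) E
  fragile_lt : (#(fragile r (1 / (p * n * w ^ 16)) E : Finset V) : ℝ) < n * w ^ 6
  meeting_lt : (#{x ∈ copiesIn S E ×ˢ copiesIn S E | ¬ Disjoint x.1 x.2} : ℝ) < p * n ^ 2 / w ^ 4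
  clusters_lt : (#(clusters S E) : ℝ) < p * n ^ 2 * w
  near_lt : ∀ φ : V → Fin r, cnt (nearIndex S φ) (fun x ↦ x.1.erase x.2) E <
    mean (nearIndex S φ) (fun x ↦ x.1.erase x.2) p +
      2 * (τ * (n ^ Fintype.card U * p ^ (#S - 1)))

/-- The hypotheses `hJ`, `hJ1` and `hJ2` bound from below the expected number of copies of the
subgraphs of the graph with edge set `S`, compared with the expected number of edges; `hX` says
that copies do not outnumber edges by much. -/
lemma pr_not_isTypical_le (hr : 2 ≤ r) (h0 : 0 < p) (h1 : p < 1) (hn : Fintype.card V = n)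
    (hn0 : 1 ≤ n) (hw0 : 0 < w) (hw : 4 * (Real.log (4 * r ^ 2) + 1) * w ^ 2 ≤ 1)
    (hw12 : 12 * w ≤ 1) (hp : 1 ≤ p * n * w ^ 80) (hp' : p ≤ w ^ 32)
    (hA : A = (Fintype.card U : ℝ) ^ Fintype.card U * 2 ^ #S) (hS : 2 ≤ #S)
    (hJ : ∀ J ⊆ S, J.Nonempty → p * n ^ 2 * w ≤ n ^ #(verts J) * p ^ #J)
    (hJ1 : ∀ J ⊆ S, J.Nonempty → #J < #S → p * n ^ 2 ≤ n ^ #(verts J) * p ^ #J)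
    (hJ2 : ∀ J ⊆ S, 2 ≤ #J → #J < #S → p * n ^ 2 / w ^ 4 ≤ n ^ #(verts J) * p ^ #J)
    (hX : n ^ Fintype.card U * p ^ #S * w ≤ p * n ^ 2) (hτ0 : 0 < τ)
    (hτ : 2 * (#S ^ 2 * A) * (Real.log r + 1) * w ≤ τ ^ 2) :
    pr p {E : Finset (Sym2 V) | ¬ IsTypical S r p n w τ E} ≤
      (55 + 2 * A + #S ^ 2 * A / τ ^ 2) * w := by
  classical
  have hw1 : w ≤ 1 := by linarith
  have hn00 : 0 < n := by linarith
  have hr0 : (0 : ℝ) < r := by exact_mod_cast (by omega : 0 < r)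
  have hA0 : 0 < A := by
    rw [hA]
    rcases Nat.eq_zero_or_pos (Fintype.card U) with h | h
    · simp [h]
    · positivity
  set u := Fintype.card U
  set h := #S with hh
  have hh0 : (0 : ℝ) < h := by exact_mod_cast (by omega : 0 < h)
  set X := n ^ u * p ^ h with hXd
  have hX0 : 0 < X := by positivity
  have hexp := exp_neg_le_pow h1.le hn00 hw0 hw1 hp
  have hpn : 1 ≤ p * n * w := hp.trans (by
    have : w ^ 80 ≤ w := pow_le_of_le_one hw0.le hw1 (by norm_num)
    gcongr)
  set Y := n ^ u * p ^ (h - 1) with hY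
  have hY0 : 0 < Y := by positivity
  set D := h * (h * (A * Y * Y / (p * n ^ 2))) with hD
  have hD0 : 0 < D := by positivity
  have b1 := pr_not_isUniform_le (V := V) (r := r) h0 h1.le hn hn0 hw0 hw1 hw hp
  have b2 := pr_fragile_le (V := V) hr h0 h1 hn hn0 hw0 hw hw12 hp hp'
  have b3 : pr p {E : Finset (Sym2 V) | p * n ^ 2 / w ^ 4 ≤
      (#{x ∈ copiesIn S E ×ˢ copiesIn S E | ¬ Disjoint x.1 x.2} : ℝ)} ≤ A * w := by
    refine (pr_le_div h0.le h1.le (fun E ↦ Nat.cast_nonneg _) (by positivity)).trans ?_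
    rw [div_le_iff₀ (by positivity)]
    refine (ex_card_meeting_le (V := V) h0 hn hn00 (by positivity : 0 < p * n ^ 2 * w) hJ).trans ?_
    rw [← hA, ← hXd, div_le_iff₀ (by positivity)]
    have : X * X * w ^ 2 ≤ (p * n ^ 2) ^ 2 := by
      calc X * X * w ^ 2 = (X * w) ^ 2 := by ring
        _ ≤ _ := by gcongr
    have e : A * w * (p * n ^ 2 / w ^ 4) * (p * n ^ 2 * w) = A * ((p * n ^ 2) ^ 2 / w ^ 2) := by
      field_simp
    rw [e, mul_assoc]
    gcongr
    rwa [le_div_iff₀ (by positivity)]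
  have b4 : pr p {E : Finset (Sym2 V) | p * n ^ 2 * w ≤ (#(clusters S E) : ℝ)} ≤ A * w := by
    refine (pr_le_div h0.le h1.le (fun E ↦ Nat.cast_nonneg _) (by positivity)).trans ?_
    rw [div_le_iff₀ (by positivity)]
    refine (ex_card_clusters_le (V := V) h0 hn hn00 (by positivity : 0 < p * n ^ 2 / w ^ 4)
      hJ2).trans ?_
    rw [← hA, ← hXd, div_le_iff₀ (by positivity)]
    have : X * X * w ^ 2 ≤ (p * n ^ 2) ^ 2 := by
      calc X * X * w ^ 2 = (X * w) ^ 2 := by ring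
        _ ≤ _ := by gcongr
    have e : A * w * (p * n ^ 2 * w) * (p * n ^ 2 / w ^ 4) = A * ((p * n ^ 2) ^ 2 / w ^ 2) := by
      field_simp
    rw [e, mul_assoc]
    gcongr
    rwa [le_div_iff₀ (by positivity)]
  have b5 : pr p {E : Finset (Sym2 V) | ∃ φ : V → Fin r,
      mean (nearIndex S φ) (fun x ↦ x.1.erase x.2) p + 2 * (τ * Y) ≤
        cnt (nearIndex S φ) (fun x ↦ x.1.erase x.2) E} ≤ (h ^ 2 * A / τ ^ 2 + 1) * w := by
    have hov := overlap_flags_le (V := V) (S := S) h0 hn hn00 (by positivity : 0 < p * n ^ 2) hJ1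
    rw [← hA, ← hY, ← hD] at hov
    refine (pr_exists_mean_add_le_cnt (β := V → Fin r) h0.le h1.le (flags V S) (nearIndex S)
      nearIndex_subset (fun x ↦ x.1.erase x.2) hov hD0 (by positivity : 0 < τ * Y)).trans ?_
    rw [add_mul, one_mul]
    refine add_le_add ?_ ?_
    · have e : D / (τ * Y) ^ 2 = h ^ 2 * A / τ ^ 2 * (1 / (p * n ^ 2)) := by
        rw [hD]; field_simp
      rw [e]
      gcongr
      rw [div_le_iff₀ (by positivity)]
      have : w * (p * n ^ 2) = p * n * w * n := by ring
      rw [this]; nlinarith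
    · have e : (τ * Y) ^ 2 / (2 * D) = τ ^ 2 * (p * n ^ 2) / (2 * (h ^ 2 * A)) := by
        rw [hD]; field_simp
      have hpow : (Fintype.card (V → Fin r) : ℝ) = Real.exp (n * Real.log r) := by
        rw [Fintype.card_fun, Fintype.card_fin, ← hn, Real.exp_nat_mul, Real.exp_log hr0]
        push_cast; rfl
      rw [hpow, e, ← Real.exp_add]
      refine le_trans (Real.exp_le_exp.2 ?_) hexp
      have : n * (Real.log r + 1) ≤ τ ^ 2 * (p * n ^ 2) / (2 * (h ^ 2 * A)) := by
        rw [le_div_iff₀ (by positivity)]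
        have hlog : 0 ≤ Real.log r := Real.log_natCast_nonneg r
        calc n * (Real.log r + 1) * (2 * (h ^ 2 * A))
            ≤ n * (Real.log r + 1) * (2 * (h ^ 2 * A)) * (p * n * w) :=
              le_mul_of_one_le_right (by positivity) hpn
          _ = (2 * (h ^ 2 * A) * (Real.log r + 1) * w) * (p * n ^ 2) := by ring
          _ ≤ _ := by gcongr
      linarith
  have hsub : {E : Finset (Sym2 V) | ¬ IsTypical S r p n w τ E} ⊆
      {E | ¬ IsUniform r p (2 * (p * n ^ 2 * w ^ 39)) E} ∪
      ({E | n * w ^ 6 ≤ #(fragile r (1 / (p * n * w ^ 16)) E : Finset V)} ∪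
      ({E | p * n ^ 2 / w ^ 4 ≤
        (#{x ∈ copiesIn S E ×ˢ copiesIn S E | ¬ Disjoint x.1 x.2} : ℝ)} ∪
      ({E | p * n ^ 2 * w ≤ (#(clusters S E) : ℝ)} ∪
      {E | ∃ φ : V → Fin r,
        mean (nearIndex S φ) (fun x ↦ x.1.erase x.2) p + 2 * (τ * Y) ≤
          cnt (nearIndex S φ) (fun x ↦ x.1.erase x.2) E}))) := by
    intro E hE
    by_contra hcon
    simp only [Set.mem_union, Set.mem_ofPred_eq, not_or, not_le, not_exists, not_not] at hcon
    exact hE ⟨hcon.1, hcon.2.1, hcon.2.2.1, hcon.2.2.2.1, hcon.2.2.2.2⟩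
  have hu := fun S T ↦ pr_union_le (α := Sym2 V) h0.le h1.le S T
  refine (pr_mono h0.le h1.le hsub).trans ?_
  refine (hu _ _).trans ((add_le_add b1 ((hu _ _).trans (add_le_add b2 ((hu _ _).trans
    (add_le_add b3 ((hu _ _).trans (add_le_add b4 b5))))))).trans ?_)
  linarith

/-- Typically the maximum cut survives the deletion of few cut edges, unless they meet a small set
of vertices. -/
lemma IsTypical.exists_robust (hr : 2 ≤ r) (h0 : 0 < p) (h1 : p < 1) (hn : Fintype.card V = n)
    (hn0 : 1 ≤ n) (hw0 : 0 < w) (hwr : 2 ^ 18 * r ^ 4 * w ≤ 1)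
    (hp : 1 ≤ p * n * w ^ 80) {E : Finset (Sym2 V)} (hE : IsTypical S r p n w τ E) :
    ∃ B : Finset V, (∀ R ⊆ E ∩ cross (maxCut r E), #R ≤ ⌈(1 / w) ^ 8⌉₊ →
        (∀ e ∈ R, ∀ x ∈ e, x ∉ B) → maxCut r (E \ R) = maxCut r E) ∧
      (#B : ℝ) ≤ 2 * (n * w ^ 6) := by
  have hn00 : 0 < n := by linarith only [hn0]
  have hr2 : (2 : ℝ) ≤ r := by exact_mod_cast hr
  have hr0 : (0 : ℝ) < r := by linarith only [hr2]
  have hr4 : (1 : ℝ) ≤ r ^ 4 := one_le_pow₀ (by linarith only [hr2])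
  have hrr4 : (r : ℝ) * w ≤ r ^ 4 * w :=
    mul_le_mul_of_nonneg_right (le_self_pow₀ (by linarith only [hr2]) (by norm_num)) hw0.le
  have hrr2 : (r : ℝ) ^ 2 * w ≤ r ^ 4 * w :=
    mul_le_mul_of_nonneg_right (pow_le_pow_right₀ (by linarith only [hr2]) (by norm_num)) hw0.le
  have hw4 : w ≤ r ^ 4 * w := le_mul_of_one_le_left hw0.le hr4
  have hw1 : w ≤ 1 := by linarith only [hw4, hwr]
  have hwk : ∀ k : ℕ, k ≠ 0 → w ^ k ≤ w := fun k hk ↦ pow_le_of_le_one hw0.le hw1 hk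
  set ρ := 1 / (p * n * w ^ 16) with hρ
  have hρ0 : 0 < ρ := by positivity
  have hρ1 : ρ ≤ 1 := by
    rw [hρ, div_le_one (by positivity)]
    refine hp.trans ?_
    have : w ^ 80 ≤ w ^ 16 := pow_le_pow_of_le_one hw0.le hw1 (by norm_num)
    gcongr
  have hcls := fun i ↦ abs_le.1 (hE.uniform.abs_card_cls_sub_le' h0 h1.le hn hn0 hw0 hw1 hp i)
  have hcls1 : ∀ i, n / (2 * r) ≤ #(cls (maxCut r E) i) := by
    intro i
    have h2 := (hcls i).1
    have h3 : 3 * n * w ^ 19 ≤ n / (2 * r) := by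
      rw [le_div_iff₀ (by positivity)]
      calc 3 * n * w ^ 19 * (2 * r) ≤ 3 * n * w * (2 * r) := by gcongr; exact hwk 19 (by norm_num)
        _ = n * (6 * (r * w)) := by ring
        _ ≤ n * 1 := by gcongr; linarith only [hrr4, hwr]
        _ = n := mul_one n
    have h5 : n / r = n / (2 * r) + n / (2 * r) := by field_simp; ring
    linarith only [h2, h3, h5]
  have hwinv : (1 : ℝ) ≤ (1 / w) ^ 8 := one_le_pow₀ ((one_le_div hw0).2 hw1)
  have hceil : ((⌈(1 / w) ^ 8⌉₊ : ℕ) : ℝ) ≤ (1 / w) ^ 8 + 1 := (Nat.ceil_lt_add_one (by positivity)).le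
  obtain ⟨B, hBc, hB⟩ := exists_contested hE.uniform h0 hρ0 hρ1 ⌈(1 / w) ^ 8⌉₊ hn hn00 hcls1
    (by
      have e : 4 * (3 * (1 / w) ^ 8) / ρ = p * n * (12 * w ^ 8) := by
        rw [hρ]; field_simp; ring
      calc 4 * ((⌈(1 / w) ^ 8⌉₊ : ℝ) + 1) / ρ ≤ 4 * (3 * (1 / w) ^ 8) / ρ := by
            gcongr; linarith only [hceil, hwinv]
        _ = p * n * (12 * w ^ 8) := e
        _ ≤ p * n * (1 / (2 ^ 14 * r ^ 4)) := by
            gcongr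
            rw [le_div_iff₀ (by positivity)]
            calc 12 * w ^ 8 * (2 ^ 14 * (r : ℝ) ^ 4) ≤ 12 * w * (2 ^ 14 * (r : ℝ) ^ 4) := by
                  gcongr; exact hwk 8 (by norm_num)
              _ ≤ 1 := by linarith only [hwr, hw4, hw0]
        _ = _ := by ring)
    (by
      refine hE.fragile_lt.le.trans ?_
      rw [le_div_iff₀ (by positivity)]
      calc n * w ^ 6 * (2 ^ 14 * (r : ℝ) ^ 4) ≤ n * w * (2 ^ 14 * (r : ℝ) ^ 4) := by
            gcongr; exact hwk 6 (by norm_num)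
        _ = n * (2 ^ 14 * (r ^ 4 * w)) := by ring
        _ ≤ n * 1 := by gcongr; linarith only [hwr, hw4, hw0]
        _ = n := mul_one n)
    (by
      rw [le_div_iff₀ (by positivity)]
      calc 2 * (p * n ^ 2 * w ^ 39) * (2 ^ 16 * (r : ℝ) ^ 4) ≤
            2 * (p * n ^ 2 * w) * (2 ^ 16 * (r : ℝ) ^ 4) := by
            gcongr; exact hwk 39 (by norm_num)
        _ = p * n ^ 2 * (2 ^ 17 * (r ^ 4 * w)) := by ring
        _ ≤ p * n ^ 2 * 1 := by gcongr; linarith only [hwr, hw4, hw0]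
        _ = _ := mul_one _)
  refine ⟨B, hB, ?_⟩
  have e : 20 * (r : ℝ) ^ 2 * (2 * (p * n ^ 2 * w ^ 39) / (p * n)) =
      n * (40 * (r ^ 2 * w ^ 39)) := by field_simp; ring
  rw [e] at hBc
  have h2 : 40 * ((r : ℝ) ^ 2 * w ^ 39) ≤ w ^ 6 := by
    have h3 : w ^ 39 ≤ w * w ^ 6 := by
      rw [← pow_succ']; exact pow_le_pow_of_le_one hw0.le hw1 (by norm_num)
    calc 40 * ((r : ℝ) ^ 2 * w ^ 39) ≤ 40 * ((r : ℝ) ^ 2 * (w * w ^ 6)) := by gcongr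
      _ = 40 * ((r : ℝ) ^ 2 * w) * w ^ 6 := by ring
      _ ≤ 1 * w ^ 6 := by gcongr; linarith only [hrr2, hwr, hw4, hw0]
      _ = _ := one_mul _
  have h3 := mul_le_mul_of_nonneg_left h2 hn00.le
  linarith only [hE.fragile_lt, hBc, h3]

/-- Up to a factor `1 - κ`, the number of edges inside the parts is at least its expectation. -/
lemma IsTypical.card_inner_ge (h0 : 0 < p) (hn : Fintype.card V = n) (hn0 : 1 ≤ n)
    (hn2 : 2 * r ≤ n) (hw0 : 0 < w) (hw1 : w ≤ 1) (hκ0 : 0 < κ) (hκw : 8 * r * w ≤ κ)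
    {E : Finset (Sym2 V)} (hE : IsTypical S r p n w τ E) :
    (1 - κ) * (p * #(inside (maxCut r E))) ≤ #(inner r E) := by
  have hn00 : 0 < n := by linarith only [hn0]
  have hr0 : (0 : ℝ) < r := by exact_mod_cast Nat.pos_of_ne_zero (NeZero.ne r)
  have hM1 := card_inside_ge (maxCut r E) hn hn2
  have h2 := hE.uniform.card_inner_ge
  have h3 : 2 * (p * n ^ 2 * w ^ 39) ≤ κ * (p * #(inside (maxCut r E))) := by
    have h4 : 8 * r * w ^ 39 ≤ κ := by
      refine le_trans ?_ hκw
      gcongr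
      exact pow_le_of_le_one hw0.le hw1 (by norm_num)
    calc _ = 8 * r * w ^ 39 * (p * (n ^ 2 / (4 * r))) := by field_simp; ring
      _ ≤ _ := by gcongr
  linarith only [h2, h3]

/-- Typically an average edge inside the parts is the missing edge of few copies that lack one
further edge. -/
lemma IsTypical.mul_cnt_nearIndex_le (h0 : 0 < p) (h1 : p < 1) (hn : Fintype.card V = n)
    (hn0 : 1 ≤ n) (hn2 : 2 * r ≤ n) (hw0 : 0 < w) (hw1 : w ≤ 1)
    (hp : 1 ≤ p * n * w ^ 80) (hS : 2 ≤ #S) (hu : 2 ≤ Fintype.card U) (hτ0 : 0 < τ)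
    (hκ0 : 0 < κ) (hκ1 : κ ≤ 1 / 2) (hκw : 8 * r * w ≤ κ) (hΛ : 0 < Λ)
    (hN : ∀ φ : V → Fin r, (∀ i, (#(cls φ i) : ℝ) ≤ n / r + 3 * n * w ^ 19) → ∀ e ∈ inside φ,
      (#{C ∈ copies V S | e ∈ C ∧ C.erase e ⊆ cross φ} : ℝ) ≤ N) (hN0 : 0 ≤ N)
    (hmain : p ^ (#S - 1) * (N + 8 * r * τ * n ^ (Fintype.card U - 2)) ≤
      (1 - κ) ^ 2 * (1 - p) * Λ) {E : Finset (Sym2 V)} (hE : IsTypical S r p n w τ E) :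
    1 / ((#S - 1 : ℕ) : ℝ) * (p / (1 - p)) *
      cnt (nearIndex S (maxCut r E)) (fun x ↦ x.1.erase x.2) E ≤
        (1 - κ) * Λ * #(inner r E) := by
  have hn00 : 0 < n := by linarith only [hn0]
  have hr0 : (0 : ℝ) < r := by exact_mod_cast Nat.pos_of_ne_zero (NeZero.ne r)
  have hcls := fun i ↦ abs_le.1 (hE.uniform.abs_card_cls_sub_le' h0 h1.le hn hn0 hw0 hw1 hp i)
  have hcls2 : ∀ i, (#(cls (maxCut r E) i) : ℝ) ≤ n / r + 3 * n * w ^ 19 := fun i ↦ by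
    linarith only [(hcls i).2]
  have hinner := hE.card_inner_ge h0 hn hn0 hn2 hw0 hw1 hκ0 hκw
  have hM1 := card_inside_ge (maxCut r E) hn hn2
  have hh1 : (1 : ℝ) ≤ ((#S - 1 : ℕ) : ℝ) := by exact_mod_cast (by omega : 1 ≤ #S - 1)
  have h2 := (hE.near_lt (maxCut r E)).le
  have h3 := mean_nearIndex_le h0.le (maxCut r E) (hN _ hcls2)
  set M : ℝ := ((#(inside (maxCut r E)) : ℕ) : ℝ) with hM
  have h4 : n ^ Fintype.card U ≤ 4 * r * M * n ^ (Fintype.card U - 2) := by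
    have e : n ^ Fintype.card U = n ^ 2 * n ^ (Fintype.card U - 2) := by
      rw [← pow_add]; congr 1; omega
    rw [e]
    gcongr
    rw [div_le_iff₀ (by positivity)] at hM1
    linarith only [hM1]
  have hM0 : 0 ≤ M := Nat.cast_nonneg _
  have h5 : 2 * (τ * (n ^ Fintype.card U * p ^ (#S - 1))) ≤
      ((#S - 1 : ℕ) : ℝ) * p ^ (#S - 1) * (M * (8 * r * τ * n ^ (Fintype.card U - 2))) := by
    calc _ ≤ 2 * (τ * ((4 * r * M * n ^ (Fintype.card U - 2)) * p ^ (#S - 1))) := by gcongr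
      _ = 1 * (p ^ (#S - 1) * (M * (8 * r * τ * n ^ (Fintype.card U - 2)))) := by ring
      _ ≤ ((#S - 1 : ℕ) : ℝ) * (p ^ (#S - 1) * (M * (8 * r * τ * n ^ (Fintype.card U - 2)))) := by
          gcongr
      _ = _ := by ring
  have h1p : 0 < 1 - p := by linarith only [h1]
  have hS0 : (0 : ℝ) < ((#S - 1 : ℕ) : ℝ) := by linarith only [hh1]
  calc _ ≤ 1 / ((#S - 1 : ℕ) : ℝ) * (p / (1 - p)) * (((#S - 1 : ℕ) : ℝ) * p ^ (#S - 1) *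
        (M * (N + 8 * r * τ * n ^ (Fintype.card U - 2)))) := by
        gcongr
        linarith only [h2, h3, h5]
    _ = p / (1 - p) * M * (p ^ (#S - 1) * (N + 8 * r * τ * n ^ (Fintype.card U - 2))) := by
        field_simp
    _ ≤ p / (1 - p) * M * ((1 - κ) ^ 2 * (1 - p) * Λ) := by gcongr
    _ = (1 - κ) * Λ * ((1 - κ) * (p * M)) := by field_simp
    _ ≤ _ := by
        have : 0 ≤ 1 - κ := by linarith only [hκ1]
        gcongr

/-- Typically a positive proportion of the edges inside the parts are good. -/
lemma IsTypical.exists_goodEdges (hr : 2 ≤ r) (h0 : 0 < p) (h1 : p < 1) (hn : Fintype.card V = n)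
    (hn0 : 1 ≤ n) (hn2 : 2 * r ≤ n) (hw0 : 0 < w) (hwr : 2 ^ 18 * r ^ 4 * w ≤ 1)
    (hp : 1 ≤ p * n * w ^ 80) (hS : 2 ≤ #S) (hu : 2 ≤ Fintype.card U) (hτ0 : 0 < τ)
    (hκ0 : 0 < κ) (hκ1 : κ ≤ 1 / 2) (hκw : 16 * r * (6 * #S + 1 + #S ^ 2) * w ≤ κ) (hΛ : 0 < Λ)
    (hN : ∀ φ : V → Fin r, (∀ i, (#(cls φ i) : ℝ) ≤ n / r + 3 * n * w ^ 19) → ∀ e ∈ inside φ,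
      (#{C ∈ copies V S | e ∈ C ∧ C.erase e ⊆ cross φ} : ℝ) ≤ N) (hN0 : 0 ≤ N)
    (hmain : p ^ (#S - 1) * (N + 8 * r * τ * n ^ (Fintype.card U - 2)) ≤
      (1 - κ) ^ 2 * (1 - p) * Λ) {E : Finset (Sym2 V)} (hE : IsTypical S r p n w τ E) :
    ∃ B : Finset V, (∀ R ⊆ E ∩ cross (maxCut r E), #R ≤ ⌈(1 / w) ^ 8⌉₊ →
        (∀ e ∈ R, ∀ x ∈ e, x ∉ B) → maxCut r (E \ R) = maxCut r E) ∧
      κ / (16 * r) * (p * n ^ 2) ≤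
        #(goodEdges S r B ((1 / w) ^ 8) (1 / ((#S - 1 : ℕ) : ℝ) * (p / (1 - p))) Λ E) := by
  obtain ⟨B, hB, hBn⟩ := hE.exists_robust hr h0 h1 hn hn0 hw0 hwr hp
  refine ⟨B, hB, ?_⟩
  have hn00 : 0 < n := by linarith only [hn0]
  have hr1 : (1 : ℝ) ≤ r := by exact_mod_cast (by omega : 1 ≤ r)
  have hr0 : (0 : ℝ) < r := by linarith only [hr1]
  have hs1 : (1 : ℝ) ≤ #S := by exact_mod_cast (by omega : 1 ≤ #S)
  have hw1 : w ≤ 1 := by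
    have : w ≤ r ^ 4 * w := le_mul_of_one_le_left hw0.le (one_le_pow₀ hr1)
    linarith only [this, hwr]
  have hwk : ∀ k : ℕ, k ≠ 0 → w ^ k ≤ w := fun k hk ↦ pow_le_of_le_one hw0.le hw1 hk
  have hpn1 : 1 ≤ p * n := hp.trans (mul_le_of_le_one_right (by positivity)
    (pow_le_one₀ hw0.le hw1))
  have hκw' : 8 * r * w ≤ κ := by
    refine le_trans ?_ hκw
    calc 8 * r * w ≤ 8 * r * w * (2 * (6 * #S + 1 + #S ^ 2)) :=
          le_mul_of_one_le_right (by positivity)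
            (by linarith only [hs1, sq_nonneg (#S : ℝ)])
      _ = _ := by ring
  have htouch : (#(E ∩ ({f | ∃ x ∈ f, x ∈ B} : Finset (Sym2 V))) : ℝ) ≤
      6 * (p * n ^ 2 * w ^ 6) := by
    refine (hE.uniform.card_touching_le h0.le hn hpn1 B).trans ?_
    have h2 : p * n * #B ≤ p * n * (2 * (n * w ^ 6)) := by gcongr
    have h3 : w ^ 39 ≤ w ^ 6 := pow_le_pow_of_le_one hw0.le hw1 (by norm_num)
    have h4 : p * n ^ 2 * w ^ 39 ≤ p * n ^ 2 * w ^ 6 := by gcongr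
    linarith only [h2, h4]
  have hZ : (∑ f ∈ E, (copyDeg S E f : ℝ) ^ 2) ≤ #S * (p * n ^ 2 / w ^ 4) := by
    have h2 := Nat.cast_le (α := ℝ).2 (sum_copyDeg_sq_le (S := S) (E := E))
    push_cast at h2
    exact h2.trans (mul_le_mul_of_nonneg_left hE.meeting_lt.le (Nat.cast_nonneg _))
  have hM1 := card_inside_ge (maxCut r E) hn hn2
  have hinner := hE.card_inner_ge h0 hn hn0 hn2 hw0 hw1 hκ0 hκw'
  have hnear := hE.mul_cnt_nearIndex_le h0 h1 hn hn0 hn2 hw0 hw1 hp hS hu hτ0 hκ0 hκ1 hκw' hΛ hN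
    hN0 hmain
  have hq : 0 ≤ 1 / ((#S - 1 : ℕ) : ℝ) * (p / (1 - p)) := by
    have : 0 < 1 - p := by linarith only [h1]
    positivity
  have key := card_inner_le B (by positivity : 0 < (1 / w) ^ 8) hΛ hq hnear hZ
  have hsqrt : √(#(E ∩ ({f | ∃ x ∈ f, x ∈ B} : Finset (Sym2 V))) * (#S * (p * n ^ 2 / w ^ 4))) ≤
      6 * #S * (p * n ^ 2 * w) := by
    apply Real.sqrt_le_iff.2 ⟨by positivity, ?_⟩
    calc _ ≤ 6 * (p * n ^ 2 * w ^ 6) * (#S * (p * n ^ 2 / w ^ 4)) := by gcongr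
      _ = 6 * #S * (p * n ^ 2 * w) ^ 2 := by field_simp
      _ ≤ (6 * #S) * ((6 * #S) * (p * n ^ 2 * w) ^ 2) :=
          le_mul_of_one_le_left (by positivity) (by linarith only [hs1])
      _ = _ := by ring
  have hlast : #S * (#S * (p * n ^ 2 / w ^ 4)) / (1 / w) ^ 8 ≤ #S ^ 2 * (p * n ^ 2 * w) := by
    have e : #S * (#S * (p * n ^ 2 / w ^ 4)) / (1 / w) ^ 8 = #S ^ 2 * (p * n ^ 2 * w ^ 4) := by
      field_simp
    rw [e]
    gcongr
    exact hwk 4 (by norm_num)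
  have hin2 : p * n ^ 2 / (8 * r) ≤ #(inner r E) := by
    refine le_trans ?_ hinner
    calc p * n ^ 2 / (8 * r) = (1 / 2) * (p * (n ^ 2 / (4 * r))) := by field_simp; norm_num
      _ ≤ _ := mul_le_mul (by linarith only [hκ1]) (mul_le_mul_of_nonneg_left hM1 h0.le)
          (by positivity) (by linarith only [hκ1])
  have h7 : κ * (p * n ^ 2 / (8 * r)) ≤ κ * #(inner r E) := by gcongr
  have h8 : (6 * #S + 1 + #S ^ 2) * (p * n ^ 2 * w) ≤ κ / (16 * r) * (p * n ^ 2) := by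
    rw [div_mul_eq_mul_div, le_div_iff₀ (by positivity)]
    calc _ = 16 * r * (6 * #S + 1 + #S ^ 2) * w * (p * n ^ 2) := by ring
      _ ≤ _ := by gcongr
  have h9 : κ * (p * n ^ 2 / (8 * r)) = 2 * (κ / (16 * r) * (p * n ^ 2)) := by field_simp; norm_num
  linarith only [hE.clusters_lt, key, hsqrt, hlast, h7, h8, h9]

/-- The random graph is unlikely to be saturated. The main hypothesis `hmain` says that the expected
number of copies closed by a pair, `p ^ (#S - 1) * N`, is smaller than `Λ` with room to spare; the
conclusion is useful if `exp Λ` is much smaller than the number `p * n ^ 2` of edges. The hypotheses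
`hJ`, `hJ1`, `hJ2` and `hX` are as in `pr_not_isTypical_le`, and `κ` is, up to a constant factor,
the proportion of edges inside the parts that turn out to be good. -/
theorem pr_isSaturated_le (hr : 2 ≤ r) (h0 : 0 < p) (h1 : p < 1) (hn : Fintype.card V = n)
    (hn0 : 1 ≤ n) (hn2 : 2 * r ≤ n) (hw0 : 0 < w)
    (hw : 4 * (Real.log (4 * r ^ 2) + 1) * w ^ 2 ≤ 1) (hwr : 2 ^ 18 * r ^ 4 * w ≤ 1)
    (hp : 1 ≤ p * n * w ^ 80) (hp' : p ≤ w ^ 32)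
    (hA : A = (Fintype.card U : ℝ) ^ Fintype.card U * 2 ^ #S) (hS : 2 ≤ #S)
    (hJ : ∀ J ⊆ S, J.Nonempty → p * n ^ 2 * w ≤ n ^ #(verts J) * p ^ #J)
    (hJ1 : ∀ J ⊆ S, J.Nonempty → #J < #S → p * n ^ 2 ≤ n ^ #(verts J) * p ^ #J)
    (hJ2 : ∀ J ⊆ S, 2 ≤ #J → #J < #S → p * n ^ 2 / w ^ 4 ≤ n ^ #(verts J) * p ^ #J)
    (hX : n ^ Fintype.card U * p ^ #S * w ≤ p * n ^ 2) (hτ0 : 0 < τ)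
    (hτ : 2 * (#S ^ 2 * A) * (Real.log r + 1) * w ≤ τ ^ 2) (hu : 2 ≤ Fintype.card U)
    (hκ0 : 0 < κ) (hκ1 : κ ≤ 1 / 2) (hκw : 16 * r * (6 * #S + 1 + #S ^ 2) * w ≤ κ) (hΛ : 0 < Λ)
    (hN : ∀ φ : V → Fin r, (∀ i, (#(cls φ i) : ℝ) ≤ n / r + 3 * n * w ^ 19) → ∀ e ∈ inside φ,
      (#{C ∈ copies V S | e ∈ C ∧ C.erase e ⊆ cross φ} : ℝ) ≤ N) (hN0 : 0 ≤ N)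
    (hmain : p ^ (#S - 1) * (N + 8 * r * τ * n ^ (Fintype.card U - 2)) ≤
      (1 - κ) ^ 2 * (1 - p) * Λ) :
    pr p {E : Finset (Sym2 V) | IsSaturated S r E} ≤
      (55 + 2 * A + #S ^ 2 * A / τ ^ 2) * w +
        (1 / w) ^ 8 * Real.exp Λ / (κ / (16 * r) * (p * n ^ 2)) := by
  classical
  have hr1 : (1 : ℝ) ≤ r := by exact_mod_cast (by omega : 1 ≤ r)
  have hn00 : 0 < n := by linarith
  have hw12 : 12 * w ≤ 1 := by
    have : (1 : ℝ) ≤ r ^ 4 := one_le_pow₀ hr1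
    nlinarith
  set q := 1 / ((#S - 1 : ℕ) : ℝ) * (p / (1 - p)) with hq
  have hex : ∀ E : Finset (Sym2 V), ∃ B : Finset V, IsTypical S r p n w τ E →
      (∀ R ⊆ E ∩ cross (maxCut r E), #R ≤ ⌈(1 / w) ^ 8⌉₊ →
        (∀ e ∈ R, ∀ x ∈ e, x ∉ B) → maxCut r (E \ R) = maxCut r E) ∧
      κ / (16 * r) * (p * n ^ 2) ≤ #(goodEdges S r B ((1 / w) ^ 8) q Λ E) := by
    intro E
    by_cases hE : IsTypical S r p n w τ E
    · obtain ⟨B, hB⟩ := hE.exists_goodEdges hr h0 h1 hn hn0 hn2 hw0 hwr hp hS hu hτ0 hκ0 hκ1 hκw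
        hΛ hN hN0 hmain
      exact ⟨B, fun _ ↦ hB⟩
    · exact ⟨∅, fun h ↦ absurd h hE⟩
  choose B hB using hex
  set good : Finset (Sym2 V) → Finset (Sym2 V) := fun E ↦
    if IsSaturated S r E ∧ IsTypical S r p n w τ E then
      goodEdges S r (B E) ((1 / w) ^ 8) q Λ E else ∅ with hgood
  have key := ex_card_good_le (S := S) (r := r) h0.le h1 hS (Λ := Λ) (Y₀ := (1 / w) ^ 8)
    (K := ⌈(1 / w) ^ 8⌉₊) (by positivity) (Nat.le_ceil _) good B
    (by
      intro E hne
      simp only [hgood] at hne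
      split_ifs at hne with h
      · exact ⟨h.1, (hB E h.2).1⟩
      · simp at hne)
    (by
      intro E e he
      simp only [hgood] at he
      split_ifs at he with h
      · simpa only [goodEdges, mem_filter] using he
      · simp at he)
  have hpos : 0 < κ / (16 * r) * (p * n ^ 2) := by positivity
  -- A typical saturated graph has many good edges, while the expected number of good edges of
  -- saturated graphs is small by the switching inequality: apply Markov's inequality.
  have h2 : pr p {E : Finset (Sym2 V) | IsSaturated S r E ∧ IsTypical S r p n w τ E} ≤
      (1 / w) ^ 8 * Real.exp Λ / (κ / (16 * r) * (p * n ^ 2)) := by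
    refine le_trans (pr_mono h0.le h1.le fun E hE ↦ ?_) ((pr_le_div h0.le h1.le
      (f := fun E ↦ (#(good E) : ℝ)) (fun E ↦ Nat.cast_nonneg _) hpos).trans
      (div_le_div_of_nonneg_right key hpos.le))
    have hE : IsSaturated S r E ∧ IsTypical S r p n w τ E := hE
    simp only [Set.mem_ofPred_eq, hgood, if_pos hE]
    exact (hB E hE.2).2
  have h3 := pr_not_isTypical_le (V := V) (S := S) hr h0 h1 hn hn0 hw0 hw hw12 hp hp' hA hS hJ hJ1
    hJ2 hX hτ0 hτ
  refine (pr_mono h0.le h1.le (T := {E | ¬ IsTypical S r p n w τ E} ∪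
    {E | IsSaturated S r E ∧ IsTypical S r p n w τ E}) fun E hE ↦ ?_).trans
    ((pr_union_le h0.le h1.le _ _).trans (add_le_add h3 h2))
  by_cases hT : IsTypical S r p n w τ E
  · exact Or.inr ⟨hE, hT⟩
  · exact Or.inl hT

end Saturation

section Asymptotics

variable {U V : Type*} [Fintype U] [DecidableEq U] [Fintype V] [DecidableEq V]
  {p n w : ℝ} {r : ℕ} [NeZero r] {S : Finset (Sym2 U)}

/-! ### Sparse random graphs -/

/-- When copies are rarer than edges, a maximum cut misses more edges than there are copies. -/
lemma pr_isSaturated_le_of_sparse (h0 : 0 < p) (h1 : p ≤ 1) (hn : Fintype.card V = n)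
    (hn0 : 1 ≤ n) (hn2 : 2 * r ≤ n) (hw0 : 0 < w)
    (hw : 4 * (Real.log (4 * r ^ 2) + 1) * w ^ 2 ≤ 1) (hwr : 16 * r * w ≤ 1)
    (hp : 1 ≤ p * n * w ^ 80) :
    pr p {E : Finset (Sym2 V) | IsSaturated S r E} ≤
      8 * Real.exp (-n) + 8 * r * (n ^ Fintype.card U * p ^ #S / (p * n ^ 2)) := by
  have hn00 : 0 < n := by linarith
  have hr1 : (1 : ℝ) ≤ r := by exact_mod_cast Nat.pos_of_ne_zero (NeZero.ne r)
  have hw1 : w ≤ 1 := by nlinarith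
  have hex : ex p (fun E : Finset (Sym2 V) ↦ (#(copiesIn S E) : ℝ)) ≤
      n ^ Fintype.card U * p ^ #S := by
    have e : ∀ E : Finset (Sym2 V), (#(copiesIn S E) : ℝ) =
        ∑ C ∈ copies V S, if C ⊆ E then (1 : ℝ) else 0 := fun E ↦ by
      rw [copiesIn, sum_boole]
    simp_rw [e]
    rw [ex_sum, sum_congr rfl fun C _ ↦ ex_ite_subset p C]
    refine (sum_copies_le (g := fun C : Finset (Sym2 V) ↦ p ^ #C)
      fun C ↦ pow_nonneg h0.le _).trans ?_
    rw [sum_congr rfl fun f _ ↦ by rw [card_img], sum_const, nsmul_eq_mul, card_univ]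
    gcongr
    rw [← hn]
    have : Fintype.card (U ↪ V) ≤ Fintype.card (U → V) :=
      Fintype.card_le_of_injective _ DFunLike.coe_injective
    rw [Fintype.card_fun] at this
    exact_mod_cast this
  have hpos : 0 < p * n ^ 2 / (8 * r) := by positivity
  have h2 : pr p {E : Finset (Sym2 V) | p * n ^ 2 / (8 * r) ≤ (#(copiesIn S E) : ℝ)} ≤
      8 * r * (n ^ Fintype.card U * p ^ #S / (p * n ^ 2)) := by
    refine (pr_le_div h0.le h1 (fun E ↦ Nat.cast_nonneg _) hpos).trans ?_
    refine (div_le_div_of_nonneg_right hex hpos.le).trans_eq ?_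
    field_simp
  have h3 := pr_not_isUniform_le (V := V) (r := r) h0 h1 hn hn0 hw0 hw1 hw hp
  refine (pr_mono h0.le h1 (T := {E | ¬ IsUniform r p (2 * (p * n ^ 2 * w ^ 39)) E} ∪
    {E | p * n ^ 2 / (8 * r) ≤ (#(copiesIn S E) : ℝ)}) fun E hE ↦ ?_).trans
    ((pr_union_le h0.le h1 _ _).trans (add_le_add h3 h2))
  by_cases hun : IsUniform r p (2 * (p * n ^ 2 * w ^ 39)) E
  · refine Or.inr (Set.mem_ofPred_eq ▸ ?_)
    have hsat : IsSaturated S r E := hE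
    -- In a saturated graph, the edges inside the parts close different copies.
    have h4 : #(inner r E) ≤ #(copiesIn S E) := by
      have h5 := sum_closers_le (S := S) (r := r) (E := E) fun _ ↦ 1
      simp only [sum_const, smul_eq_mul, mul_one] at h5
      refine le_trans ?_ h5
      rw [card_eq_sum_ones]
      exact sum_le_sum fun e he ↦ card_pos.2 (hsat e he)
    have h5 : (#(inner r E) : ℝ) ≤ #(copiesIn S E) := by exact_mod_cast h4
    have h6 := hun.card_inner_ge
    have h7 := card_inside_ge (maxCut r E) hn hn2
    have h8 : p * (n ^ 2 / (4 * r)) ≤ p * #(inside (maxCut r E)) := by gcongr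
    have h9 : 2 * (p * n ^ 2 * w ^ 39) ≤ p * n ^ 2 / (8 * r) := by
      rw [le_div_iff₀ (by positivity)]
      have : w ^ 39 ≤ w := pow_le_of_le_one hw0.le hw1 (by norm_num)
      calc 2 * (p * n ^ 2 * w ^ 39) * (8 * r) ≤ 2 * (p * n ^ 2 * w) * (8 * r) := by gcongr
        _ = p * n ^ 2 * (16 * r * w) := by ring
        _ ≤ p * n ^ 2 * 1 := by gcongr
        _ = _ := mul_one _
    have h10 : p * (n ^ 2 / (4 * r)) = 2 * (p * n ^ 2 / (8 * r)) := by field_simp; norm_num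
    linarith
  · exact Or.inl hun

/-! ### Asymptotics -/

lemma exists_pos_forall_le {ι : Type*} (T : Finset ι) (f : ι → ℝ) (hf : ∀ i ∈ T, 0 < f i) :
    ∃ g > 0, ∀ i ∈ T, g ≤ f i := by
  rcases T.eq_empty_or_nonempty with rfl | hT
  · exact ⟨1, one_pos, by simp⟩
  · obtain ⟨i, hi, h⟩ := exists_min_image T f hT
    exact ⟨f i, hf i hi, h⟩

lemma tendsto_natCast_rpow_neg {c : ℝ} (hc : 0 < c) :
    Tendsto (fun n : ℕ ↦ (n : ℝ) ^ (-c)) atTop (𝓝 0) :=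
  (tendsto_rpow_neg_atTop hc).comp tendsto_natCast_atTop_atTop

lemma eventually_mul_rpow_neg_le {c : ℝ} (hc : 0 < c) (a : ℝ) {b : ℝ} (hb : 0 < b) :
    ∀ᶠ n : ℕ in atTop, a * (n : ℝ) ^ (-c) ≤ b := by
  have := (tendsto_natCast_rpow_neg hc).const_mul a
  rw [mul_zero] at this
  exact this.eventually_le_const hb

lemma eventually_mul_log_le {c : ℝ} (hc : 0 < c) (a : ℝ) :
    ∀ᶠ n : ℕ in atTop, a * Real.log n ≤ (n : ℝ) ^ c := by
  have h := ((isLittleO_log_rpow_atTop hc).const_mul_left a).comp_tendsto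
    (tendsto_natCast_atTop_atTop (R := ℝ))
  filter_upwards [h.bound one_pos] with n hn
  simp only [Function.comp, one_mul, Real.norm_eq_abs] at hn
  exact (le_abs_self _).trans (hn.trans_eq (abs_of_nonneg (Real.rpow_nonneg (Nat.cast_nonneg _) _)))

/-- The number of copies closed by an edge in a nearly balanced partition. -/
lemma eventually_count_le {u : ℕ} (cop : ℕ → ℕ) {ϖ c σ : ℝ}
    (hcop : Tendsto (fun m ↦ (cop m : ℝ) / (m : ℝ) ^ u) atTop (𝓝 ϖ)) (hc : 0 < c) (hσ : 0 < σ) :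
    ∀ᶠ n : ℕ in atTop, (cop ⌊(n : ℝ) / r + 3 * n * ((n : ℝ) ^ (-c)) ^ 19⌋₊ : ℝ) ≤
      (ϖ / (r : ℝ) ^ u + σ) * (n : ℝ) ^ u := by
  have hr : (0 : ℝ) < r := by exact_mod_cast Nat.pos_of_ne_zero (NeZero.ne r)
  set a : ℕ → ℝ := fun n ↦ 1 / r + 3 * ((n : ℝ) ^ (-c)) ^ 19 with ha
  have ha0 : ∀ n, 1 / (r : ℝ) ≤ a n := fun n ↦
    le_add_of_nonneg_right (by positivity)
  have ha1 : Tendsto a atTop (𝓝 (1 / r)) := by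
    have := (((tendsto_natCast_rpow_neg hc).pow 19).const_mul 3).const_add (1 / (r : ℝ))
    simpa [ha] using this
  set m : ℕ → ℕ := fun n ↦ ⌊(n : ℝ) / r + 3 * n * ((n : ℝ) ^ (-c)) ^ 19⌋₊ with hm
  have hma : ∀ n, m n = ⌊a n * n⌋₊ := fun n ↦ by simp only [hm, ha]; congr 1; ring
  have hfl : Tendsto (fun n : ℕ ↦ (m n : ℝ) / n) atTop (𝓝 (1 / r)) := by
    refine tendsto_of_tendsto_of_tendsto_of_le_of_le' (g := fun n : ℕ ↦ a n - 1 / n) (h := a) ?_ ha1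
      ?_ ?_
    · simpa using ha1.sub tendsto_one_div_atTop_nhds_zero_nat
    · filter_upwards [eventually_gt_atTop 0] with n hn
      have hn' : (0 : ℝ) < n := by exact_mod_cast hn
      rw [le_div_iff₀ hn', hma, sub_mul, one_div_mul_cancel hn'.ne']
      linarith [Nat.lt_floor_add_one (a n * n)]
    · filter_upwards [eventually_gt_atTop 0] with n hn
      have hn' : (0 : ℝ) < n := by exact_mod_cast hn
      rw [div_le_iff₀ hn', hma]
      exact Nat.floor_le (mul_nonneg ((by positivity : 0 ≤ 1 / (r : ℝ)).trans (ha0 n)) hn'.le)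
  have hmtop : Tendsto m atTop atTop := by
    have : Tendsto (fun n : ℕ ↦ (1 / (r : ℝ)) * n) atTop atTop :=
      tendsto_natCast_atTop_atTop.const_mul_atTop (by positivity)
    have h2 := tendsto_nat_floor_atTop.comp this
    refine tendsto_atTop_mono (fun n ↦ ?_) h2
    rw [hma]
    exact Nat.floor_mono (mul_le_mul_of_nonneg_right (ha0 n) (Nat.cast_nonneg _))
  have hlim : Tendsto (fun n : ℕ ↦ (cop (m n) : ℝ) / (m n : ℝ) ^ u * ((m n : ℝ) / n) ^ u) atTop
      (𝓝 (ϖ * (1 / r) ^ u)) := (hcop.comp hmtop).mul (hfl.pow u)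
  have hlt : ϖ * (1 / (r : ℝ)) ^ u < ϖ / (r : ℝ) ^ u + σ := by
    rw [one_div, inv_pow, ← div_eq_mul_inv]; linarith
  filter_upwards [hlim.eventually_le_const hlt, eventually_gt_atTop 0,
    hmtop.eventually_gt_atTop 0] with n h1 hn hmn
  have hn' : (0 : ℝ) < n := by exact_mod_cast hn
  have hm' : (0 : ℝ) < m n := by exact_mod_cast hmn
  rw [div_pow, div_mul_div_cancel₀ (by positivity), div_le_iff₀ (by positivity)] at h1
  exact h1

end Asymptotics

section Threshold

variable {U : Type*} [Fintype U] [DecidableEq U] {r : ℕ} [NeZero r] {S : Finset (Sym2 U)}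

/-! ### Below the threshold -/

lemma rpow_neg_pow {n : ℝ} (hn : 0 ≤ n) (c : ℝ) (k : ℕ) : (n ^ (-c)) ^ k = n ^ (-(c * k)) := by
  rw [← Real.rpow_natCast, ← Real.rpow_mul hn]; ring_nf

/-- A power of `p` is compared with a power of `n` through the corresponding `p ^ k`. -/
lemma rpow_neg_le_of_pow {n p a : ℝ} (hn : 0 < n) (hp : 0 ≤ p) {k : ℕ} (hk : k ≠ 0)
    (h : n ^ (-(a * k)) ≤ p ^ k) : n ^ (-a) ≤ p := by
  rw [← rpow_neg_pow hn.le] at h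
  exact le_of_pow_le_pow_left₀ hk hp h

lemma le_rpow_neg_of_pow {n p a : ℝ} (hn : 0 < n) {k : ℕ} (hk : k ≠ 0)
    (h : p ^ k ≤ n ^ (-(a * k))) : p ≤ n ^ (-a) := by
  rw [← rpow_neg_pow hn.le] at h
  exact le_of_pow_le_pow_left₀ hk (Real.rpow_nonneg hn.le _) h

/-- Constants for which the expected number of missing copies stays below the threshold. -/
lemma exists_threshold_constants {G y c₀ : ℝ} (hG : 0 < G) (hy : 0 ≤ y) (hc₀ : 0 ≤ c₀)
    (h : y * c₀ < G) : ∃ κ σ δ : ℝ, 0 < κ ∧ κ ≤ 1 / 2 ∧ 0 < σ ∧ 0 < δ ∧ 0 < G - δ ∧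
      y * (c₀ + 2 * σ) ≤ (1 - κ) ^ 2 * (1 - κ) * (G - δ) := by
  set g := G - y * c₀ with hg
  have hg0 : 0 < g := by linarith
  have hgG : g ≤ G := by nlinarith [mul_nonneg hy hc₀]
  refine ⟨min (1 / 2) (g / (12 * G)), g / (8 * (y + 1)), g / 4, by positivity, min_le_left _ _,
    by positivity, by positivity, by linarith, ?_⟩
  set κ := min (1 / 2) (g / (12 * G))
  have hκ1 : κ ≤ 1 / 2 := min_le_left _ _
  have hκ2 : κ ≤ g / (12 * G) := min_le_right _ _
  have hκ0 : 0 < κ := by positivity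
  rw [le_div_iff₀ (by positivity)] at hκ2
  have h1 : 1 - 3 * κ ≤ (1 - κ) ^ 2 * (1 - κ) := by nlinarith [sq_nonneg κ]
  have h2 : (1 - 3 * κ) * (G - g / 4) ≤ (1 - κ) ^ 2 * (1 - κ) * (G - g / 4) :=
    mul_le_mul_of_nonneg_right h1 (by linarith)
  have h3 : y * (2 * (g / (8 * (y + 1)))) ≤ g / 4 := by
    have : y * (2 * (g / (8 * (y + 1)))) = g / 4 * (y / (y + 1)) := by field_simp; ring
    rw [this]
    have : y / (y + 1) ≤ 1 := (div_le_one (by positivity)).2 (by linarith)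
    nlinarith
  nlinarith [mul_pos hκ0 hg0]

variable {μ ϖ y : ℝ}

set_option maxHeartbeats 1000000 in
/-- Below the threshold, and if copies are not too rare, the random graph is unlikely to be
saturated. -/
lemma eventually_pr_isSaturated_le (hr : 2 ≤ r) (hS : 2 ≤ #S) (hu : 3 ≤ Fintype.card U)
    (hμ : μ * (#S - 1 : ℕ) = (Fintype.card U - 2 : ℕ)) (hμ1 : μ < 1)
    (hv1 : ∀ J ⊆ S, #J = 1 → #(verts J) = 2) (hvS : #(verts S) = Fintype.card U)
    (hbal : ∀ J ⊆ S, 2 ≤ #J → #J < #S → μ * (#J - 1 : ℕ) + 2 < #(verts J)) (cop : ℕ → ℕ)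
    (hcop : Tendsto (fun m ↦ (cop m : ℝ) / (m : ℝ) ^ (Fintype.card U - 2)) atTop (𝓝 ϖ))
    (hϖ : 0 ≤ ϖ)
    (hcopφ : ∀ (n m : ℕ) (φ : Fin n → Fin r), (∀ i, #(cls φ i) ≤ m) → ∀ e ∈ inside φ,
      #{C ∈ copies (Fin n) S | e ∈ C ∧ C.erase e ⊆ cross φ} ≤ cop m) (hy : 0 ≤ y)
    (hyG : y * (ϖ / (r : ℝ) ^ (Fintype.card U - 2)) < 2 - μ) :
    ∃ c : ℝ, 0 < c ∧ ∃ C : ℝ, ∀ᶠ n : ℕ in atTop, ∀ p : ℝ, 0 < p → p ≤ 1 →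
      (n : ℝ) ^ (-c) ≤ (n : ℝ) ^ (Fintype.card U - 2) * p ^ (#S - 1) →
      (n : ℝ) ^ (Fintype.card U - 2) * p ^ (#S - 1) ≤ y * Real.log n →
      pr p {E : Finset (Sym2 (Fin n)) | IsSaturated S r E} ≤ C * (n : ℝ) ^ (-c) := by
  set h := #S with hh
  set u := Fintype.card U with hud
  have hr0 : (0 : ℝ) < r := by exact_mod_cast (by omega : 0 < r)
  have hk0 : h - 1 ≠ 0 := by omega
  have hk1 : (1 : ℝ) ≤ (h - 1 : ℕ) := by exact_mod_cast (by omega : 1 ≤ h - 1)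
  have hu2 : (1 : ℝ) ≤ (u - 2 : ℕ) := by exact_mod_cast (by omega : 1 ≤ u - 2)
  have hμ0 : 0 < μ := by
    by_contra! hcon
    nlinarith
  obtain ⟨κ, σ, δ, hκ0, hκ1, hσ0, hδ0, hlam0, hconst⟩ := exists_threshold_constants
    (by linarith : 0 < 2 - μ) hy (by positivity : 0 ≤ ϖ / (r : ℝ) ^ (u - 2)) hyG
  set lam := 2 - μ - δ with hlam
  obtain ⟨g, hg0, hg⟩ := exists_pos_forall_le ({J ∈ S.powerset | 2 ≤ #J ∧ #J < h})
    (fun J ↦ (#(verts J) : ℝ) - 2 - μ * (#J - 1 : ℕ)) (by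
      intro J hJ
      simp only [mem_filter, mem_powerset] at hJ
      linarith [hbal J hJ.1 hJ.2.1 hJ.2.2])
  -- The exponent of `w = n ^ (-c)` is small compared with all gaps between exponents.
  obtain ⟨c, hc0, hc1, hc2, hc3, hc4⟩ : ∃ c : ℝ, 0 < c ∧ 81 * c ≤ 1 - μ ∧ 33 * c ≤ μ ∧
      10 * c ≤ δ ∧ (4 + h) * c ≤ g := by
    refine ⟨min (min ((1 - μ) / 81) (μ / 33)) (min (δ / 10) (g / (4 + h))), ?_, ?_, ?_, ?_, ?_⟩
    · have : 0 < 1 - μ := by linarith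
      positivity
    · have := (min_le_left (min ((1 - μ) / 81) (μ / 33)) (min (δ / 10) (g / (4 + h)))).trans
        (min_le_left _ _)
      linarith
    · have := (min_le_left (min ((1 - μ) / 81) (μ / 33)) (min (δ / 10) (g / (4 + h)))).trans
        (min_le_right _ _)
      linarith
    · have := (min_le_right (min ((1 - μ) / 81) (μ / 33)) (min (δ / 10) (g / (4 + h)))).trans
        (min_le_left _ _)
      linarith
    · have := (min_le_right (min ((1 - μ) / 81) (μ / 33)) (min (δ / 10) (g / (4 + h)))).trans
        (min_le_right _ _)
      rw [le_div_iff₀ (by positivity)] at this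
      linarith
  set A : ℝ := (u : ℝ) ^ u * 2 ^ h with hA
  set τ := σ / (8 * r) with hτ
  have hτ0 : 0 < τ := by positivity
  refine ⟨c, hc0, (55 + 2 * A + h ^ 2 * A / τ ^ 2) + 1 / (κ / (16 * r)), ?_⟩
  have ev1 := eventually_mul_rpow_neg_le (by linarith : 0 < 2 * c)
    (4 * (Real.log (4 * r ^ 2) + 1)) one_pos
  have ev2 := eventually_mul_rpow_neg_le hc0 (2 ^ 18 * r ^ 4 : ℝ) one_pos
  have ev3 := eventually_mul_rpow_neg_le hc0 (2 * (h ^ 2 * A) * (Real.log r + 1))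
    (pow_pos hτ0 2)
  have ev4 := eventually_mul_rpow_neg_le hc0 (16 * r * (6 * h + 1 + h ^ 2) : ℝ) hκ0
  have ev5 := eventually_mul_log_le hc0 y
  have ev6 := eventually_count_le (r := r) cop hcop hc0 hσ0
  filter_upwards [ev1, ev2, ev3, ev4, ev5, ev6, eventually_ge_atTop (2 * r),
    eventually_ge_atTop 3] with n e1 e2 e3 e4 e5 e6 hn2 hn3 p hp0 hp1 hx1 hx2
  have hn3' : (3 : ℝ) ≤ n := by exact_mod_cast hn3
  have hn0 : (0 : ℝ) < n := by linarith
  have hn1 : (1 : ℝ) ≤ n := by linarith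
  have hlog : 0 < Real.log n := Real.log_pos (by linarith)
  set w := (n : ℝ) ^ (-c) with hw
  have hw0 : 0 < w := Real.rpow_pos_of_pos hn0 _
  have hw1 : w ≤ 1 := Real.rpow_le_one_of_one_le_of_nonpos hn1 (by linarith)
  have hwpow : ∀ k : ℕ, w ^ k = (n : ℝ) ^ (-(c * k)) := rpow_neg_pow hn0.le c
  have hmono : ∀ {a b : ℝ}, a ≤ b → (n : ℝ) ^ a ≤ (n : ℝ) ^ b := fun hab ↦
    Real.rpow_le_rpow_of_exponent_le hn1 hab
  have hcast : ∀ k : ℕ, (n : ℝ) ^ k = (n : ℝ) ^ (k : ℝ) := fun k ↦ (Real.rpow_natCast _ _).symm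
  -- The bounds on `p` as powers of `n`.
  have hpk1 : (n : ℝ) ^ (-c - (u - 2 : ℕ)) ≤ p ^ (h - 1) := by
    rw [Real.rpow_sub hn0, ← hcast, div_le_iff₀ (by positivity)]
    linarith
  have hpk2 : p ^ (h - 1) ≤ (n : ℝ) ^ (c - (u - 2 : ℕ)) := by
    rw [Real.rpow_sub hn0, ← hcast, le_div_iff₀ (by positivity)]
    linarith
  have hpl : (n : ℝ) ^ (-(μ + c)) ≤ p := by
    refine rpow_neg_le_of_pow hn0 hp0.le hk0 (le_trans (hmono ?_) hpk1)
    rw [add_mul, hμ]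
    linarith only [le_mul_of_one_le_right hc0.le hk1]
  have hpu : p ≤ (n : ℝ) ^ (-(μ - c)) := by
    refine le_rpow_neg_of_pow hn0 hk0 (hpk2.trans (hmono ?_))
    rw [sub_mul, hμ]
    linarith only [le_mul_of_one_le_right hc0.le hk1]
  have hp32 : p ≤ w ^ 32 := by
    rw [hwpow]
    refine hpu.trans (hmono ?_)
    push_cast; linarith
  have hpκ : p ≤ κ := by
    have h16 : w ≤ κ := by
      refine le_trans ?_ e4
      refine le_mul_of_one_le_left hw0.le ?_
      have : (1 : ℝ) ≤ r := by exact_mod_cast (by omega : 1 ≤ r)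
      have h2 : (0 : ℝ) ≤ h := Nat.cast_nonneg _
      have h3 : (1 : ℝ) ≤ 6 * h + 1 + h ^ 2 := by linarith only [h2, sq_nonneg (h : ℝ)]
      exact one_le_mul_of_one_le_of_one_le (by linarith only [this]) h3
    exact hp32.trans ((pow_le_of_le_one hw0.le hw1 (by norm_num)).trans h16)
  have hnpw : 1 ≤ p * n * w ^ 80 := by
    rw [hwpow]
    calc (1 : ℝ) = (n : ℝ) ^ (0 : ℝ) := (Real.rpow_zero _).symm
      _ ≤ (n : ℝ) ^ (-(μ + c) + 1 + -(c * (80 : ℕ))) := hmono (by push_cast; linarith)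
      _ = (n : ℝ) ^ (-(μ + c)) * n * (n : ℝ) ^ (-(c * (80 : ℕ))) := by
          rw [Real.rpow_add hn0, Real.rpow_add hn0, Real.rpow_one]
      _ ≤ _ := by gcongr
  have hsplit : (n : ℝ) ^ u * p ^ h = p * n ^ 2 * ((n : ℝ) ^ (u - 2) * p ^ (h - 1)) := by
    have a : (n : ℝ) ^ u = n ^ 2 * n ^ (u - 2) := by rw [← pow_add]; congr 1; omega
    have b : p ^ h = p * p ^ (h - 1) := by rw [← pow_succ']; congr 1; omega
    rw [a, b]; ring
  have hPn : 0 < p * (n : ℝ) ^ 2 := by positivity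
  have hJ2 : ∀ J ⊆ S, 2 ≤ #J → #J < h → p * (n : ℝ) ^ 2 / w ^ 4 ≤ n ^ #(verts J) * p ^ #J := by
    intro J hJ hJ1 hJ2
    have hgJ := hg J (by simp [hJ, hJ1, hJ2])
    rw [div_le_iff₀ (by positivity)]
    have b : p ^ #J = p * p ^ (#J - 1) := by rw [← pow_succ']; congr 1; omega
    have hpJ : (n : ℝ) ^ (-((μ + c) * (#J - 1 : ℕ))) ≤ p ^ (#J - 1) := by
      rw [← rpow_neg_pow hn0.le]
      exact pow_le_pow_left₀ (Real.rpow_nonneg hn0.le _) hpl _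
    have hJh : ((#J - 1 : ℕ) : ℝ) ≤ h := by exact_mod_cast (by omega : #J - 1 ≤ h)
    have hexp : (2 : ℝ) ≤ #(verts J) + -((μ + c) * (#J - 1 : ℕ)) + -(c * (4 : ℕ)) := by
      push_cast
      linarith only [mul_le_mul_of_nonneg_left hJh hc0.le, hgJ, hc4]
    have : (n : ℝ) ^ 2 ≤ n ^ #(verts J) * p ^ (#J - 1) * w ^ 4 := by
      calc (n : ℝ) ^ 2 = (n : ℝ) ^ (2 : ℝ) := by rw [hcast]; norm_num
        _ ≤ (n : ℝ) ^ (#(verts J) + -((μ + c) * (#J - 1 : ℕ)) + -(c * (4 : ℕ))) := hmono hexp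
        _ = n ^ #(verts J) * (n : ℝ) ^ (-((μ + c) * (#J - 1 : ℕ))) * w ^ 4 := by
            rw [Real.rpow_add hn0, Real.rpow_add hn0, ← hcast, hwpow]
        _ ≤ _ := by gcongr
    rw [b]
    calc p * (n : ℝ) ^ 2 ≤ p * (n ^ #(verts J) * p ^ (#J - 1) * w ^ 4) := by gcongr
      _ = _ := by ring
  have hJ1 : ∀ J ⊆ S, J.Nonempty → #J < h → p * (n : ℝ) ^ 2 ≤ n ^ #(verts J) * p ^ #J := by
    intro J hJ hne hlt
    have hpos := hne.card_pos
    rcases (by omega : #J = 1 ∨ 2 ≤ #J) with h1 | h2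
    · rw [hv1 J hJ h1, h1, pow_one, mul_comm]
    · refine le_trans ?_ (hJ2 J hJ h2 hlt)
      rw [le_div_iff₀ (by positivity)]
      exact mul_le_of_le_one_right hPn.le (pow_le_one₀ hw0.le hw1)
  have hJ0 : ∀ J ⊆ S, J.Nonempty → p * (n : ℝ) ^ 2 * w ≤ n ^ #(verts J) * p ^ #J := by
    intro J hJ hne
    by_cases hlt : #J < h
    · exact (mul_le_of_le_one_right hPn.le hw1).trans (hJ1 J hJ hne hlt)
    · have : J = S := eq_of_subset_of_card_le hJ (not_lt.1 hlt)
      rw [this, hvS, ← hh, hsplit]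
      gcongr
  have hX : (n : ℝ) ^ u * p ^ h * w ≤ p * n ^ 2 := by
    rw [hsplit, mul_assoc]
    refine mul_le_of_le_one_right hPn.le ?_
    calc _ ≤ (n : ℝ) ^ c * (n : ℝ) ^ (-c) := by
          have := hx2.trans e5
          gcongr
      _ = 1 := by rw [← Real.rpow_add hn0, add_neg_cancel, Real.rpow_zero]
  set N : ℝ := (cop ⌊(n : ℝ) / r + 3 * n * w ^ 19⌋₊ : ℝ) with hN
  have hN1 : ∀ φ : Fin n → Fin r, (∀ i, (#(cls φ i) : ℝ) ≤ n / r + 3 * n * w ^ 19) →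
      ∀ e ∈ inside φ,
        (#{C ∈ copies (Fin n) S | e ∈ C ∧ C.erase e ⊆ cross φ} : ℝ) ≤ N := by
    intro φ hφ e he
    rw [hN]
    exact_mod_cast hcopφ n _ φ (fun i ↦ Nat.le_floor (hφ i)) e he
  have hmain : p ^ (h - 1) * (N + 8 * r * τ * (n : ℝ) ^ (u - 2)) ≤
      (1 - κ) ^ 2 * (1 - p) * (lam * Real.log n) := by
    have hτσ : 8 * r * τ = σ := by rw [hτ]; field_simp
    rw [hτσ]
    have h1κ : 0 ≤ 1 - κ := by linarith
    calc _ ≤ p ^ (h - 1) * ((ϖ / (r : ℝ) ^ (u - 2) + σ) * (n : ℝ) ^ (u - 2) +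
          σ * (n : ℝ) ^ (u - 2)) := by gcongr
      _ = (n : ℝ) ^ (u - 2) * p ^ (h - 1) * (ϖ / (r : ℝ) ^ (u - 2) + 2 * σ) := by ring
      _ ≤ y * Real.log n * (ϖ / (r : ℝ) ^ (u - 2) + 2 * σ) := by gcongr
      _ = y * (ϖ / (r : ℝ) ^ (u - 2) + 2 * σ) * Real.log n := by ring
      _ ≤ (1 - κ) ^ 2 * (1 - κ) * lam * Real.log n := by gcongr
      _ ≤ (1 - κ) ^ 2 * (1 - p) * lam * Real.log n := by gcongr
      _ = _ := by ring
  have hp1' : p < 1 := by linarith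
  have key := pr_isSaturated_le (V := Fin n) (S := S) (r := r) (A := A) (τ := τ) (κ := κ) (N := N)
    (Λ := lam * Real.log n) (w := w) (n := n) hr hp0 hp1' (by simp) hn1 (by exact_mod_cast hn2) hw0
    (by rw [hwpow]; push_cast; rw [mul_comm c 2]; exact e1) e2 hnpw hp32 rfl hS hJ0 hJ1 hJ2 hX hτ0
    e3 (by omega) hκ0 hκ1 e4 (by positivity) hN1 (Nat.cast_nonneg _) hmain
  refine key.trans ((add_le_add le_rfl ?_).trans_eq (add_mul _ _ _).symm)
  have e : 1 / (κ / (16 * r)) * w * (κ / (16 * r) * (p * (n : ℝ) ^ 2)) = w * (p * n ^ 2) := by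
    field_simp
  rw [div_le_iff₀ (by positivity), e]
  have hinv : (1 / w) ^ 8 = (n : ℝ) ^ (c * 8) := by
    rw [one_div, inv_pow, hwpow, Real.rpow_neg hn0.le, inv_inv]; norm_num
  have hexpΛ : Real.exp (lam * Real.log n) = (n : ℝ) ^ lam := by
    rw [Real.rpow_def_of_pos hn0, mul_comm]
  rw [hinv, hexpΛ, ← Real.rpow_add hn0]
  calc (n : ℝ) ^ (c * 8 + lam) ≤ (n : ℝ) ^ (-c + (-(μ + c) + 2)) := hmono (by rw [hlam]; linarith)
    _ = w * ((n : ℝ) ^ (-(μ + c)) * n ^ 2) := by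
        rw [Real.rpow_add hn0, Real.rpow_add hn0, hcast 2]; norm_num
        exact Or.inl rfl
    _ ≤ w * (p * n ^ 2) := by gcongr

end Threshold

section Limit

variable {U : Type*} [Fintype U] [DecidableEq U] {r : ℕ} [NeZero r] {S : Finset (Sym2 U)}
  {μ ϖ y : ℝ}

/-- Below the threshold, the random graph is unlikely to be saturated. -/
theorem tendsto_pr_isSaturated (hr : 2 ≤ r) (hS : 2 ≤ #S) (hu : 3 ≤ Fintype.card U)
    (hμ : μ * (#S - 1 : ℕ) = (Fintype.card U - 2 : ℕ)) (hμ1 : μ < 1)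
    (hv1 : ∀ J ⊆ S, #J = 1 → #(verts J) = 2) (hvS : #(verts S) = Fintype.card U)
    (hbal : ∀ J ⊆ S, 2 ≤ #J → #J < #S → μ * (#J - 1 : ℕ) + 2 < #(verts J)) (cop : ℕ → ℕ)
    (hcop : Tendsto (fun m ↦ (cop m : ℝ) / (m : ℝ) ^ (Fintype.card U - 2)) atTop (𝓝 ϖ))
    (hϖ : 0 ≤ ϖ)
    (hcopφ : ∀ (n m : ℕ) (φ : Fin n → Fin r), (∀ i, #(cls φ i) ≤ m) → ∀ e ∈ inside φ,
      #{C ∈ copies (Fin n) S | e ∈ C ∧ C.erase e ⊆ cross φ} ≤ cop m) (hy : 0 ≤ y)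
    (hyG : y * (ϖ / (r : ℝ) ^ (Fintype.card U - 2)) < 2 - μ) (p : ℕ → ℝ) (h0 : ∀ n, 0 ≤ p n)
    (h1 : ∀ n, p n ≤ 1) (hpn : Tendsto (fun n ↦ p n * n) atTop atTop)
    (hx : ∀ᶠ n : ℕ in atTop,
      (n : ℝ) ^ (Fintype.card U - 2) * p n ^ (#S - 1) ≤ y * Real.log n) :
    Tendsto (fun n ↦ pr (p n) {E : Finset (Sym2 (Fin n)) | IsSaturated S r E}) atTop (𝓝 0) := by
  obtain ⟨c, hc, C, hC⟩ := eventually_pr_isSaturated_le hr hS hu hμ hμ1 hv1 hvS hbal cop hcop hϖ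
    hcopφ hy hyG
  -- In the sparse range `p * n` may tend to infinity arbitrarily slowly, so that the error
  -- parameter has to be a power of it rather than of `n`. The exponent makes `p * n * w ^ 80`
  -- equal to one.
  set w : ℕ → ℝ := fun n ↦ (p n * n) ^ (-(1 / 80 : ℝ)) with hw
  have hwlim : Tendsto w atTop (𝓝 0) := (tendsto_rpow_neg_atTop (by norm_num)).comp hpn
  have ev1 : ∀ᶠ n in atTop, 4 * (Real.log (4 * r ^ 2) + 1) * w n ^ 2 ≤ 1 := by
    have := (hwlim.pow 2).const_mul (4 * (Real.log (4 * r ^ 2) + 1))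
    rw [zero_pow two_ne_zero, mul_zero] at this
    exact this.eventually_le_const one_pos
  have ev2 : ∀ᶠ n in atTop, 16 * r * w n ≤ 1 := by
    have := hwlim.const_mul (16 * r : ℝ)
    rw [mul_zero] at this
    exact this.eventually_le_const one_pos
  have hbound : Tendsto (fun n : ℕ ↦ 8 * Real.exp (-(n : ℝ)) + 8 * r * (n : ℝ) ^ (-c) +
      |C| * (n : ℝ) ^ (-c)) atTop (𝓝 0) := by
    have a := (Real.tendsto_exp_neg_atTop_nhds_zero.comp
      (tendsto_natCast_atTop_atTop (R := ℝ))).const_mul 8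
    have b := (tendsto_natCast_rpow_neg hc).const_mul (8 * r : ℝ)
    have d := (tendsto_natCast_rpow_neg hc).const_mul |C|
    simpa using (a.add b).add d
  refine squeeze_zero' (Eventually.of_forall fun n ↦ pr_nonneg (h0 n) (h1 n) _) ?_ hbound
  filter_upwards [ev1, ev2, hC, hx, eventually_ge_atTop (2 * r), eventually_ge_atTop 1,
    hpn.eventually_gt_atTop 0] with n e1 e2 e3 e4 hn2 hn1 hpos
  have hn0 : (0 : ℝ) < n := by exact_mod_cast hn1
  have hp0 : 0 < p n := pos_of_mul_pos_left hpos hn0.le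
  have hnc : 0 ≤ (n : ℝ) ^ (-c) := Real.rpow_nonneg hn0.le _
  -- Switching applies if copies are not much rarer than edges, and counting applies otherwise.
  rcases le_or_gt ((n : ℝ) ^ (-c)) ((n : ℝ) ^ (Fintype.card U - 2) * p n ^ (#S - 1)) with h | h
  · refine (e3 (p n) hp0 (h1 n) h e4).trans ?_
    have : C * (n : ℝ) ^ (-c) ≤ |C| * (n : ℝ) ^ (-c) := by gcongr; exact le_abs_self C
    have h2 : 0 ≤ 8 * Real.exp (-(n : ℝ)) + 8 * r * (n : ℝ) ^ (-c) := by positivity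
    linarith
  · have hw0 : 0 < w n := Real.rpow_pos_of_pos hpos _
    have hpw : 1 ≤ p n * n * w n ^ 80 := by
      rw [hw]
      simp only
      rw [← Real.rpow_natCast, ← Real.rpow_mul hpos.le]
      norm_num
      rw [Real.rpow_neg_one, mul_inv_cancel₀ hpos.ne']
    have key := pr_isSaturated_le_of_sparse (V := Fin n) (S := S) hp0 (h1 n) (by simp)
      (by exact_mod_cast hn1) (by exact_mod_cast hn2) hw0 e1 e2 hpw
    refine key.trans ?_
    have hsplit : (n : ℝ) ^ Fintype.card U * p n ^ #S / (p n * n ^ 2) =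
        (n : ℝ) ^ (Fintype.card U - 2) * p n ^ (#S - 1) := by
      have a : (n : ℝ) ^ Fintype.card U = n ^ 2 * n ^ (Fintype.card U - 2) := by
        rw [← pow_add]; congr 1; omega
      have b : p n ^ #S = p n * p n ^ (#S - 1) := by rw [← pow_succ']; congr 1; omega
      rw [a, b]; field_simp
    rw [hsplit]
    have : 8 * (r : ℝ) * ((n : ℝ) ^ (Fintype.card U - 2) * p n ^ (#S - 1)) ≤
      8 * r * (n : ℝ) ^ (-c) := by gcongr
    have h2 : 0 ≤ |C| * (n : ℝ) ^ (-c) := by positivity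
    linarith

end Limit

section Graph

variable {U V : Type*} [Fintype U] [DecidableEq U] [Fintype V] [DecidableEq V]
  {r : ℕ} [NeZero r] {S : Finset (Sym2 U)} {H : SimpleGraph U}

/-! ### Largest free subgraphs and saturation -/

/-- The graph with edge set `E`; loops in `E` are ignored. -/
abbrev graphOf (E : Finset (Sym2 V)) : SimpleGraph V := SimpleGraph.fromEdgeSet (E : Set (Sym2 V))

/-- An injection is a homomorphism from `H` to `G` if and only if the image of the edges of `H`
consists of edges of `G`. -/
lemma sym2Map_mem_edgeSet {G : SimpleGraph V} (f : U ↪ V) (hS : (S : Set (Sym2 U)) = H.edgeSet) :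
    (∀ a b, H.Adj a b → G.Adj (f a) (f b)) ↔ (img S f : Set (Sym2 V)) ⊆ G.edgeSet := by
  have hS' : ∀ e, e ∈ S ↔ e ∈ H.edgeSet := fun e ↦ by rw [← hS, mem_coe]
  constructor
  · intro h e he
    simp only [img, coe_map, Set.mem_image, mem_coe] at he
    obtain ⟨d, hd, rfl⟩ := he
    induction d with | _ a b
    rw [hS', SimpleGraph.mem_edgeSet] at hd
    simpa using h a b hd
  · intro h a b hab
    have : f.sym2Map s(a, b) ∈ G.edgeSet :=
      h (mem_coe.2 (mem_map_of_mem _ ((hS' _).2 hab)))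
    simpa using this

/-- A graph contains `H` if and only if it contains the edge set of a copy. -/
lemma not_free_iff {G : SimpleGraph V} (hS : (S : Set (Sym2 U)) = H.edgeSet) :
    ¬ H.Free G ↔ ∃ C ∈ copies V S, (C : Set (Sym2 V)) ⊆ G.edgeSet := by
  rw [SimpleGraph.Free, not_not]
  constructor
  · rintro ⟨f⟩
    refine ⟨img S f.toEmbedding, mem_image_of_mem _ (mem_univ _), ?_⟩
    rw [← sym2Map_mem_edgeSet f.toEmbedding hS]
    exact fun a b hab ↦ f.toHom.map_adj hab
  · rintro ⟨C, hC, hCG⟩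
    obtain ⟨f, -, rfl⟩ := mem_image.1 hC
    rw [← sym2Map_mem_edgeSet f hS] at hCG
    exact ⟨⟨⟨f, fun {a b} h ↦ hCG a b h⟩, f.injective⟩⟩

lemma colorable_of_subset_cross {G : SimpleGraph V} {φ : V → Fin r}
    (h : G.edgeSet ⊆ cross φ) : G.Colorable r :=
  ⟨SimpleGraph.Coloring.mk φ fun hab ↦ mk_mem_cross.1 (h hab)⟩

lemma exists_isLargestFreeSubgraph (G : SimpleGraph V) (hH : H ≠ ⊥) :
    ∃ F, SimpleGraph.IsLargestFreeSubgraph F G H := by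
  have hne : {F : SimpleGraph V | F ≤ G ∧ H.Free F}.Nonempty := by
    refine ⟨⊥, bot_le, fun ⟨f⟩ ↦ hH ?_⟩
    ext a b
    simpa using fun hab ↦ f.toHom.map_adj hab
  obtain ⟨F, hF, hmax⟩ := Set.exists_max_image {F : SimpleGraph V | F ≤ G ∧ H.Free F}
    (fun F ↦ F.edgeSet.ncard) (Set.toFinite _) hne
  exact ⟨F, hF.1, hF.2, fun F' h1 h2 ↦ hmax F' ⟨h1, h2⟩⟩

/-- If every largest `H`-free subgraph is `r`-partite, then its size is that of a maximum cut, so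
that adding an edge inside a part to a maximum cut creates a copy of `H`. -/
lemma isSaturated_of_isSimonovits (hS : (S : Set (Sym2 U)) = H.edgeSet)
    (hr : H.chromaticPred = r) (hcol : ¬ H.Colorable r) (E : Finset (Sym2 V))
    (hE : (graphOf E).IsSimonovits H) : IsSaturated S r E := by
  intro e he
  by_contra hcon
  rw [not_nonempty_iff_eq_empty] at hcon
  set φ := maxCut r E
  have heE : e ∈ E := (mem_inter.1 he).1
  have hei : e ∈ inside φ := (mem_inter.1 he).2
  have hediag : ¬ e.IsDiag := by
    simp only [inside, mem_filter] at hei; exact hei.2.1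
  have hecross := notMem_cross_of_mem_inner he
  have hcd : ∀ f ∈ cross φ, ¬ f.IsDiag := by
    rintro ⟨a, b⟩ h hab
    exact mk_mem_cross.1 h (congrArg φ (Sym2.mk_isDiag_iff.1 hab))
  have hedge : ∀ X : Finset (Sym2 V), (∀ f ∈ X, ¬ f.IsDiag) →
      (graphOf X).edgeSet = X := by
    intro X hX
    rw [SimpleGraph.edgeSet_fromEdgeSet, sdiff_eq_left, Set.disjoint_left]
    exact fun f hf hd ↦ hX f hf (by simpa using hd)
  -- If `e` closes no copy, then the maximum cut and `e` form an `H`-free subgraph that is larger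
  -- than any `r`-partite subgraph.
  set X : Finset (Sym2 V) := insert e (E ∩ cross φ) with hX
  have hXd : ∀ f ∈ X, ¬ f.IsDiag := by
    intro f hf
    rcases mem_insert.1 hf with rfl | hf
    · exact hediag
    · exact hcd f (mem_inter.1 hf).2
  have hfree : H.Free (graphOf X) := by
    by_contra hnf
    replace hnf := (not_free_iff hS).1 (not_not.2 hnf)
    obtain ⟨C, hC, hCX⟩ := hnf
    rw [hedge X hXd, Finset.coe_subset] at hCX
    by_cases heC : e ∈ C
    · have : C ∈ closers S r E e := mem_closers.2 ⟨hC, heC, fun f hf ↦ by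
        obtain ⟨h1, h2⟩ := mem_erase.1 hf
        exact (mem_insert.1 (hCX h2)).resolve_left h1⟩
      rw [hcon] at this
      exact notMem_empty _ this
    · have hC2 : C ⊆ E ∩ cross φ := fun f hf ↦
        (mem_insert.1 (hCX hf)).resolve_left fun h ↦ heC (h ▸ hf)
      obtain ⟨f, -, rfl⟩ := mem_image.1 hC
      have h2 : (img S f : Set (Sym2 V)) ⊆
          (graphOf (E ∩ cross φ)).edgeSet := by
        rw [hedge _ fun g hg ↦ hcd g (mem_inter.1 hg).2, Finset.coe_subset]
        exact hC2
      rw [← sym2Map_mem_edgeSet f hS] at h2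
      refine hcol (SimpleGraph.Colorable.of_hom
        (G' := graphOf (E ∩ cross φ))
        ⟨f, fun {a b} h ↦ h2 a b h⟩ (colorable_of_subset_cross (φ := φ) ?_))
      rw [hedge _ fun g hg ↦ hcd g (mem_inter.1 hg).2, Finset.coe_subset]
      exact inter_subset_right
  have hle : graphOf X ≤ graphOf E :=
    SimpleGraph.fromEdgeSet_mono (Finset.coe_subset.2 (insert_subset heE inter_subset_left))
  have hbot : H ≠ ⊥ := by
    rintro rfl
    exact hcol ⟨SimpleGraph.Coloring.mk (fun _ ↦ 0) fun h ↦ absurd h (by simp)⟩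
  obtain ⟨F, hF⟩ := exists_isLargestFreeSubgraph (graphOf E) hbot
  have hFcol := hE F hF
  rw [hr] at hFcol
  obtain ⟨ψ⟩ := hFcol
  have h1 : F.edgeSet ⊆ (E ∩ cross (ψ : V → Fin r) : Finset (Sym2 V)) := by
    intro f hf
    induction f with | _ a b
    have hadj : F.Adj a b := hf
    have h2 := hF.1 hadj
    rw [SimpleGraph.fromEdgeSet_adj] at h2
    exact mem_coe.2 (mem_inter.2 ⟨mem_coe.1 h2.1, mk_mem_cross.2 (ψ.valid hadj)⟩)
  have h2 : F.edgeSet.ncard ≤ #(E ∩ cross (ψ : V → Fin r)) := by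
    rw [← Set.ncard_coe_finset]
    exact Set.ncard_le_ncard h1 (Set.toFinite _)
  have h3 := card_inter_cross_le E (ψ : V → Fin r)
  have h4 := hF.2.2 _ hle hfree
  rw [hedge X hXd, Set.ncard_coe_finset, hX, card_insert_of_notMem
    fun h ↦ hecross (mem_inter.1 h).2] at h4
  omega

/-! ### The binomial random graph -/

/-- The random subset of `Sym2 V` also contains random loops, which `graphOf` ignores: summing over
all sets of loops gives the probability of `G` in the binomial model. -/
lemma sum_wt_fromEdgeSet (p : ℝ) (G : SimpleGraph V) [DecidableRel G.Adj]
    [DecidablePred fun E : Finset (Sym2 V) ↦ graphOf E = G] :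
    ∑ E with graphOf E = G, wt p E =
      p ^ #G.edgeFinset * (1 - p) ^ ((Fintype.card V).choose 2 - #G.edgeFinset) := by
  set X := G.edgeFinset
  set D : Finset (Sym2 V) := {e | e.IsDiag} with hD
  have hXD : ∀ e ∈ X, e ∉ D := fun e he hd ↦ by
    rw [hD, mem_filter] at hd
    exact G.not_isDiag_of_mem_edgeSet (SimpleGraph.mem_edgeFinset.1 he) hd.2
  have hfib : ({E | graphOf E = G} : Finset (Finset (Sym2 V))) = D.powerset.image fun L ↦ X ∪ L := by
    ext E
    simp only [mem_filter, mem_univ, true_and, mem_image, mem_powerset]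
    constructor
    · rintro rfl
      refine ⟨E ∩ D, inter_subset_right, ?_⟩
      ext e
      simp only [X, hD, mem_union, SimpleGraph.mem_edgeFinset, SimpleGraph.edgeSet_fromEdgeSet,
        mem_inter, mem_filter, mem_univ, true_and, Set.mem_sdiff, mem_coe, Sym2.mem_diagSet]
      tauto
    · rintro ⟨L, hL, rfl⟩
      ext a b
      rw [SimpleGraph.fromEdgeSet_adj, mem_coe, mem_union, SimpleGraph.mem_edgeFinset,
        SimpleGraph.mem_edgeSet]
      constructor
      · rintro ⟨h | h, hne⟩
        · exact h
        · have := hL h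
          rw [hD, mem_filter, Sym2.mk_isDiag_iff] at this
          exact absurd this.2 hne
      · exact fun h ↦ ⟨Or.inl h, h.ne⟩
  have hcardD : #Dᶜ = (Fintype.card V).choose 2 := by
    rw [← Sym2.card_diagSet_compl, Fintype.card_subtype, hD]
    congr 1
    ext e
    simp
  have hX : #X ≤ #Dᶜ := card_le_card fun e he ↦ mem_compl.2 (hXD e he)
  have hinj : Set.InjOn (fun L ↦ X ∪ L) (D.powerset : Set (Finset (Sym2 V))) := by
    intro L hL L' hL' h
    have hd : ∀ M ∈ D.powerset, (X ∪ M) ∩ D = M := by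
      intro M hM
      rw [mem_powerset] at hM
      ext e
      simp only [mem_inter, mem_union]
      constructor
      · rintro ⟨h | h, hd⟩
        · exact absurd hd (hXD e h)
        · exact h
      · exact fun h ↦ ⟨Or.inr h, hM h⟩
    rw [← hd L (mem_coe.1 hL), ← hd L' (mem_coe.1 hL')]
    simp only at h
    rw [h]
  rw [hfib, sum_image hinj]
  have hterm : ∀ L ∈ D.powerset, wt p (X ∪ L) =
      p ^ #X * (1 - p) ^ (#Dᶜ - #X) * (p ^ #L * (1 - p) ^ (#D - #L)) := by
    intro L hL
    rw [mem_powerset] at hL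
    have hd : Disjoint X L := Finset.disjoint_left.2 fun e h h' ↦ hXD e h (hL h')
    have h1 := card_le_card hL
    have h2 := card_add_card_compl D
    have h3 : #(X ∪ L)ᶜ = (#Dᶜ - #X) + (#D - #L) := by
      rw [card_compl, card_union_of_disjoint hd]; omega
    rw [wt, h3, card_union_of_disjoint hd, pow_add, pow_add]; ring
  rw [sum_congr rfl hterm, ← mul_sum, sum_pow_mul_eq_add_pow, ← hcardD]
  simp

open scoped unitInterval in
/-- The graph of a `p`-random subset of `Sym2 V` is a binomial random graph. -/
lemma binomialRandom_apply_eq (p : I) (𝒜 : Set (SimpleGraph V)) :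
    SimpleGraph.binomialRandom V p 𝒜 = ENNReal.ofReal
      (pr (p : ℝ) {E : Finset (Sym2 V) | graphOf E ∈ 𝒜}) := by
  classical
  have h0 : (0 : ℝ) ≤ p := p.2.1
  have h1 : (p : ℝ) ≤ 1 := p.2.2
  have hsing : ∀ G : SimpleGraph V, SimpleGraph.binomialRandom V p {G} = ENNReal.ofReal
      (∑ E with graphOf E = G, wt (p : ℝ) E) := by
    intro G
    rw [SimpleGraph.binomialRandom_singleton, sum_wt_fromEdgeSet, Nat.card_eq_fintype_card,
      ENNReal.ofReal_mul (by positivity), ENNReal.ofReal_pow h0, ENNReal.ofReal_pow (by linarith),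
      ← SimpleGraph.coe_edgeFinset, Set.ncard_coe_finset]
    have e1 : ENNReal.ofReal (p : ℝ) = (unitInterval.toNNReal p : ENNReal) := by
      rw [← unitInterval.coe_toNNReal, ENNReal.ofReal_coe_nnreal]
    have e2 : ENNReal.ofReal (1 - (p : ℝ)) = (unitInterval.toNNReal (σ p) : ENNReal) := by
      rw [← unitInterval.coe_symm_eq, ← unitInterval.coe_toNNReal, ENNReal.ofReal_coe_nnreal]
    rw [e1, e2]
  have : MeasurableSingletonClass (SimpleGraph V) := ⟨fun G ↦ by
    have : ({G} : Set (SimpleGraph V)) = SimpleGraph.edgeSet ⁻¹' {G.edgeSet} := by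
      ext G'; simp
    rw [this]
    exact SimpleGraph.measurable_edgeSet (measurableSet_singleton _)⟩
  have hfin : 𝒜 = ((univ.filter (· ∈ 𝒜) : Finset (SimpleGraph V)) : Set (SimpleGraph V)) := by
    ext; simp
  rw [hfin, ← MeasureTheory.sum_measure_singleton]
  rw [sum_congr rfl fun G _ ↦ hsing G, ← ENNReal.ofReal_sum_of_nonneg
    fun G _ ↦ sum_nonneg fun E _ ↦ wt_nonneg h0 h1 E]
  congr 1
  simp only [sum_filter (fun E ↦ graphOf E = _)]
  rw [sum_comm, pr, ex]
  simp only [sum_ite_eq]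
  refine sum_congr rfl fun E _ ↦ ?_
  by_cases h : graphOf E ∈ 𝒜 <;> simp [h]

end Graph

section Counting

variable {U W : Type*} [Fintype U] [DecidableEq U] [Fintype W] [DecidableEq W]
  {r : ℕ} [NeZero r] {H : SimpleGraph U}

/-! ### Copies in the complete equipartite graph with an additional edge -/

lemma exists_iso_of_toSubgraph_eq {G : SimpleGraph W} {f f₀ : H.Copy G}
    (h : f.toSubgraph = f₀.toSubgraph) : ∃ σ : H ≃g H, ∀ a, f₀ (σ a) = f a := by
  have h1 : ∀ a, ∃ b, f₀ b = f a := by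
    intro a
    have : f a ∈ f.toSubgraph.verts := by simp
    rw [h] at this
    simpa using this
  choose σ hσ using h1
  have hinj : Function.Injective σ := fun a b hab ↦
    f.injective (show f a = f b by rw [← hσ, ← hσ, hab])
  have hadj : ∀ (g : H.Copy G) a b, g.toSubgraph.Adj (g a) (g b) ↔ H.Adj a b := by
    intro g a b
    simp only [SimpleGraph.Copy.toSubgraph, SimpleGraph.Subgraph.map_adj, Relation.map_apply,
      SimpleGraph.Subgraph.top_adj]
    constructor
    · rintro ⟨x, y, hxy, hx, hy⟩
      rwa [← g.injective hx, ← g.injective hy]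
    · exact fun hab ↦ ⟨a, b, hab, rfl, rfl⟩
  refine ⟨⟨Equiv.ofBijective σ (Finite.injective_iff_bijective.1 hinj), fun {a b} ↦ ?_⟩, hσ⟩
  rw [Equiv.ofBijective_apply, Equiv.ofBijective_apply, ← hadj f₀, hσ, hσ, ← h, hadj]

/-- Every copy arises from as many embeddings as `H` has automorphisms. -/
lemma copyCount_mul_card_iso (G : SimpleGraph W) (H : SimpleGraph U) :
    G.copyCount H * Nat.card (H ≃g H) = Nat.card (H.Copy G) := by
  classical
  rw [SimpleGraph.copyCount_eq_card_image_copyToSubgraph, Nat.card_eq_fintype_card (α := H.Copy G),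
    ← card_univ, card_eq_sum_card_image SimpleGraph.Copy.toSubgraph, ← smul_eq_mul, ← sum_const]
  refine sum_congr rfl fun B hB ↦ ?_
  obtain ⟨f₀, -, rfl⟩ := mem_image.1 hB
  rw [← Fintype.card_subtype, ← Nat.card_eq_fintype_card]
  refine Nat.card_congr (Equiv.ofBijective
    (fun σ : H ≃g H ↦ ⟨f₀.comp σ.toCopy, ?_⟩) ⟨?_, ?_⟩)
  · have : (f₀.comp σ.toCopy).toSubgraph = (⊤ : H.Subgraph).map (f₀.toHom.comp σ.toHom) := rfl
    rw [this, SimpleGraph.Subgraph.map_comp]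
    congr 1
    ext a b
    · simp only [SimpleGraph.Subgraph.map_verts, SimpleGraph.Subgraph.verts_top, Set.image_univ,
        Set.mem_univ, iff_true]
      exact σ.surjective a
    · simp only [SimpleGraph.Subgraph.map_adj, Relation.map_apply, SimpleGraph.Subgraph.top_adj]
      constructor
      · rintro ⟨x, y, hxy, rfl, rfl⟩
        exact σ.map_adj_iff.2 hxy
      · intro h
        refine ⟨σ.symm a, σ.symm b, σ.symm.map_adj_iff.2 h, ?_, ?_⟩
        · exact σ.apply_symm_apply a
        · exact σ.apply_symm_apply b
  · intro σ σ' h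
    ext a
    have h2 := congrArg (fun f : H.Copy G ↦ f a) (Subtype.ext_iff.1 h)
    exact f₀.injective h2
  · rintro ⟨f, hf⟩
    obtain ⟨σ, hσ⟩ := exists_iso_of_toSubgraph_eq hf
    refine ⟨σ, Subtype.ext (DFunLike.ext _ _ fun a ↦ hσ a)⟩

lemma equipartitePlus_adj {m : ℕ} {u v : Fin r × Fin m} :
    (SimpleGraph.equipartitePlus r m).Adj u v ↔ u.1 ≠ v.1 ∨ u ≠ v ∧
      (((u.1 : ℕ) = 0 ∧ (u.2 : ℕ) = 0 ∧ (v.1 : ℕ) = 0 ∧ (v.2 : ℕ) = 1) ∨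
        ((v.1 : ℕ) = 0 ∧ (v.2 : ℕ) = 0 ∧ (u.1 : ℕ) = 0 ∧ (u.2 : ℕ) = 1)) := by
  rw [SimpleGraph.equipartitePlus, SimpleGraph.sup_adj, SimpleGraph.completeEquipartiteGraph_adj,
    SimpleGraph.fromRel_adj]

variable (r) in
open scoped Classical in
/-- The darts `(a, b)` of `H`, together with a colouring that is proper up to the edge `ab`, whose
endpoints both receive the colour `0`. -/
noncomputable def nearColorings (H : SimpleGraph U) : Finset ((U × U) × (U → Fin r)) :=
  {t | H.Adj t.1.1 t.1.2 ∧ (t.2 t.1.1 : ℕ) = 0 ∧ (t.2 t.1.2 : ℕ) = 0 ∧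
    ∀ x y, H.Adj x y → s(x, y) ≠ s(t.1.1, t.1.2) → t.2 x ≠ t.2 y}

/-- The injections with first coordinate `c` that send `a` and `b` to the ends of the additional
edge, where `t = ((a, b), c)`. -/
noncomputable def placements (m : ℕ) (t : (U × U) × (U → Fin r)) : Finset (U ↪ Fin r × Fin m) :=
  {f | (∀ x, (f x).1 = t.2 x) ∧ ((f t.1.1).2 : ℕ) = 0 ∧ ((f t.1.2).2 : ℕ) = 1}

/-- Every embedding of `H` uses the additional edge, as `H` is not `r`-colourable. The first
coordinates give a near colouring, with the preimage of the additional edge as its exceptional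
dart. -/
lemma card_copy_equipartitePlus (hcol : ¬ H.Colorable r) (m : ℕ) :
    Nat.card (H.Copy (SimpleGraph.equipartitePlus r m)) =
      ∑ t ∈ nearColorings r H, #(placements m t) := by
  classical
  have hdis : ((nearColorings r H : Finset _) : Set ((U × U) × (U → Fin r))).PairwiseDisjoint
      (placements m) := by
    rintro ⟨⟨a, b⟩, c⟩ ht ⟨⟨a', b'⟩, c'⟩ ht' hne
    rw [Function.onFun, Finset.disjoint_left]
    intro f hf hf'
    simp only [nearColorings, coe_filter, mem_univ, true_and, Set.mem_ofPred_eq] at ht ht'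
    simp only [placements, mem_filter, mem_univ, true_and] at hf hf'
    obtain ⟨h1, h2, h3⟩ := hf
    obtain ⟨h1', h2', h3'⟩ := hf'
    have hc : c = c' := funext fun x ↦ (h1 x).symm.trans (h1' x)
    subst hc
    refine hne ?_
    have ea : a = a' := f.injective (Prod.ext (Fin.ext (by rw [h1, h1, ht.2.1, ht'.2.1]))
      (Fin.ext (h2.trans h2'.symm)))
    have eb : b = b' := f.injective (Prod.ext (Fin.ext (by rw [h1, h1, ht.2.2.1, ht'.2.2.1]))
      (Fin.ext (h3.trans h3'.symm)))
    rw [ea, eb]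
  rw [← card_biUnion hdis]
  have e : Nat.card (H.Copy (SimpleGraph.equipartitePlus r m)) =
      #({f | ∀ x y, H.Adj x y → (SimpleGraph.equipartitePlus r m).Adj (f x) (f y)} :
        Finset (U ↪ Fin r × Fin m)) := by
    rw [← Fintype.card_subtype, ← Nat.card_eq_fintype_card]
    exact Nat.card_congr
      { toFun := fun f ↦ ⟨f.toEmbedding, fun x y h ↦ f.toHom.map_adj h⟩
        invFun := fun f ↦ ⟨⟨f.1, fun {x y} h ↦ f.2 x y h⟩, f.1.injective⟩
        left_inv := fun f ↦ rfl
        right_inv := fun f ↦ rfl }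
  rw [e]
  congr 1
  ext f
  simp only [mem_filter, mem_univ, true_and, mem_biUnion]
  constructor
  · intro hf
    set c : U → Fin r := fun x ↦ (f x).1 with hc
    have hspecial : ∀ x y, H.Adj x y → c x = c y →
        (((f x).1 : ℕ) = 0 ∧ ((f x).2 : ℕ) = 0 ∧ ((f y).1 : ℕ) = 0 ∧ ((f y).2 : ℕ) = 1) ∨
        (((f y).1 : ℕ) = 0 ∧ ((f y).2 : ℕ) = 0 ∧ ((f x).1 : ℕ) = 0 ∧ ((f x).2 : ℕ) = 1) :=
      fun x y hxy hcxy ↦ ((equipartitePlus_adj.1 (hf x y hxy)).resolve_left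
        fun h ↦ h hcxy).2
    have hex : ∃ a b, H.Adj a b ∧ ((f a).1 : ℕ) = 0 ∧ ((f a).2 : ℕ) = 0 ∧ ((f b).1 : ℕ) = 0 ∧
        ((f b).2 : ℕ) = 1 := by
      by_contra! hcon
      refine hcol ⟨SimpleGraph.Coloring.mk c fun {x y} hxy hcxy ↦ ?_⟩
      rcases hspecial x y hxy hcxy with ⟨h1, h2, h3, h4⟩ | ⟨h1, h2, h3, h4⟩
      · exact hcon x y hxy h1 h2 h3 h4
      · exact hcon y x hxy.symm h1 h2 h3 h4
    obtain ⟨a, b, hab, h1, h2, h3, h4⟩ := hex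
    have huniq : ∀ x y, ((f x).1 : ℕ) = 0 ∧ ((f x).2 : ℕ) = 0 ∧ ((f y).1 : ℕ) = 0 ∧
        ((f y).2 : ℕ) = 1 → x = a ∧ y = b := fun x y ⟨g1, g2, g3, g4⟩ ↦
      ⟨f.injective (Prod.ext (Fin.ext (g1.trans h1.symm)) (Fin.ext (g2.trans h2.symm))),
        f.injective (Prod.ext (Fin.ext (g3.trans h3.symm)) (Fin.ext (g4.trans h4.symm)))⟩
    refine ⟨((a, b), c), ?_, ?_⟩
    · simp only [nearColorings, mem_filter, mem_univ, true_and]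
      refine ⟨hab, h1, h3, fun x y hxy hne hcxy ↦ hne ?_⟩
      rcases hspecial x y hxy hcxy with h | h
      · obtain ⟨rfl, rfl⟩ := huniq x y h; rfl
      · obtain ⟨rfl, rfl⟩ := huniq y x h; exact Sym2.eq_swap
    · simp only [placements, mem_filter, mem_univ, true_and]
      exact ⟨fun _ ↦ rfl, h2, h4⟩
  · rintro ⟨⟨⟨a, b⟩, c⟩, ht, hf⟩ x y hxy
    simp only [nearColorings, mem_filter, mem_univ, true_and] at ht
    simp only [placements, mem_filter, mem_univ, true_and] at hf
    obtain ⟨hab, ha, hb, hprop⟩ := ht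
    obtain ⟨hfc, hfa, hfb⟩ := hf
    rw [equipartitePlus_adj]
    by_cases hne : s(x, y) = s(a, b)
    · refine Or.inr ⟨fun h ↦ hxy.ne (f.injective h), ?_⟩
      rw [Sym2.eq_iff] at hne
      rcases hne with ⟨rfl, rfl⟩ | ⟨rfl, rfl⟩
      · exact Or.inl ⟨by rw [hfc]; exact ha, hfa, by rw [hfc]; exact hb, hfb⟩
      · exact Or.inr ⟨by rw [hfc]; exact ha, hfa, by rw [hfc]; exact hb, hfb⟩
    · left
      rw [hfc, hfc]
      exact hprop x y hxy hne

lemma card_compl_pair {a b : U} (hab : a ≠ b) :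
    Fintype.card {x // x ≠ a ∧ x ≠ b} = Fintype.card U - 2 := by
  rw [Fintype.card_subtype, ← card_pair hab, ← card_compl]
  congr 1
  ext x
  simp

lemma card_placements_le {m : ℕ} {t : (U × U) × (U → Fin r)} (hab : t.1.1 ≠ t.1.2) :
    #(placements m t) ≤ m ^ (Fintype.card U - 2) := by
  obtain ⟨⟨a, b⟩, c⟩ := t
  have h := card_le_card_of_injOn (s := placements m ((a, b), c)) (t := univ)
    (fun f ↦ fun x : {x // x ≠ a ∧ x ≠ b} ↦ (f x).2) (fun _ _ ↦ mem_univ _) (by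
      intro f hf g hg hfg
      simp only [placements, coe_filter, mem_univ, true_and, Set.mem_ofPred_eq] at hf hg
      refine DFunLike.ext _ _ fun x ↦ Prod.ext ((hf.1 x).trans (hg.1 x).symm) ?_
      by_cases hxa : x = a
      · exact Fin.ext (by rw [hxa, hf.2.1, hg.2.1])
      by_cases hxb : x = b
      · exact Fin.ext (by rw [hxb, hf.2.2, hg.2.2])
      exact congrFun hfg ⟨x, hxa, hxb⟩)
  rwa [card_univ, Fintype.card_fun, Fintype.card_fin, card_compl_pair hab] at h

/-- Place the vertices other than `a` and `b` injectively at positions from `2` on. -/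
lemma le_card_placements {m : ℕ} (hm : 2 ≤ m) {t : (U × U) × (U → Fin r)}
    (hab : t.1.1 ≠ t.1.2) :
    (m - 2).descFactorial (Fintype.card U - 2) ≤ #(placements m t) := by
  obtain ⟨⟨a, b⟩, c⟩ := t
  simp only at hab
  set s : ({x // x ≠ a ∧ x ≠ b} ↪ {j : Fin m // 2 ≤ (j : ℕ)}) → U → Fin m := fun g x ↦
    if h : x ≠ a ∧ x ≠ b then (g ⟨x, h⟩).1 else if x = a then ⟨0, by omega⟩ else ⟨1, by omega⟩
    with hs
  have hs1 : ∀ g x (h : x ≠ a ∧ x ≠ b), s g x = (g ⟨x, h⟩).1 := fun g x h ↦ by simp [hs, h]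
  have hsa : ∀ g, s g a = ⟨0, by omega⟩ := fun g ↦ by simp [hs]
  have hsb : ∀ g, s g b = ⟨1, by omega⟩ := fun g ↦ by simp [hs, hab.symm]
  have hinj : ∀ g, Function.Injective (s g) := by
    intro g x y hxy
    by_cases hx : x ≠ a ∧ x ≠ b <;> by_cases hy : y ≠ a ∧ y ≠ b
    · rw [hs1 g x hx, hs1 g y hy] at hxy
      exact congrArg Subtype.val (g.injective (Subtype.ext hxy))
    · have h2 := (g ⟨x, hx⟩).2
      rw [hs1 g x hx] at hxy
      rcases not_and_or.1 hy with h | h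
      · rw [not_not.1 h, hsa] at hxy; rw [hxy] at h2; simp at h2
      · rw [not_not.1 h, hsb] at hxy; rw [hxy] at h2; simp at h2
    · have h2 := (g ⟨y, hy⟩).2
      rw [hs1 g y hy] at hxy
      rcases not_and_or.1 hx with h | h
      · rw [not_not.1 h, hsa] at hxy; rw [← hxy] at h2; simp at h2
      · rw [not_not.1 h, hsb] at hxy; rw [← hxy] at h2; simp at h2
    · rcases not_and_or.1 hx with h | h <;> rcases not_and_or.1 hy with h' | h'
      · rw [not_not.1 h, not_not.1 h']
      · rw [not_not.1 h, not_not.1 h', hsa, hsb] at hxy; simp at hxy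
      · rw [not_not.1 h, not_not.1 h', hsa, hsb] at hxy; simp at hxy
      · rw [not_not.1 h, not_not.1 h']
  have hcard : Fintype.card {j : Fin m // 2 ≤ (j : ℕ)} = m - 2 := by
    obtain ⟨k, rfl⟩ := Nat.exists_eq_add_of_le hm
    have e : k = Fintype.card (Fin k) := (Fintype.card_fin k).symm
    rw [Nat.add_sub_cancel_left]
    conv_rhs => rw [e]
    refine Fintype.card_congr
      { toFun := fun j ↦ ⟨j.1 - 2, by have := j.1.2; have := j.2; omega⟩
        invFun := fun i ↦ ⟨⟨i + 2, by have := i.2; omega⟩, by simp⟩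
        left_inv := fun j ↦ Subtype.ext (Fin.ext (Nat.sub_add_cancel j.2))
        right_inv := fun i ↦ Fin.ext (Nat.add_sub_cancel _ _) }
  have h := card_le_card_of_injOn (s := univ) (t := placements m ((a, b), c))
    (fun g : {x // x ≠ a ∧ x ≠ b} ↪ {j : Fin m // 2 ≤ (j : ℕ)} ↦
      (⟨fun x ↦ (c x, s g x), fun x y h ↦ hinj g (Prod.ext_iff.1 h).2⟩ : U ↪ Fin r × Fin m))
    (by
      intro g _
      simp only [placements, coe_filter, mem_univ, true_and, Set.mem_ofPred_eq]
      exact ⟨fun _ ↦ rfl, congrArg Fin.val (hsa g), congrArg Fin.val (hsb g)⟩)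
    (by
      intro g _ g' _ hgg
      ext x
      have h2 : s g x.1 = s g' x.1 := congrArg (fun f : U ↪ Fin r × Fin m ↦ (f x.1).2) hgg
      rw [hs1 g x.1 x.2, hs1 g' x.1 x.2] at h2
      exact congrArg Fin.val h2)
  rwa [card_univ, Fintype.card_embedding_eq, hcard, card_compl_pair hab] at h

lemma tendsto_descFactorial_div_pow (k : ℕ) :
    Tendsto (fun m : ℕ ↦ ((m - 2).descFactorial k : ℝ) / (m : ℝ) ^ k) atTop (𝓝 1) := by
  have hlow : Tendsto (fun m : ℕ ↦ (1 - ((k : ℝ) + 1) / m) ^ k) atTop (𝓝 1) := by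
    have := ((tendsto_const_div_atTop_nhds_zero_nat ((k : ℝ) + 1)).const_sub 1).pow k
    simpa using this
  refine tendsto_of_tendsto_of_tendsto_of_le_of_le' hlow tendsto_const_nhds ?_ ?_
  · filter_upwards [eventually_ge_atTop (k + 2)] with m hm
    have hm0 : (0 : ℝ) < m := by exact_mod_cast (by omega : 0 < m)
    have h := Nat.pow_sub_le_descFactorial (m - 2) k
    have e : ((m - 2 + 1 - k : ℕ) : ℝ) = m - ((k : ℝ) + 1) := by
      rw [show m - 2 + 1 - k = m - (k + 1) by omega, Nat.cast_sub (by omega)]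
      push_cast; ring
    have h2 : (m - ((k : ℝ) + 1)) ^ k ≤ ((m - 2).descFactorial k : ℝ) := by
      rw [← e]; exact_mod_cast h
    have e2 : 1 - ((k : ℝ) + 1) / m = (m - ((k : ℝ) + 1)) / m := by field_simp
    rw [e2, div_pow]
    gcongr
  · filter_upwards [eventually_ge_atTop 1] with m hm
    have hm0 : (0 : ℝ) < m := by exact_mod_cast hm
    rw [div_le_one (by positivity)]
    have : (m - 2).descFactorial k ≤ m ^ k :=
      ((m - 2).descFactorial_le_pow k).trans (Nat.pow_le_pow_left (Nat.sub_le _ _) _)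
    exact_mod_cast this

/-- A proper colouring of `H` without the edge `e` gives equal colours to the ends of `e`; permute
the colours to make that colour `0`. -/
lemma nearColorings_nonempty (hcol : ¬ H.Colorable r) {e : Sym2 U} (he : e ∈ H.edgeSet)
    (hdel : (H.deleteEdges {e}).Colorable r) : (nearColorings r H).Nonempty := by
  obtain ⟨c⟩ := hdel
  induction e with | _ a b
  have hprop : ∀ x y, H.Adj x y → s(x, y) ≠ s(a, b) → c x ≠ c y := fun x y hxy hne ↦
    c.valid (by rw [SimpleGraph.deleteEdges_adj]; exact ⟨hxy, hne⟩)
  have hcab : c a = c b := by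
    by_contra hne
    refine hcol ⟨SimpleGraph.Coloring.mk c fun {x y} hxy hcxy ↦ ?_⟩
    by_cases h : s(x, y) = s(a, b)
    · rcases Sym2.eq_iff.1 h with ⟨rfl, rfl⟩ | ⟨rfl, rfl⟩
      · exact hne hcxy
      · exact hne hcxy.symm
    · exact hprop x y hxy h hcxy
  have h0 : ((Equiv.swap (c a) 0 (c a) : Fin r) : ℕ) = 0 := by
    rw [Equiv.swap_apply_left]; simp
  refine ⟨((a, b), fun x ↦ Equiv.swap (c a) 0 (c x)), ?_⟩
  simp only [nearColorings, mem_filter, mem_univ, true_and]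
  exact ⟨he, h0, hcab ▸ h0, fun x y hxy hne h ↦ hprop x y hxy hne ((Equiv.swap _ _).injective h)⟩

/-- The limit is the number of near colourings divided by the number of automorphisms: almost all
maps that are compatible with a near colouring are injective. -/
theorem exists_tendsto_copyCount (hcol : ¬ H.Colorable r) {e : Sym2 U} (he : e ∈ H.edgeSet)
    (hdel : (H.deleteEdges {e}).Colorable r) : ∃ ϖ : ℝ, 0 < ϖ ∧
      Tendsto (fun m : ℕ ↦ ((SimpleGraph.equipartitePlus r m).copyCount H : ℝ) /
        (m : ℝ) ^ (Fintype.card U - 2)) atTop (𝓝 ϖ) := by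
  set k := Fintype.card U - 2
  have hA : 0 < Nat.card (H ≃g H) := by
    have : Finite (H ≃g H) := Finite.of_injective (fun σ : H ≃g H ↦ (σ : U → U))
      DFunLike.coe_injective
    have : Nonempty (H ≃g H) := ⟨SimpleGraph.Iso.refl⟩
    exact Nat.card_pos
  have hA' : (0 : ℝ) < Nat.card (H ≃g H) := by exact_mod_cast hA
  refine ⟨#(nearColorings r H) / Nat.card (H ≃g H), ?_, ?_⟩
  · have : 0 < #(nearColorings r H) := (nearColorings_nonempty hcol he hdel).card_pos
    positivity
  have hterm : ∀ t ∈ nearColorings r H,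
      Tendsto (fun m : ℕ ↦ (#(placements m t) : ℝ) / (m : ℝ) ^ k) atTop (𝓝 1) := by
    intro t ht
    have hab : t.1.1 ≠ t.1.2 := by
      simp only [nearColorings, mem_filter] at ht
      exact ht.2.1.ne
    refine tendsto_of_tendsto_of_tendsto_of_le_of_le' (tendsto_descFactorial_div_pow k)
      tendsto_const_nhds ?_ ?_
    · filter_upwards [eventually_ge_atTop 2] with m hm
      gcongr
      exact le_card_placements hm hab
    · filter_upwards [eventually_ge_atTop 1] with m hm
      have hm0 : (0 : ℝ) < m := by exact_mod_cast hm
      rw [div_le_one (by positivity)]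
      exact_mod_cast card_placements_le hab
  have hsum := (tendsto_finsetSum (nearColorings r H) hterm).div_const
    (Nat.card (H ≃g H) : ℝ)
  simp only [sum_const, nsmul_eq_mul, mul_one] at hsum
  refine hsum.congr fun m ↦ ?_
  have h1 := copyCount_mul_card_iso (SimpleGraph.equipartitePlus r m) H
  rw [card_copy_equipartitePlus hcol] at h1
  have h2 : ((SimpleGraph.equipartitePlus r m).copyCount H : ℝ) * Nat.card (H ≃g H) =
      ∑ t ∈ nearColorings r H, (#(placements m t) : ℝ) := by exact_mod_cast h1
  rw [← sum_div, ← h2]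
  field_simp

end Counting

section Transfer

variable {U V : Type*} [Fintype U] [DecidableEq U] [Fintype V] [DecidableEq V]
  {r : ℕ} [NeZero r] {H : SimpleGraph U} {S : Finset (Sym2 U)}

/-- A cut whose classes have at most `m` vertices embeds into the equipartite vertex set, in such a
way that a given pair inside a class goes to the ends of the additional edge. -/
lemma exists_embedding_equipartite {m : ℕ} {φ : V → Fin r} (hφ : ∀ i, #(cls φ i) ≤ m) {x y : V}
    (hxy : x ≠ y) (hφxy : φ x = φ y) : ∃ ι : V ↪ Fin r × Fin m,
      (∀ u v, (ι u).1 = (ι v).1 ↔ φ u = φ v) ∧ ((ι x).1 : ℕ) = 0 ∧ ((ι x).2 : ℕ) = 0 ∧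
        ((ι y).1 : ℕ) = 0 ∧ ((ι y).2 : ℕ) = 1 := by
  have hemb : ∀ i, Nonempty ({v // φ v = i} ↪ Fin m) := fun i ↦ by
    refine Function.Embedding.nonempty_of_card_le ?_
    rw [Fintype.card_fin, Fintype.card_subtype]
    exact hφ i
  have G : ∀ i, {v // φ v = i} ↪ Fin m := fun i ↦ (hemb i).some
  set g : V → Fin m := fun v ↦ G (φ v) ⟨v, rfl⟩ with hg
  have hGg : ∀ i v (h : φ v = i), G i ⟨v, h⟩ = g v := by rintro i v rfl; rfl
  have hginj : ∀ u v, φ u = φ v → g u = g v → u = v := by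
    intro u v h1 h2
    rw [← hGg (φ v) u h1] at h2
    exact congrArg Subtype.val ((G (φ v)).injective h2)
  have hgxy : g x ≠ g y := fun h ↦ hxy (hginj x y hφxy h)
  have hm : 2 ≤ m := by
    have h1 := (g x).2
    have h2 := (g y).2
    have h3 := fun h ↦ hgxy (Fin.ext h)
    omega
  set z : Fin m := ⟨0, by omega⟩ with hz
  set o : Fin m := ⟨1, by omega⟩ with ho
  have hzo : z ≠ o := by simp [hz, ho]
  -- A permutation of the positions that sends the positions of `x` and `y` to `0` and `1`.
  set τ : Equiv.Perm (Fin m) := (Equiv.swap (g x) z).trans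
    (Equiv.swap (Equiv.swap (g x) z (g y)) o) with hτ
  have hτx : τ (g x) = z := by
    rw [hτ, Equiv.trans_apply, Equiv.swap_apply_left, Equiv.swap_apply_of_ne_of_ne _ hzo]
    intro h
    have h2 := congrArg (Equiv.swap (g x) z) h
    rw [Equiv.swap_apply_right, Equiv.swap_apply_self] at h2
    exact hgxy h2
  have hτy : τ (g y) = o := by rw [hτ, Equiv.trans_apply, Equiv.swap_apply_left]
  refine ⟨⟨fun v ↦ (Equiv.swap (φ x) 0 (φ v), τ (g v)), fun u v h ↦ ?_⟩, ?_, ?_, ?_, ?_, ?_⟩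
  · obtain ⟨h1, h2⟩ := Prod.ext_iff.1 h
    exact hginj u v ((Equiv.swap _ _).injective h1) (τ.injective h2)
  · exact fun u v ↦ (Equiv.swap _ _).injective.eq_iff
  · change ((Equiv.swap (φ x) 0 (φ x) : Fin r) : ℕ) = 0
    rw [Equiv.swap_apply_left]; simp
  · exact congrArg Fin.val hτx
  · change ((Equiv.swap (φ x) 0 (φ y) : Fin r) : ℕ) = 0
    rw [← hφxy, Equiv.swap_apply_left]; simp
  · exact congrArg Fin.val hτy

/-- If all classes of a cut have at most `m` vertices, then a pair inside a class closes at most as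
many potential copies as there are copies in `K_r(m)⁺`. -/
lemma card_copies_closing_le (hS : (S : Set (Sym2 U)) = H.edgeSet) {m : ℕ} {φ : V → Fin r}
    (hφ : ∀ i, #(cls φ i) ≤ m) {e : Sym2 V} (he : e ∈ inside φ) :
    #{C ∈ copies V S | e ∈ C ∧ C.erase e ⊆ cross φ} ≤
      (SimpleGraph.equipartitePlus r m).copyCount H := by
  classical
  induction e with | _ x y
  rw [mk_mem_inside] at he
  obtain ⟨ι, hι, hx1, hx2, hy1, hy2⟩ := exists_embedding_equipartite hφ he.1 he.2
  have hSH : ∀ a b, s(a, b) ∈ S ↔ H.Adj a b := fun a b ↦ by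
    rw [← mem_coe, hS, SimpleGraph.mem_edgeSet]
  have hcopy : ∀ C ∈ ({C ∈ copies V S | s(x, y) ∈ C ∧ C.erase s(x, y) ⊆ cross φ} :
      Finset (Finset (Sym2 V))), ∃ B : (SimpleGraph.equipartitePlus r m).Subgraph,
        B ∈ (univ : Finset (H.Copy (SimpleGraph.equipartitePlus r m))).image
          SimpleGraph.Copy.toSubgraph ∧ ∀ d, ι.sym2Map d ∈ B.edgeSet ↔ d ∈ C := by
    intro C hC
    obtain ⟨hC, -, hCφ⟩ := mem_filter.1 hC
    obtain ⟨f, -, rfl⟩ := mem_image.1 hC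
    have hhom : ∀ a b, H.Adj a b →
        (SimpleGraph.equipartitePlus r m).Adj (ι (f a)) (ι (f b)) := by
      intro a b hab
      rw [equipartitePlus_adj]
      have hmem : s(f a, f b) ∈ img S f := by
        rw [img, Finset.mem_map]
        exact ⟨s(a, b), (hSH a b).2 hab, rfl⟩
      by_cases hne : s(f a, f b) = s(x, y)
      · refine Or.inr ⟨fun h ↦ hab.ne (f.injective (ι.injective h)), ?_⟩
        rcases Sym2.eq_iff.1 hne with ⟨h1, h2⟩ | ⟨h1, h2⟩
        · rw [h1, h2]; exact Or.inl ⟨hx1, hx2, hy1, hy2⟩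
        · rw [h1, h2]; exact Or.inr ⟨hx1, hx2, hy1, hy2⟩
      · left
        rw [Ne, hι]
        exact mk_mem_cross.1 (hCφ (mem_erase.2 ⟨hne, hmem⟩))
    refine ⟨_, mem_image_of_mem _ (mem_univ ⟨⟨fun a ↦ ι (f a), fun {a b} h ↦ hhom a b h⟩,
      fun a b h ↦ f.injective (ι.injective h)⟩), fun d ↦ ?_⟩
    induction d with | _ u v
    rw [Function.Embedding.sym2Map_apply, Sym2.map_mk, SimpleGraph.Subgraph.mem_edgeSet, img,
      Finset.mem_map]
    simp only [SimpleGraph.Copy.toSubgraph, SimpleGraph.Subgraph.map_adj, Relation.map_apply,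
      SimpleGraph.Subgraph.top_adj]
    constructor
    · rintro ⟨a, b, hab, ha, hb⟩
      have ha' : f a = u := ι.injective ha
      have hb' : f b = v := ι.injective hb
      exact ⟨s(a, b), (hSH a b).2 hab, by rw [← ha', ← hb']; rfl⟩
    · rintro ⟨d, hd, hdu⟩
      induction d with | _ a b
      rw [hSH] at hd
      rw [Function.Embedding.sym2Map_apply, Sym2.map_mk, Sym2.eq_iff] at hdu
      rcases hdu with ⟨rfl, rfl⟩ | ⟨rfl, rfl⟩
      · exact ⟨a, b, hd, rfl, rfl⟩
      · exact ⟨b, a, hd.symm, rfl, rfl⟩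
  -- The edge set of a copy can be read off from its image, so the assignment is injective.
  choose! g hg using hcopy
  rw [SimpleGraph.copyCount_eq_card_image_copyToSubgraph]
  refine card_le_card_of_injOn g (fun C hC ↦ (hg C hC).1) fun C hC C' hC' h ↦ ?_
  ext d
  rw [← (hg C hC).2, ← (hg C' hC').2, h]

end Transfer

section Balanced

variable {V : Type*} [Fintype V] [DecidableEq V] {H : SimpleGraph V}

/-! ### Strictly balanced, edge-critical graphs -/

lemma edgeVertexRatio_top : SimpleGraph.edgeVertexRatio (⊤ : H.Subgraph) =
    ((H.edgeSet.ncard : ℝ) - 1) / ((Fintype.card V : ℝ) - 2) := by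
  rw [SimpleGraph.edgeVertexRatio, SimpleGraph.Subgraph.edgeSet_top,
    SimpleGraph.Subgraph.verts_top, Set.ncard_univ, Nat.card_eq_fintype_card]

/-- The `2`-density of a strictly balanced graph is attained by the graph itself. -/
lemma twoDensity_eq (hbal : H.IsStrictlyTwoBalanced) :
    H.twoDensity = ((H.edgeSet.ncard : ℝ) - 1) / ((Fintype.card V : ℝ) - 2) := by
  rw [← edgeVertexRatio_top, SimpleGraph.twoDensity]
  refine IsGreatest.csSup_eq ⟨⟨⊤, ?_, rfl⟩, ?_⟩
  · change 2 ≤ _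
    rw [SimpleGraph.Subgraph.edgeSet_top]
    exact hbal.1
  · rintro _ ⟨F, hF, rfl⟩
    by_cases h : F = ⊤
    · rw [h]
    · exact (hbal.2 F hF h).le

/-- The subgraph with the edges in `J` and the vertices that these cover. -/
def coverSubgraph (J : Finset (Sym2 V)) (hJ : (J : Set (Sym2 V)) ⊆ H.edgeSet) : H.Subgraph where
  verts := verts J
  Adj a b := s(a, b) ∈ J
  adj_sub h := hJ (mem_coe.2 h)
  edge_vert {a b} h := by
    rw [mem_coe, verts, mem_filter]
    exact ⟨mem_univ _, s(a, b), h, Sym2.mem_mk_left a b⟩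
  symm := ⟨fun a b h ↦ by rwa [Sym2.eq_swap]⟩

lemma edgeSet_coverSubgraph (J : Finset (Sym2 V)) (hJ : (J : Set (Sym2 V)) ⊆ H.edgeSet) :
    (coverSubgraph J hJ).edgeSet = J := by
  ext d
  induction d with | _ a b
  rfl

lemma edgeVertexRatio_coverSubgraph (J : Finset (Sym2 V)) (hJ : (J : Set (Sym2 V)) ⊆ H.edgeSet) :
    SimpleGraph.edgeVertexRatio (coverSubgraph J hJ) = ((#J : ℝ) - 1) / ((#(verts J) : ℝ) - 2) := by
  rw [SimpleGraph.edgeVertexRatio, edgeSet_coverSubgraph, Set.ncard_coe_finset, coverSubgraph,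
    Set.ncard_coe_finset]

lemma card_verts_singleton {e : Sym2 V} (he : e ∈ H.edgeSet) : #(verts {e}) = 2 := by
  induction e with | _ a b
  have hab : a ≠ b := SimpleGraph.Adj.ne he
  rw [← card_pair hab]
  congr 1
  ext x
  simp [verts]

/-- Two edges cover at least three vertices. -/
lemma three_le_card_verts {J : Finset (Sym2 V)} (hJ : (J : Set (Sym2 V)) ⊆ H.edgeSet)
    (h2 : 2 ≤ #J) : 3 ≤ #(verts J) := by
  obtain ⟨e, he, f, hf, hef⟩ := one_lt_card.1 h2
  have hsub : verts {e} ⊆ verts J := fun x hx ↦ by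
    simp only [verts, mem_filter, mem_univ, true_and, mem_singleton, exists_eq_left] at hx ⊢
    exact ⟨e, he, hx⟩
  have hc := card_verts_singleton (hJ he)
  by_contra! hlt
  have heq : verts {e} = verts J := eq_of_subset_of_card_le hsub (by omega)
  refine hef ?_
  have hsubf : verts {f} ⊆ verts {e} := fun x hx ↦ by
    rw [heq]
    simp only [verts, mem_filter, mem_univ, true_and, mem_singleton, exists_eq_left] at hx ⊢
    exact ⟨f, hf, hx⟩
  have heqf : verts {f} = verts {e} := eq_of_subset_of_card_le hsubf (by
    rw [hc, card_verts_singleton (hJ hf)])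
  ext x
  have := Finset.ext_iff.1 heqf x
  simp only [verts, mem_filter, mem_univ, true_and, mem_singleton, exists_eq_left] at this
  exact this.symm

end Balanced

section Balanced

variable {V : Type*} [Fintype V] [DecidableEq V] {H : SimpleGraph V} {S : Finset (Sym2 V)}

lemma card_eq_ncard (hS : (S : Set (Sym2 V)) = H.edgeSet) : #S = H.edgeSet.ncard := by
  rw [← hS, Set.ncard_coe_finset]

/-- Strict `2`-balancedness in terms of sets of edges: passing to `J` loses edges or leaves
isolated vertices. -/
lemma ratio_lt (hS : (S : Set (Sym2 V)) = H.edgeSet) (hbal : H.IsStrictlyTwoBalanced)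
    {J : Finset (Sym2 V)} (hJ : J ⊆ S) (h2 : 2 ≤ #J) (hne : #J < #S ∨ #(verts J) ≠ Fintype.card V) :
    ((#J : ℝ) - 1) / ((#(verts J) : ℝ) - 2) < ((#S : ℝ) - 1) / ((Fintype.card V : ℝ) - 2) := by
  have hJ' : (J : Set (Sym2 V)) ⊆ H.edgeSet := by rw [← hS]; exact Finset.coe_subset.2 hJ
  rw [← edgeVertexRatio_coverSubgraph J hJ', card_eq_ncard hS, ← edgeVertexRatio_top]
  refine hbal.2 _ ?_ fun h ↦ ?_
  · rwa [edgeSet_coverSubgraph, Set.ncard_coe_finset]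
  · rcases hne with hne | hne
    · have := congrArg (fun F : H.Subgraph ↦ F.edgeSet.ncard) h
      simp only [edgeSet_coverSubgraph, Set.ncard_coe_finset, SimpleGraph.Subgraph.edgeSet_top,
        ← card_eq_ncard hS] at this
      omega
    · have := congrArg (fun F : H.Subgraph ↦ F.verts.ncard) h
      simp only [coverSubgraph, Set.ncard_coe_finset, SimpleGraph.Subgraph.verts_top,
        Set.ncard_univ, Nat.card_eq_fintype_card] at this
      exact hne this

/-- A strictly balanced graph has no isolated vertices. -/
lemma card_verts_eq (hS : (S : Set (Sym2 V)) = H.edgeSet) (hbal : H.IsStrictlyTwoBalanced) :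
    #(verts S) = Fintype.card V := by
  have h2 : 2 ≤ #S := by rw [card_eq_ncard hS]; exact hbal.1
  have h3 := three_le_card_verts (by rw [hS]) h2
  have hle : #(verts S) ≤ Fintype.card V := card_le_univ _
  by_contra hne
  have h := ratio_lt hS hbal subset_rfl h2 (Or.inr hne)
  have e2 : (2 : ℝ) ≤ #S := by exact_mod_cast h2
  have e3 : (3 : ℝ) ≤ #(verts S) := by exact_mod_cast h3
  have e4 : (#(verts S) : ℝ) ≤ Fintype.card V := by exact_mod_cast hle
  refine absurd h (not_lt.2 ?_)
  gcongr
  · linarith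
  · linarith

/-- A graph that contains a cycle has `2`-density larger than `1`. -/
lemma card_lt_of_not_isBipartite (hS : (S : Set (Sym2 V)) = H.edgeSet)
    (hbal : H.IsStrictlyTwoBalanced) (hbip : ¬ H.IsBipartite) : Fintype.card V < #S + 1 := by
  have hcyc : ¬ H.IsAcyclic := fun h ↦ hbip h.isBipartite
  simp only [SimpleGraph.IsAcyclic, not_forall, not_not] at hcyc
  obtain ⟨v, c, hc⟩ := hcyc
  have hl := hc.three_le_length
  set J := c.edges.toFinset with hJdef
  have hJ : #J = c.length := by
    rw [hJdef, List.toFinset_card_of_nodup hc.edges_nodup, SimpleGraph.Walk.length_edges]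
  have hJS : J ⊆ S := fun e he ↦ by
    rw [← mem_coe, hS]
    exact c.edges_subset_edgeSet (List.mem_toFinset.1 he)
  have hv : #(verts J) ≤ c.length := by
    have hsub : verts J ⊆ c.support.tail.toFinset := by
      intro x hx
      simp only [verts, mem_filter, mem_univ, true_and] at hx
      obtain ⟨e, he, hx⟩ := hx
      rw [List.mem_toFinset]
      have hxs : x ∈ c.support := by
        obtain ⟨y, rfl⟩ := Sym2.mem_iff_exists.1 hx
        exact c.fst_mem_support_of_mem_edges (List.mem_toFinset.1 he)
      rw [← SimpleGraph.Walk.cons_tail_support] at hxs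
      rcases List.mem_cons.1 hxs with rfl | h
      · exact SimpleGraph.Walk.end_mem_tail_support (fun h ↦ by
          have := SimpleGraph.Walk.length_eq_zero_iff.2 h; omega)
      · exact h
    refine (card_le_card hsub).trans ((List.toFinset_card_le _).trans ?_)
    rw [List.length_tail, SimpleGraph.Walk.length_support]
    omega
  have h2 : 2 ≤ #J := by omega
  have h3 := three_le_card_verts (by rw [← hS]; exact Finset.coe_subset.2 hJS) h2
  have hle : #(verts J) ≤ Fintype.card V := card_le_univ _
  by_contra hcon
  rw [not_lt] at hcon
  have hlt : ((#J : ℝ) - 1) / ((#(verts J) : ℝ) - 2) <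
      ((#S : ℝ) - 1) / ((Fintype.card V : ℝ) - 2) := by
    refine ratio_lt hS hbal hJS h2 ?_
    by_cases h : #J < #S
    · exact Or.inl h
    · have := card_le_card hJS
      right; omega
  have e1 : ((#S : ℝ) - 1) / ((Fintype.card V : ℝ) - 2) ≤ 1 := by
    have a1 : (3 : ℝ) ≤ Fintype.card V := by exact_mod_cast h3.trans hle
    have a2 : (#S : ℝ) + 1 ≤ Fintype.card V := by exact_mod_cast hcon
    rw [div_le_one (by linarith)]; linarith
  have e2 : 1 ≤ ((#J : ℝ) - 1) / ((#(verts J) : ℝ) - 2) := by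
    have a1 : (3 : ℝ) ≤ #(verts J) := by exact_mod_cast h3
    have a2 : (#(verts J) : ℝ) ≤ #J := by rw [hJ]; exact_mod_cast hv
    rw [one_le_div (by linarith)]; linarith
  linarith

/-- For a nonbipartite edge-critical graph, `χ(H) - 1` is at least two, and it is the chromatic
number after the removal of a suitable edge. -/
lemma chromaticPred_spec (hbip : ¬ H.IsBipartite) (hcrit : H.IsEdgeCritical) :
    2 ≤ H.chromaticPred ∧ ¬ H.Colorable H.chromaticPred ∧
      ∃ e ∈ H.edgeSet, (H.deleteEdges {e}).Colorable H.chromaticPred := by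
  obtain ⟨k, hk⟩ : ∃ k : ℕ, H.chromaticNumber = k := by
    refine ⟨H.chromaticNumber.toNat, (ENat.natCast_toNat ?_).symm⟩
    exact SimpleGraph.chromaticNumber_ne_top_iff_exists.2 ⟨_, H.colorable_of_fintype⟩
  have hcol : ∀ n : ℕ, H.Colorable n ↔ k ≤ n := fun n ↦ by
    rw [← SimpleGraph.chromaticNumber_le_iff_colorable, hk, Nat.cast_le]
  have hr : H.chromaticPred = k - 1 := by rw [SimpleGraph.chromaticPred, hk, ENat.toNat_natCast]
  have h2 : ¬ k ≤ 2 := fun h ↦ hbip ((hcol 2).2 h)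
  refine ⟨by omega, by rw [hcol]; omega, ?_⟩
  obtain ⟨e, he, hχ⟩ := hcrit
  refine ⟨e, he, ?_⟩
  rw [← SimpleGraph.chromaticNumber_le_iff_colorable, hr]
  have hk1 : ((k - 1 : ℕ) : ℕ∞) + 1 = k := by exact_mod_cast Nat.sub_add_cancel (by omega)
  rw [hk, ← hk1] at hχ
  exact (ENat.add_left_injective_of_ne_top (by simp) hχ).le

end Balanced

section Constants

/-! ### The constants and the range of the edge probability -/

lemma tendsto_mul_natCast_atTop {p : ℕ → ℝ} (h0 : ∀ n, 0 ≤ p n)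
    (h : (fun n : ℕ ↦ 1 / (n : ℝ)) =o[atTop] p) : Tendsto (fun n ↦ p n * n) atTop atTop := by
  rw [tendsto_atTop]
  intro b
  have hb : (0 : ℝ) < 1 / (|b| + 1) := by positivity
  filter_upwards [h.bound hb, eventually_ge_atTop 1] with n hn hn1
  have hn0 : (0 : ℝ) < n := by exact_mod_cast hn1
  rw [Real.norm_of_nonneg (by positivity), Real.norm_of_nonneg (h0 n), div_mul_eq_mul_div,
    one_mul, div_le_div_iff₀ hn0 (by positivity), one_mul] at hn
  exact (le_abs_self b).trans (by linarith)

/-- The bound on `p` in terms of the expected number of copies on a given pair. -/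
lemma pow_mul_pow_le {n p x μ : ℝ} {h w : ℕ} (hn : 1 ≤ n) (h0 : 0 ≤ p) (hh : h ≠ 0)
    (hμ : μ * h = w) (hp : p ≤ x * n ^ (-μ) * Real.log n ^ (1 / (h : ℝ))) :
    n ^ w * p ^ h ≤ (max x 0) ^ h * Real.log n := by
  have hn0 : 0 < n := by linarith
  have hL : 0 ≤ Real.log n := Real.log_nonneg hn
  have h1 : p ≤ max x 0 * n ^ (-μ) * Real.log n ^ (1 / (h : ℝ)) :=
    hp.trans (by gcongr; exact le_max_left _ _)
  have h2 := pow_le_pow_left₀ h0 h1 h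
  rw [mul_pow, mul_pow, ← Real.rpow_natCast (n ^ (-μ)), ← Real.rpow_mul hn0.le, one_div,
    Real.rpow_inv_natCast_pow hL hh, neg_mul, hμ, Real.rpow_neg hn0.le, Real.rpow_natCast] at h2
  calc n ^ w * p ^ h ≤ n ^ w * (max x 0 ^ h * (n ^ w)⁻¹ * Real.log n) := by gcongr
    _ = _ := by field_simp

end Constants

end RandomSubset

open RandomSubset in
theorem theorem1p5 {V : Type*} [Finite V] (H : SimpleGraph V)
    (hbip : ¬ H.IsBipartite) (hcrit : H.IsEdgeCritical) (hbal : H.IsStrictlyTwoBalanced) :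
    -- the constants `π_H` and `θ_H` are well defined
    (Tendsto H.copyRatio atTop (𝓝 H.piConst) ∧ 0 < H.piConst) ∧
    (0 < H.thetaConst ∧
      (H.chromaticPred : ℝ) ^ (2 - (Nat.card V : ℤ)) * H.piConst *
        H.thetaConst ^ (H.edgeSet.ncard - 1) = 2 - 1 / H.twoDensity ∧
      ∀ θ : ℝ, 0 < θ →
        (H.chromaticPred : ℝ) ^ (2 - (Nat.card V : ℤ)) * H.piConst *
          θ ^ (H.edgeSet.ncard - 1) = 2 - 1 / H.twoDensity → θ = H.thetaConst) ∧
    -- the lower bound on the threshold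
    ∀ (ε : ℝ), 0 < ε → ∀ p : ℕ → unitInterval,
      (fun n : ℕ ↦ 1 / (n : ℝ)) =o[atTop] (fun n : ℕ ↦ (p n : ℝ)) →
      (∀ᶠ n : ℕ in atTop,
        (p n : ℝ) ≤ (H.thetaConst - ε) * (n : ℝ) ^ (-(1 / H.twoDensity)) *
          Real.log n ^ (1 / ((H.edgeSet.ncard : ℝ) - 1))) →
      Tendsto (fun n : ℕ ↦ SimpleGraph.binomialRandom (Fin n) (p n)
        {G : SimpleGraph (Fin n) | ¬ G.IsSimonovits H}) atTop (𝓝 1) := by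
  classical
  have := Fintype.ofFinite V
  obtain ⟨hr2, hcol, e, he, hdel⟩ := chromaticPred_spec hbip hcrit
  set r := H.chromaticPred with hr
  have : NeZero r := ⟨by omega⟩
  set S : Finset (Sym2 V) := H.edgeSet.toFinset with hSdef
  have hS : (S : Set (Sym2 V)) = H.edgeSet := Set.coe_toFinset _
  have hcS := card_eq_ncard hS
  have hS2 : 2 ≤ S.card := by rw [hcS]; exact hbal.1
  have hvS := card_verts_eq hS hbal
  have hu : 3 ≤ Fintype.card V := hvS ▸ three_le_card_verts hS.subset hS2
  have hlt := card_lt_of_not_isBipartite hS hbal hbip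
  have hm2 := twoDensity_eq hbal
  rw [← hcS] at hm2 ⊢
  have hSr : ((S.card - 1 : ℕ) : ℝ) = (S.card : ℝ) - 1 := by
    rw [Nat.cast_sub (by omega)]; simp
  have hur : ((Fintype.card V - 2 : ℕ) : ℝ) = (Fintype.card V : ℝ) - 2 := by
    rw [Nat.cast_sub (by omega)]; simp
  have hSpos : (0 : ℝ) < (S.card : ℝ) - 1 := by
    rw [← hSr]; exact_mod_cast (by omega : 0 < S.card - 1)
  have hupos : (0 : ℝ) < (Fintype.card V : ℝ) - 2 := by
    rw [← hur]; exact_mod_cast (by omega : 0 < Fintype.card V - 2)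
  set μ : ℝ := 1 / H.twoDensity with hμdef
  have hμeq : μ = ((Fintype.card V : ℝ) - 2) / ((S.card : ℝ) - 1) := by
    rw [hμdef, hm2, one_div_div]
  have hμ : μ * (S.card - 1 : ℕ) = (Fintype.card V - 2 : ℕ) := by
    rw [hμeq, hSr, hur, div_mul_cancel₀ _ hSpos.ne']
  have hμ1 : μ < 1 := by
    rw [hμeq, div_lt_one hSpos]
    have : (Fintype.card V : ℝ) < S.card + 1 := by exact_mod_cast hlt
    linarith
  have hr0 : (0 : ℝ) < r := by exact_mod_cast (by omega : 0 < r)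
  obtain ⟨ϖ, hϖ, hlim⟩ := exists_tendsto_copyCount (r := r) hcol he hdel
  have hratio : Tendsto H.copyRatio atTop (𝓝 ϖ) := by
    refine hlim.congr fun m ↦ ?_
    rw [SimpleGraph.copyRatio, Nat.card_eq_fintype_card, ← zpow_natCast, Nat.cast_sub (by omega)]
    rfl
  have hpi : H.piConst = ϖ := hratio.limUnder_eq
  have hzpow : (r : ℝ) ^ (2 - (Nat.card V : ℤ)) = ((r : ℝ) ^ (Fintype.card V - 2))⁻¹ := by
    rw [← zpow_natCast, ← zpow_neg, Nat.cast_sub (by omega), Nat.card_eq_fintype_card]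
    congr 1
    push_cast
    ring
  set A : ℝ := (r : ℝ) ^ (2 - (Nat.card V : ℤ)) * ϖ with hA
  have hApos : 0 < A := by positivity
  -- The constant `θ_H` is the unique positive root of `A * θ ^ (e_H - 1) = 2 - μ`.
  have hX : 0 < (2 - μ) / A := div_pos (by linarith) hApos
  have hθ : H.thetaConst = ((2 - μ) / A) ^ (1 / ((S.card : ℝ) - 1)) := by
    rw [SimpleGraph.thetaConst, hpi, ← hcS]
  have hθ0 : 0 < H.thetaConst := by rw [hθ]; positivity
  have hθpow : H.thetaConst ^ (S.card - 1) = (2 - μ) / A := by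
    rw [hθ, ← hSr, one_div, Real.rpow_inv_natCast_pow hX.le (by omega)]
  have hθeq : A * H.thetaConst ^ (S.card - 1) = 2 - μ := by
    rw [hθpow]; field_simp
  rw [hpi]
  refine ⟨⟨hratio, hϖ⟩, ⟨hθ0, hθeq, fun θ h0 h ↦ ?_⟩, fun ε hε p hpn hp ↦ ?_⟩
  · rw [← hθeq] at h
    exact (pow_left_inj₀ h0.le hθ0.le (by omega)).1 (mul_left_cancel₀ hApos.ne' h)
  have h0 : ∀ n, 0 ≤ (p n : ℝ) := fun n ↦ (p n).2.1
  have h1 : ∀ n, (p n : ℝ) ≤ 1 := fun n ↦ (p n).2.2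
  -- The expected number of copies on a pair is at most `y * log n` with `y = max (θ_H - ε) 0 ^
  -- (e_H - 1)`; the maximum covers the case `ε > θ_H`.
  have hsat := tendsto_pr_isSaturated (U := V) (r := r) (S := S) (μ := μ) (ϖ := ϖ)
    (y := max (H.thetaConst - ε) 0 ^ (S.card - 1)) hr2 hS2 hu hμ hμ1
    (fun J hJ hJ1 ↦ by
      obtain ⟨f, rfl⟩ := Finset.card_eq_one.1 hJ1
      exact card_verts_singleton (hS ▸ Finset.mem_coe.2 (hJ (Finset.mem_singleton_self f))))
    hvS
    (fun J hJ hJ2 hJS ↦ by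
      have h := ratio_lt hS hbal hJ hJ2 (Or.inl hJS)
      have h3 := three_le_card_verts (by rw [← hS]; exact Finset.coe_subset.2 hJ) hJ2
      have h3' : (0 : ℝ) < ((verts J).card : ℝ) - 2 := by
        have : (3 : ℝ) ≤ (verts J).card := by exact_mod_cast h3
        linarith
      rw [div_lt_div_iff₀ h3' hupos] at h
      rw [hμeq, Nat.cast_sub (by omega), Nat.cast_one, div_mul_eq_mul_div]
      have : ((Fintype.card V : ℝ) - 2) * ((J.card : ℝ) - 1) / ((S.card : ℝ) - 1) <
          ((verts J).card : ℝ) - 2 := by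
        rw [div_lt_iff₀ hSpos]; linarith
      linarith)
    (fun m ↦ (SimpleGraph.equipartitePlus r m).copyCount H) hlim hϖ.le
    (fun n m φ hφ e he ↦ card_copies_closing_le hS hφ he)
    (by positivity)
    (by
      have hlt : max (H.thetaConst - ε) 0 ^ (S.card - 1) < H.thetaConst ^ (S.card - 1) :=
        pow_lt_pow_left₀ (max_lt (by linarith) hθ0) (le_max_right _ _) (by omega)
      have hAeq : ϖ / (r : ℝ) ^ (Fintype.card V - 2) = A := by
        rw [hA, hzpow, div_eq_inv_mul]
      rw [hAeq, ← hθeq, mul_comm A]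
      gcongr)
    (fun n ↦ (p n : ℝ)) h0 h1 (tendsto_mul_natCast_atTop h0 hpn)
    (by
      filter_upwards [hp, eventually_ge_atTop 1] with n hn hn1
      rw [← hSr] at hn
      exact pow_mul_pow_le (by exact_mod_cast hn1) (h0 n) (by omega) hμ hn)
  -- The probability of not being `H`-Simonovits is between that of not being saturated and one.
  have hlow : Tendsto (fun n : ℕ ↦ ENNReal.ofReal
      (1 - pr (p n : ℝ) {E : Finset (Sym2 (Fin n)) | IsSaturated S r E})) atTop (𝓝 1) := by
    have := ENNReal.tendsto_ofReal (hsat.const_sub 1)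
    simpa using this
  refine tendsto_of_tendsto_of_tendsto_of_le_of_le hlow tendsto_const_nhds (fun n ↦ ?_)
    (fun n ↦ ?_)
  · simp only
    rw [binomialRandom_apply_eq, ← pr_compl]
    refine ENNReal.ofReal_le_ofReal (pr_mono (h0 n) (h1 n) fun E hE hsim ↦ hE ?_)
    exact isSaturated_of_isSimonovits hS hr.symm hcol E hsim
  · simp only
    rw [binomialRandom_apply_eq, ← ENNReal.ofReal_one]
    exact ENNReal.ofReal_le_ofReal (pr_le_one (h0 n) (h1 n) _)
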